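/- **Setting.** Let $(\Lambda,d_\Lambda)$ be a bounded metric space with a finite Borel measure $\rho$, and let $T:\Lambda\to\Lambda$ be nonsingular (measurable, and $\rho(T^{-1}N)=0$ whenever $\rho(N)=0$). Let $Y\subset\Lambda$ be measurable with $\rho(Y)>0$, let $\alpha$ be an at most countable measurable partition of $Y$ (modulo $\rho$-null sets), and let $\tau:Y\to\{1,2,\dots\}$ be $\rho$-integrable and constant on each $a\in\alpha$, with value $\tau(a)$. Put $F=T^\tau:Y\to Y$, i.e. $Fy=T^{\tau(y)}y$. Suppose there are constants $\beta>1$, $\eta\in(0,1]$, $C_1\ge1$ such that for each $a\in\alpha$: 1. $F$ restricts to a measure-theoretic bijection (a bijection up to $\rho$-null sets) from $a$ onto $Y$; 2. $d_\Lambda(Fx,Fy)\ge\beta\, d_\Lambda(x,y)$ for all $x,y\in a$; 3. $d_\Lambda(T^\ell x,T^\ell y)\le C_1 d_\Lambda(Fx,Fy)$ for all $x,y\in a$, $0\le\ell<\tau(a)$; 4. $\zeta_0=\frac{d\rho|_Y}{d\rho|_Y\circ F}$ is positive and satisfies $|\log\zeta_0(x)-\log\zeta_0(y)|\le C_1 d_\Lambda(Fx,Fy)^\eta$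 for all $x,y\in a$. Such a $T$ is called nonuniformly expanding with return time $\tau$. Let $\mu_Y$ be the (unique) $F$-invariant probability measure on $Y$ that is absolutely continuous with respect to $\rho|_Y$. On the Young tower $\Delta=\{(y,\ell)\in Y\times\mathbb Z:0\le\ell\le\tau(y)-1\}$ let $\mu_\Delta=(\mu_Y\times\text{counting})/\int_Y\tau\,d\mu_Y$, and let $\mu=(\pi_\Delta)_*\mu_\Delta$ where $\pi_\Delta(y,\ell)=T^\ell y$; this is a $T$-invariant probability measure on $\Lambda$. Let $p\in[2,\infty)$ and suppose that $\tau\in L^p(Y,\mu_Y)$. Write $|\cdot|_q$ for the $L^q$-norm on $(\Lambda,\mu)$, and $|\tau|_p$ for the $L^p(Y,\mu_Y)$-norm of $\tau$. For $v:\Lambda\to\mathbb R^d$ (Euclidean norm on $\mathbb R^d$) let $\|v\|_\eta=\sup_{x}|v(x)|+\sup_{x\ne y}|v(x)-v(y)|/d_\Lambda(x,y)^\eta$, with the same exponent $\eta$ as above, and define $$S_nv=\sum_{0\le j<n}v\circ T^j,\qquad \mathbb S_nv=\sum_{0\le i<j<n}(v\circ T^i)\otimes(v\circ T^j),$$ where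 $a\otimes b=ab^T\in\mathbb R^{d\times d}$ and $\mathbb R^{d\times d}$ carries the norm $|J|=(\sum_{i,j}J_{ij}^2)^{1/2}$. **Theorem (Iterated moments).** For every $d$ there is a constant $C$, depending on $d$ and otherwise only, and continuously, on $\operatorname{diam}\Lambda$, $C_1$, $\beta$, $\eta$, $p$ and $|\tau|_p$, such that for every nonuniformly expanding map $T$ as above with $\tau\in L^p(Y,\mu_Y)$, $p\ge 2$, every $v:\Lambda\to\mathbb R^d$ with $\|v\|_\eta<\infty$ and $\int_\Lambda v\,d\mu=0$, and all $n\ge1$, $$\Big|\max_{k\le n}|S_kv|\Big|_{2(p-1)}\le C n^{1/2}\|v\|_\eta,\qquad \Big|\max_{k\le n}|\mathbb S_kv|\Big|_{p-1}\le C n\|v\|_\eta^2 .$$ -/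

import Mathlib

open MeasureTheory Set
open scoped NNReal ENNReal

/- Matrices carry the Frobenius norm `(∑ i, ∑ j, J i j ^ 2) ^ (1 / 2)`. -/
attribute [local instance] Matrix.frobeniusNormedAddCommGroup

/-- The induced map `F = T ^ τ`, that is `F x = T ^ (τ x) x`. Only its restriction to the domain `Y`
of the return time matters. -/
def inducedMap {Λ : Type*} (T : Λ → Λ) (τ : Λ → ℕ) (x : Λ) : Λ :=
  T^[τ x] x

/-- `T` is a nonuniformly expanding map of the bounded metric space `Λ` with reference measure `ρ`,
inducing set `Y`, partition `α` of `Y` (modulo `ρ`), return time `τ` on `Y` (only the values on `Y`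
matter), and constants `β`, `C₁`, `η`. -/
structure IsNonuniformlyExpanding {Λ : Type*} [MetricSpace Λ] [MeasurableSpace Λ]
    (ρ : Measure Λ) (T : Λ → Λ) (Y : Set Λ) (α : Set (Set Λ)) (τ : Λ → ℕ)
    (β C₁ : ℝ) (η : ℝ≥0) : Prop where
  one_lt_beta : 1 < β
  one_le_C₁ : 1 ≤ C₁
  eta_pos : 0 < η
  eta_le_one : η ≤ 1
  /-- `T` is measurable and preimages of `ρ`-null sets are `ρ`-null. -/
  nonsingular : Measure.QuasiMeasurePreserving T ρ ρ
  measurableSet_Y : MeasurableSet Y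
  measure_Y_pos : 0 < ρ Y
  countable_partition : α.Countable
  measurableSet_of_mem : ∀ a ∈ α, MeasurableSet a
  subset_of_mem : ∀ a ∈ α, a ⊆ Y
  pairwiseDisjoint : α.PairwiseDisjoint id
  measure_diff_partition : ρ (Y \ ⋃₀ α) = 0
  measurable_returnTime : Measurable τ
  returnTime_pos : ∀ a ∈ α, ∀ x ∈ a, 1 ≤ τ x
  returnTime_const : ∀ a ∈ α, ∀ x ∈ a, ∀ y ∈ a, τ x = τ y
  returnTime_integrable : IntegrableOn (fun y => (τ y : ℝ)) Y ρ
  /-- `F` restricts to a bijection from `a` onto `Y` up to `ρ`-null sets. (By `expansion` its inverse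
  is Lipschitz, so this bijection is automatically bimeasurable.) -/
  bijection : ∀ a ∈ α, ∃ a' ⊆ a, ∃ Y' ⊆ Y, MeasurableSet a' ∧ MeasurableSet Y' ∧
    ρ (a \ a') = 0 ∧ ρ (Y \ Y') = 0 ∧ BijOn (inducedMap T τ) a' Y'
  expansion : ∀ a ∈ α, ∀ x ∈ a, ∀ y ∈ a,
    β * dist x y ≤ dist (inducedMap T τ x) (inducedMap T τ y)
  intermediate : ∀ a ∈ α, ∀ x ∈ a, ∀ y ∈ a, ∀ l < τ x,
    dist (T^[l] x) (T^[l] y) ≤ C₁ * dist (inducedMap T τ x) (inducedMap T τ y)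
  /-- A positive version `ζ₀` of the density of `ρ|_Y` with respect to `ρ|_Y ∘ F` (equivalently,
  `1 / ζ₀` is the density of `ρ|_Y ∘ F` with respect to `ρ|_Y`) has bounded distortion. -/
  distortion : ∃ ζ₀ : Λ → ℝ, Measurable ζ₀ ∧ ∀ a ∈ α,
    (∀ x ∈ a, 0 < ζ₀ x) ∧
    (∀ E ⊆ a, MeasurableSet E →
      ρ.restrict Y (inducedMap T τ '' E) = ∫⁻ x in E, ENNReal.ofReal (1 / ζ₀ x) ∂ρ) ∧
    ∀ x ∈ a, ∀ y ∈ a, |Real.log (ζ₀ x) - Real.log (ζ₀ y)| ≤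
      C₁ * dist (inducedMap T τ x) (inducedMap T τ y) ^ (η : ℝ)

/-- `μY` is an `F`-invariant probability measure on `Y`, absolutely continuous with respect to
`ρ|_Y`. (For a nonuniformly expanding map there is exactly one.) -/
structure IsInducedACIP {Λ : Type*} [MeasurableSpace Λ]
    (ρ : Measure Λ) (T : Λ → Λ) (Y : Set Λ) (τ : Λ → ℕ) (μY : Measure Λ) : Prop where
  isProbabilityMeasure : IsProbabilityMeasure μY
  absolutelyContinuous : μY ≪ ρ.restrict Y
  invariant : MeasurePreserving (inducedMap T τ) μY μY

/-- The measure `μ_Δ = (μ_Y × counting) / ∫ τ dμ_Y` on the Young tower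
`Δ = {(y, ℓ) : y ∈ Y, 0 ≤ ℓ ≤ τ y - 1}`, viewed as a measure on `Λ × ℕ`
(the measure `μY` is concentrated on `Y`). -/
noncomputable def towerMeasure {Λ : Type*} [MeasurableSpace Λ]
    (τ : Λ → ℕ) (μY : Measure Λ) : Measure (Λ × ℕ) :=
  (∫⁻ y, (τ y : ℝ≥0∞) ∂μY)⁻¹ • (μY.prod Measure.count).restrict {z | z.2 < τ z.1}

/-- The `T`-invariant measure `μ = (π_Δ)_* μ_Δ` on `Λ`, where `π_Δ (y, ℓ) = T ^ ℓ y`. -/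
noncomputable def projectedMeasure {Λ : Type*} [MeasurableSpace Λ]
    (T : Λ → Λ) (τ : Λ → ℕ) (μY : Measure Λ) : Measure Λ :=
  (towerMeasure τ μY).map (fun z => T^[z.2] z.1)

/-- The Hölder norm `‖v‖_η = sup |v| + sup_{x ≠ y} |v x - v y| / d(x, y) ^ η`, with values
in `[0, ∞]`. -/
noncomputable def holderNormFull {Λ E : Type*} [MetricSpace Λ] [NormedAddCommGroup E]
    (η : ℝ≥0) (v : Λ → E) : ℝ≥0∞ :=
  (⨆ x, ‖v x‖ₑ) + eHolderNorm η v

/-- The iterated sum `𝕊_n v = ∑_{0 ≤ i < j < n} (v ∘ T ^ i) ⊗ (v ∘ T ^ j)`, where `a ⊗ b = a bᵀ`. -/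
noncomputable def iteratedSum {Λ : Type*} {d : ℕ} (T : Λ → Λ) (v : Λ → EuclideanSpace ℝ (Fin d))
    (n : ℕ) (x : Λ) : Matrix (Fin d) (Fin d) ℝ :=
  ∑ j ∈ Finset.range n, ∑ i ∈ Finset.range j,
    Matrix.vecMulVec (v (T^[i] x)).ofLp (v (T^[j] x)).ofLp

/-- `maxUpTo f n x = max_{0 ≤ k ≤ n} f k x`. -/
noncomputable def maxUpTo {Λ : Type*} (f : ℕ → Λ → ℝ) (n : ℕ) (x : Λ) : ℝ :=
  (Finset.range (n + 1)).sup' Finset.nonempty_range_add_one (fun k => f k x)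

/-! ### Elementary real inequalities -/

/-! The estimates are proved on the base, for the full-branch Gibbs–Markov map F = T^τ, and then
lifted to the tower. Inducing replaces v by φ(y) = S_{τ(y)}v(y), which is only known to be bounded
by a multiple of τ, hence to lie in L^p, while moments of order 2(p-1) ≥ p are wanted. The gain
comes from fixing n first. An excursion completed within time n has length at most n, so φ may be
replaced by its truncation u to {τ ≤ n} without changing any sum up to time n. With Z = min(τ, n)
one has ∫Z^q ≤ n^{q/2-1}∫τ^p for 2 ≤ q ≤ 2(p-1), and n such increments contribute n^{q/2}, the
diffusive order. The mean c lost by truncation is harmless: on {τ > n}, n|φ| ≤ τ² ≤ τ^p up to the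
norm of v, so n|c| is bounded.

Next, u is a martingale difference up to a bounded coboundary. Pushing measures forward by F
regularizes their densities, and two regular measures of equal mass merge exponentially fast
(`map_iterate_le_add`). So u - c has exponentially decaying correlations against L¹ functions, with
constants independent of n, and summing the transfer operator gives a bounded χ such that m = u - c
+ χ - χ∘F is orthogonal to every function of F (`exists_corrector`). Bounded distortion also makes
powers of Z quasi-independent of F. These facts feed a Rosenthal inequality
(`integral_reverseTransform_rpow_le`) and a Doob inequality
(`integral_suffixMax_reverseTransform_le`) for reverse martingales.

In an iterated sum the sum over the later index is a function of the future. Decomposing the earlier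
factor therefore gives a martingale transform whose coefficients are Birkhoff sums, of size n^{1/2},
and summation by parts leaves terms controlled by Birkhoff sums and by the sum of Z². All of these
are bounded by one function Φ with ∫Φ^{p-1} of order n^{p-1} (`exists_dominating_function`).

On the tower, an orbit starting above y finishes its column, contributing at most Z(y), and
continues from F y under the control of Φ(F y). The column weight τ(y) is quasi-independent of F y,
and ∫τ Z^{2(p-1)} ≤ n^{p-1}∫τ^p, so lifting costs no integrability
(`exists_tower_dominating_function`). The constants use only one-sided bounds on the parameters;
they are thus locally uniform and can be glued to a continuous function. -/

theorem le_of_recursion {s a b : ℝ} (hs : 1 ≤ s) (ha : 0 ≤ a) (hb : 0 ≤ b) {u : ℕ → ℝ}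
    (hu : ∀ k, 0 ≤ u k) (hu0 : u 0 = 0) {n : ℕ}
    (h : ∀ k < n, u (k + 1) ≤ u k + a * u k ^ (1 - 1 / s) + b) :
    ∀ k ≤ n, u k ≤ (2 * n * a) ^ s + 2 * n * b := by
  rcases Nat.eq_zero_or_pos n with rfl | hn
  · intro k hk
    obtain rfl : k = 0 := by omega
    rw [hu0]; positivity
  have hn' : (0 : ℝ) < n := by exact_mod_cast hn
  have hs0 : 0 < s := by linarith
  -- While u stays below X, each of the two increments is at most X/(2n), so n steps cannot leave
  -- [0, X]. The power 1 - 1/s is what Hölder's inequality leaves in the moment recursions below.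
  set X : ℝ := (2 * n * a) ^ s + 2 * n * b with hX
  have hX0 : 0 ≤ X := by positivity
  have he : 0 ≤ 1 - 1 / s := by
    rw [sub_nonneg, div_le_one hs0]; exact hs
  have h1 : 2 * n * a ≤ X ^ (1 / s) := by
    calc 2 * n * a = ((2 * n * a) ^ s) ^ (1 / s) := by
          rw [← Real.rpow_mul (by positivity), mul_one_div_cancel hs0.ne', Real.rpow_one]
      _ ≤ X ^ (1 / s) := by
          apply Real.rpow_le_rpow (by positivity) _ (by positivity)
          rw [hX]; linarith [show 0 ≤ 2 * n * b by positivity]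
  have h2 : a * X ^ (1 - 1 / s) + b ≤ X / n := by
    rw [le_div_iff₀ hn']
    have h3 : 2 * n * a * X ^ (1 - 1 / s) ≤ X := by
      calc 2 * n * a * X ^ (1 - 1 / s) ≤ X ^ (1 / s) * X ^ (1 - 1 / s) := by gcongr
        _ = X := by
          rw [← Real.rpow_add' hX0 (by simp)]; simp
    have h4 : 2 * n * b ≤ X := by
      rw [hX]; linarith [show 0 ≤ (2 * n * a) ^ s by positivity]
    nlinarith
  have key : ∀ k ≤ n, u k ≤ k * (X / n) := by
    intro k
    induction k with
    | zero => intro _; simp [hu0]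
    | succ k ih =>
      intro hk
      have hk1 := ih (by omega)
      have hkn : (k : ℝ) ≤ n := by exact_mod_cast (by omega : k ≤ n)
      have hkX : u k ≤ X := by
        refine hk1.trans ?_
        calc (k : ℝ) * (X / n) ≤ n * (X / n) := by gcongr
          _ = X := by field_simp
      have := h k (by omega)
      have h5 : a * u k ^ (1 - 1 / s) ≤ a * X ^ (1 - 1 / s) :=
        mul_le_mul_of_nonneg_left (Real.rpow_le_rpow (hu k) hkX he) ha
      push_cast
      linarith
  intro k hk
  refine (key k hk).trans ?_
  have hkn : (k : ℝ) ≤ n := by exact_mod_cast hk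
  calc (k : ℝ) * (X / n) ≤ n * (X / n) := by gcongr
    _ = X := by field_simp

/-- Convexity: `t ^ r` lies above its tangent at a + b, here evaluated at a. -/
theorem rpow_add_le_rpow_add_mul {r : ℝ} (hr : 1 ≤ r) {a b : ℝ} (ha : 0 ≤ a) (hb : 0 ≤ b) :
    (a + b) ^ r ≤ a ^ r + r * (a + b) ^ (r - 1) * b := by
  rcases eq_or_lt_of_le (add_nonneg ha hb) with h | h
  · have : a = 0 := by linarith
    have : b = 0 := by linarith
    subst_vars
    simp
  have h1 := one_add_mul_self_le_rpow_one_add (s := -b / (a + b))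
    (by rw [le_div_iff₀ h]; linarith) hr
  have h2 : 1 + -b / (a + b) = a / (a + b) := by field_simp; ring
  rw [h2, Real.div_rpow ha h.le, le_div_iff₀ (by positivity)] at h1
  have h3 : (a + b) ^ r = (a + b) ^ (r - 1) * (a + b) := by
    rw [← Real.rpow_add_one h.ne']; simp
  have h4 : (1 + r * (-b / (a + b))) * (a + b) ^ r = (a + b) ^ r - r * (a + b) ^ (r - 1) * b := by
    rw [h3]; field_simp; ring
  linarith

/-- The constant involves an upper bound Q of the exponent rather than the exponent, so that it
stays uniform when p varies. The same device is used in the moment bounds that follow. -/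
theorem rpow_add_le_two_rpow_mul {r Q : ℝ} (hr : 0 ≤ r) (hrQ : r ≤ Q) {a b : ℝ} (ha : 0 ≤ a)
    (hb : 0 ≤ b) : (a + b) ^ r ≤ 2 ^ Q * (a ^ r + b ^ r) := by
  have h0 : a + b ≤ 2 * max a b := by
    linarith [le_max_left a b, le_max_right a b]
  calc (a + b) ^ r ≤ (2 * max a b) ^ r := Real.rpow_le_rpow (by positivity) h0 hr
    _ = 2 ^ r * max a b ^ r := Real.mul_rpow (by norm_num) (le_max_of_le_left ha)
    _ ≤ 2 ^ Q * (a ^ r + b ^ r) := by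
      gcongr
      · norm_num
      · rcases le_total a b with h | h
        · rw [max_eq_right h]; linarith [Real.rpow_nonneg ha r]
        · rw [max_eq_left h]; linarith [Real.rpow_nonneg hb r]

theorem rpow_add_le_of_nonneg {r Q : ℝ} (hr : 1 ≤ r) (hrQ : r ≤ Q) {a b : ℝ} (ha : 0 ≤ a)
    (hb : 0 ≤ b) :
    (a + b) ^ r ≤ a ^ r + Q * 2 ^ Q * (a ^ (r - 1) * b + b ^ r) := by
  have h1 := rpow_add_le_rpow_add_mul hr ha hb
  have h2 : (a + b) ^ (r - 1) ≤ 2 ^ Q * (a ^ (r - 1) + b ^ (r - 1)) :=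
    rpow_add_le_two_rpow_mul (by linarith) (by linarith) ha hb
  have h3 : b ^ (r - 1) * b = b ^ r := by
    rcases eq_or_lt_of_le hb with rfl | hb'
    · rw [Real.zero_rpow (by linarith : r ≠ 0)]; simp
    · rw [← Real.rpow_add_one hb'.ne']; simp
  have hQ : 0 ≤ Q := by linarith
  calc (a + b) ^ r ≤ a ^ r + r * (a + b) ^ (r - 1) * b := h1
    _ ≤ a ^ r + Q * (2 ^ Q * (a ^ (r - 1) + b ^ (r - 1))) * b := by gcongr
    _ = a ^ r + Q * 2 ^ Q * (a ^ (r - 1) * b + b ^ (r - 1) * b) := by ring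
    _ = _ := by rw [h3]

/-- Bernoulli's inequality for 1/(1 + x) gives (1 + x)^q ≤ 1/(1 - y) with y = qx/(1 + x), and the
right side is expanded to second order. -/
theorem one_add_rpow_le {q x : ℝ} (hq : 1 ≤ q) (hx : |x| ≤ 1 / (4 * q)) :
    (1 + x) ^ q ≤ 1 + q * x + 3 * q ^ 2 * x ^ 2 := by
  have hq0 : 0 < q := by linarith
  have hx1 : |q * x| ≤ 1 / 4 := by
    rw [abs_mul, abs_of_pos hq0]
    rw [le_div_iff₀ (by positivity)] at hx
    nlinarith
  have hx2 : |x| ≤ 1 / 4 := hx.trans (by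
    apply one_div_le_one_div_of_le <;> linarith)
  obtain ⟨h1, h2⟩ := abs_le.1 hx1
  obtain ⟨h3, h4⟩ := abs_le.1 hx2
  have h5 : 0 < 1 + x := by linarith
  have hB := one_add_mul_self_le_rpow_one_add (s := -x / (1 + x))
    (by rw [le_div_iff₀ h5]; linarith) hq
  have h6 : 1 + -x / (1 + x) = 1 / (1 + x) := by field_simp; ring
  rw [h6, Real.div_rpow zero_le_one h5.le, Real.one_rpow] at hB
  set y := q * x / (1 + x) with hy
  have hyx : y * (1 + x) = q * x := by rw [hy]; field_simp
  have hy1 : |y| ≤ 1 / 3 := by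
    rw [hy, abs_div, abs_of_pos h5, div_le_iff₀ h5]; linarith
  obtain ⟨h7, h8⟩ := abs_le.1 hy1
  have hB' : 1 - y ≤ 1 / (1 + x) ^ q := by
    refine le_trans (le_of_eq ?_) hB
    rw [hy]; ring
  have hpos : 0 < (1 + x) ^ q := Real.rpow_pos_of_pos h5 q
  have h9 : (1 + x) ^ q * (1 - y) ≤ 1 := by
    rw [le_div_iff₀ hpos] at hB'; linarith
  have h10 : (1 + x) ^ q ≤ 1 / (1 - y) := by
    rw [le_div_iff₀ (by linarith)]; exact h9
  have hy4 : y ^ 2 * (1 + x) ^ 2 = q ^ 2 * x ^ 2 := by rw [← mul_pow, hyx]; ring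
  have hy2 : y ^ 2 ≤ 16 / 9 * (q ^ 2 * x ^ 2) := by
    have h13 : 0 ≤ (1 + x) ^ 2 - 9 / 16 := by nlinarith
    rw [← hy4]; nlinarith [mul_nonneg (sq_nonneg y) h13]
  have h11 : 1 / (1 - y) ≤ 1 + y + 3 / 2 * y ^ 2 := by
    rw [div_le_iff₀ (by linarith)]
    nlinarith [mul_nonneg (sq_nonneg y) (by linarith : 0 ≤ 1 - 3 * y)]
  have h12 : y ≤ q * x := by
    have : y = q * x - q * x ^ 2 / (1 + x) := by rw [hy]; field_simp; ring
    rw [this]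
    have : 0 ≤ q * x ^ 2 / (1 + x) := by positivity
    linarith
  nlinarith [mul_nonneg (sq_nonneg q) (sq_nonneg x)]

/-- If |b| is small compared with |a|, homogeneity reduces this to `one_add_rpow_le` at x = b/a;
otherwise every term is absorbed by |b|^q. The linear term is kept exact because it integrates to
zero when b is a martingale increment. -/
theorem abs_add_rpow_le {q Q : ℝ} (hq : 2 ≤ q) (hqQ : q ≤ Q) (a b : ℝ) :
    |a + b| ^ q ≤ |a| ^ q + q * (|a| ^ (q - 2) * a * b)
      + (2 * Q * (4 * Q + 1) ^ Q + 3 * Q ^ 2) * (|a| ^ (q - 2) * b ^ 2 + |b| ^ q) := by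
  have hq0 : 0 < q := by linarith
  by_cases hab : |b| * (4 * q) ≤ |a| ∧ a ≠ 0
  · obtain ⟨hab, ha⟩ := hab
    have ha' : 0 < |a| := abs_pos.2 ha
    have h1 := one_add_rpow_le (q := q) (x := b / a) (by linarith) (by
      rw [abs_div, div_le_div_iff₀ ha' (by positivity)]; linarith)
    have h2 : |a + b| ^ q = |a| ^ q * |1 + b / a| ^ q := by
      rw [← Real.mul_rpow (abs_nonneg _) (abs_nonneg _), ← abs_mul]
      congr 2; field_simp
    have hx : |b / a| ≤ 1 := by
      rw [abs_div, div_le_one ha']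
      nlinarith [abs_nonneg b]
    have h3 : |1 + b / a| = 1 + b / a := abs_of_nonneg (by linarith [(abs_le.1 hx).1])
    have h4 : |a| ^ q = |a| ^ (q - 2) * a ^ 2 := by
      rw [← sq_abs a, ← Real.rpow_natCast (|a|) 2, ← Real.rpow_add ha']; norm_num
    have h5 : |a| ^ q * (1 + q * (b / a) + 3 * q ^ 2 * (b / a) ^ 2)
        = |a| ^ q + q * (|a| ^ (q - 2) * a * b) + 3 * q ^ 2 * (|a| ^ (q - 2) * b ^ 2) := by
      rw [h4]; field_simp
    have h6 : 0 ≤ |a| ^ (q - 2) * b ^ 2 := by positivity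
    have h7 : 0 ≤ |b| ^ q := by positivity
    have h8 : 3 * q ^ 2 ≤ 3 * Q ^ 2 := by gcongr
    have h9 : 0 ≤ 2 * Q * (4 * Q + 1) ^ Q := by
      have : 0 ≤ Q := by linarith
      positivity
    calc |a + b| ^ q = |a| ^ q * (1 + b / a) ^ q := by rw [h2, h3]
      _ ≤ |a| ^ q * (1 + q * (b / a) + 3 * q ^ 2 * (b / a) ^ 2) := by gcongr
      _ = |a| ^ q + q * (|a| ^ (q - 2) * a * b) + 3 * q ^ 2 * (|a| ^ (q - 2) * b ^ 2) := h5
      _ ≤ _ := by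
        have : 3 * q ^ 2 * (|a| ^ (q - 2) * b ^ 2) ≤
          (2 * Q * (4 * Q + 1) ^ Q + 3 * Q ^ 2) * (|a| ^ (q - 2) * b ^ 2 + |b| ^ q) := by
            apply mul_le_mul _ _ h6 (by positivity) <;> linarith
        linarith
  · have hab' : |a| ≤ 4 * q * |b| := by
      by_cases ha : a = 0
      · subst ha; simp; positivity
      · have : ¬ (|b| * (4 * q) ≤ |a|) := fun h => hab ⟨h, ha⟩
        linarith
    have hb0 := abs_nonneg b
    have h41 : (1 : ℝ) ≤ 4 * q + 1 := by linarith
    have hle : (4 * q + 1) ^ q ≤ (4 * Q + 1) ^ Q := by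
      calc (4 * q + 1) ^ q ≤ (4 * Q + 1) ^ q := by gcongr
        _ ≤ (4 * Q + 1) ^ Q := Real.rpow_le_rpow_of_exponent_le (by linarith) hqQ
    have h1 : |a + b| ^ q ≤ (4 * Q + 1) ^ Q * |b| ^ q := by
      calc |a + b| ^ q ≤ ((4 * q + 1) * |b|) ^ q := by
            apply Real.rpow_le_rpow (abs_nonneg _) _ hq0.le
            linarith [abs_add_le a b]
        _ = (4 * q + 1) ^ q * |b| ^ q := Real.mul_rpow (by linarith) hb0
        _ ≤ _ := by gcongr
    have h2 : |a| ^ (q - 2) * |a| * |b| ≤ (4 * Q + 1) ^ Q * |b| ^ q := by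
      have hm : |a| ≤ (4 * q + 1) * |b| := by linarith
      have e1 : |a| ^ (q - 2) ≤ ((4 * q + 1) * |b|) ^ (q - 2) :=
        Real.rpow_le_rpow (abs_nonneg _) hm (by linarith)
      rcases eq_or_lt_of_le hb0 with hb | hb
      · rw [← hb]; simp
        rw [Real.zero_rpow hq0.ne']; simp
      calc |a| ^ (q - 2) * |a| * |b| ≤ ((4 * q + 1) * |b|) ^ (q - 2) * ((4 * q + 1) * |b|)
            * ((4 * q + 1) * |b|) := by
              gcongr
              nlinarith
        _ = ((4 * q + 1) * |b|) ^ q := by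
              have hp : 0 < (4 * q + 1) * |b| := by positivity
              rw [← Real.rpow_add_one hp.ne', ← Real.rpow_add_one hp.ne']
              congr 1; ring
        _ = (4 * q + 1) ^ q * |b| ^ q := Real.mul_rpow (by linarith) hb0
        _ ≤ _ := by gcongr
    have h3 : -(|a| ^ (q - 2) * |a| * |b|) ≤ |a| ^ (q - 2) * a * b := by
      rw [mul_assoc, mul_assoc, ← abs_mul]
      have := neg_abs_le (a * b)
      have h0 : 0 ≤ |a| ^ (q - 2) := by positivity
      nlinarith
    have h4 : 0 ≤ |a| ^ (q - 2) * b ^ 2 := by positivity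
    have h5 : 0 ≤ |b| ^ q := by positivity
    have h6 : 0 ≤ |a| ^ q := by positivity
    have hP : 0 ≤ (4 * Q + 1) ^ Q := by
      have : 0 ≤ 4 * Q + 1 := by linarith
      positivity
    have h7 : -(Q * ((4 * Q + 1) ^ Q * |b| ^ q)) ≤ q * (|a| ^ (q - 2) * a * b) := by
      have h8 : q * ((4 * Q + 1) ^ Q * |b| ^ q) ≤ Q * ((4 * Q + 1) ^ Q * |b| ^ q) := by
        gcongr
      nlinarith
    have h9 : (4 * Q + 1) ^ Q * |b| ^ q + Q * ((4 * Q + 1) ^ Q * |b| ^ q)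
        ≤ 2 * Q * (4 * Q + 1) ^ Q * |b| ^ q := by
      have : 0 ≤ (4 * Q + 1) ^ Q * |b| ^ q := by positivity
      nlinarith
    have h10 : 2 * Q * (4 * Q + 1) ^ Q * |b| ^ q ≤
      (2 * Q * (4 * Q + 1) ^ Q + 3 * Q ^ 2) * (|a| ^ (q - 2) * b ^ 2 + |b| ^ q) := by
      have hQ : 0 ≤ Q := by linarith
      have e1 : 0 ≤ 2 * Q * (4 * Q + 1) ^ Q := by positivity
      apply mul_le_mul _ _ h5 (by positivity)
      · nlinarith [sq_nonneg Q]
      · linarith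
    linarith

/-- The pointwise inequality behind Doob's `L^q` maximal inequality. -/
theorem doob_pointwise {q y g d : ℝ} (hq : 1 < q) (hgy : |g| ≤ y) :
    max |g + d| y ^ q - q / (q - 1) * (max |g + d| y ^ (q - 1) * |g + d|)
      ≤ y ^ q - q / (q - 1) * (y ^ (q - 1) * |g|)
        - q / (q - 1) * (y ^ (q - 1) * SignType.sign g * d) := by
  have hy : 0 ≤ y := (abs_nonneg g).trans hgy
  have hq1 : 0 < q - 1 := by linarith
  have hc : 0 < q / (q - 1) := by positivity
  have hyq : 0 ≤ y ^ (q - 1) := by positivity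
  -- A tangent inequality for the absolute value at g. The slope depends on g only, so the term in d
  -- will be killed by orthogonality.
  have h1 : |g| + SignType.sign g * d ≤ |g + d| := by
    rcases lt_trichotomy g 0 with h | h | h
    · rw [sign_neg h, abs_of_neg h]
      simp only [SignType.coe_neg, SignType.coe_one]
      linarith [neg_abs_le (g + d)]
    · subst h; simp
    · rw [sign_pos h, abs_of_pos h]
      simp only [SignType.coe_one]
      linarith [le_abs_self (g + d)]
  -- If |g + d| is the new maximum this is Young's inequality for |g + d| · y^(q-1); otherwise it is
  -- an equality.
  have h2 : max |g + d| y ^ q - q / (q - 1) * (max |g + d| y ^ (q - 1) * |g + d|)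
      ≤ y ^ q - q / (q - 1) * (y ^ (q - 1) * |g + d|) := by
    set x := |g + d| with hx
    have hx0 : 0 ≤ x := abs_nonneg _
    rcases le_total x y with h | h
    · rw [max_eq_right h]
    · rw [max_eq_left h]
      have hY := Real.young_inequality_of_nonneg hx0 hyq
        (Real.HolderConjugate.conjExponent hq)
      have e1 : (y ^ (q - 1)) ^ (q.conjExponent) = y ^ q := by
        rw [← Real.rpow_mul hy, Real.conjExponent]
        congr 1; field_simp
      have e2 : x ^ (q - 1) * x = x ^ q := by
        rcases eq_or_lt_of_le hx0 with h0 | h0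
        · rw [← h0, Real.zero_rpow (by linarith : q ≠ 0)]; simp
        · rw [← Real.rpow_add_one h0.ne']; simp
      rw [e1, Real.conjExponent] at hY
      rw [e2]
      have hq0 : 0 < q := by linarith
      have e3 : q / (q - 1) * (y ^ (q - 1) * x)
          ≤ q / (q - 1) * (x ^ q / q + y ^ q / (q / (q - 1))) := by
        apply mul_le_mul_of_nonneg_left _ hc.le
        linarith
      have e4 : q / (q - 1) * (x ^ q / q + y ^ q / (q / (q - 1)))
          = x ^ q / (q - 1) + y ^ q := by field_simp
      have e5 : x ^ q - q / (q - 1) * x ^ q = - (x ^ q / (q - 1)) := by field_simp; ring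
      linarith
  have h3 : q / (q - 1) * (y ^ (q - 1) * (|g| + SignType.sign g * d))
      ≤ q / (q - 1) * (y ^ (q - 1) * |g + d|) := by gcongr
  have h4 : q / (q - 1) * (y ^ (q - 1) * (|g| + SignType.sign g * d))
    = q / (q - 1) * (y ^ (q - 1) * |g|)
        + q / (q - 1) * (y ^ (q - 1) * SignType.sign g * d) := by ring
  linarith

/-! ### Bounded measurable functions -/

/-- Bounded measurable real functions. -/
def IsBddMeasurable {Ω : Type*} [MeasurableSpace Ω] (f : Ω → ℝ) : Prop :=
  Measurable f ∧ ∃ C, ∀ x, |f x| ≤ C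

namespace IsBddMeasurable

variable {Ω : Type*} [MeasurableSpace Ω] {f g : Ω → ℝ}

theorem const (c : ℝ) : IsBddMeasurable (fun _ : Ω => c) :=
  ⟨measurable_const, |c|, fun _ => le_rfl⟩

theorem add (hf : IsBddMeasurable f) (hg : IsBddMeasurable g) :
    IsBddMeasurable (fun x => f x + g x) := by
  obtain ⟨hf, C, hC⟩ := hf
  obtain ⟨hg, D, hD⟩ := hg
  exact ⟨hf.add hg, C + D, fun x => (abs_add_le _ _).trans (add_le_add (hC x) (hD x))⟩

theorem neg (hf : IsBddMeasurable f) : IsBddMeasurable (fun x => -f x) := by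
  obtain ⟨hf, C, hC⟩ := hf
  exact ⟨hf.neg, C, fun x => by rw [abs_neg]; exact hC x⟩

theorem sub (hf : IsBddMeasurable f) (hg : IsBddMeasurable g) :
    IsBddMeasurable (fun x => f x - g x) := by
  simpa [sub_eq_add_neg] using hf.add hg.neg

theorem mul (hf : IsBddMeasurable f) (hg : IsBddMeasurable g) :
    IsBddMeasurable (fun x => f x * g x) := by
  obtain ⟨hf, C, hC⟩ := hf
  obtain ⟨hg, D, hD⟩ := hg
  refine ⟨hf.mul hg, C * D, fun x => ?_⟩
  rw [abs_mul]
  exact mul_le_mul (hC x) (hD x) (abs_nonneg _) ((abs_nonneg _).trans (hC x))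

theorem abs (hf : IsBddMeasurable f) : IsBddMeasurable (fun x => |f x|) := by
  obtain ⟨hf, C, hC⟩ := hf
  exact ⟨hf.norm, C, fun x => by rw [abs_abs]; exact hC x⟩

theorem max (hf : IsBddMeasurable f) (hg : IsBddMeasurable g) :
    IsBddMeasurable (fun x => max (f x) (g x)) := by
  obtain ⟨hf, C, hC⟩ := hf
  obtain ⟨hg, D, hD⟩ := hg
  refine ⟨hf.max hg, Max.max C D, fun x => ?_⟩
  beta_reduce
  rcases le_total (f x) (g x) with h | h
  · rw [max_eq_right h]; exact (hD x).trans (le_max_right _ _)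
  · rw [max_eq_left h]; exact (hC x).trans (le_max_left _ _)

theorem rpow (hf : IsBddMeasurable f) (h0 : ∀ x, 0 ≤ f x) {q : ℝ} (hq : 0 ≤ q) :
    IsBddMeasurable (fun x => f x ^ q) := by
  obtain ⟨hf, C, hC⟩ := hf
  refine ⟨hf.pow_const q, C ^ q, fun x => ?_⟩
  rw [abs_of_nonneg (Real.rpow_nonneg (h0 x) q)]
  exact Real.rpow_le_rpow (h0 x) ((le_abs_self _).trans (hC x)) hq

theorem sq (hf : IsBddMeasurable f) : IsBddMeasurable (fun x => f x ^ 2) := by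
  simpa [pow_two] using hf.mul hf

theorem sign (hf : IsBddMeasurable f) :
    IsBddMeasurable (fun x => (SignType.sign (f x) : ℝ)) := by
  refine ⟨?_, 1, fun x => ?_⟩
  · have : (fun x => (SignType.sign (f x) : ℝ))
        = fun x => if 0 < f x then (1 : ℝ) else if f x < 0 then -1 else 0 := by
      funext x
      rcases lt_trichotomy (f x) 0 with h | h | h
      · simp [h, not_lt.2 h.le]
      · simp [h]
      · simp [h]
    rw [this]
    exact Measurable.ite (measurableSet_lt measurable_const hf.1) measurable_const
      (Measurable.ite (measurableSet_lt hf.1 measurable_const) measurable_const measurable_const)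
  · beta_reduce
    generalize SignType.sign (f x) = s
    cases s <;> simp

theorem comp (hf : IsBddMeasurable f) {F : Ω → Ω} (hF : Measurable F) :
    IsBddMeasurable (fun x => f (F x)) :=
  ⟨hf.1.comp hF, hf.2.imp fun _ h x => h (F x)⟩

theorem finset_sum {ι : Type*} (s : Finset ι) {f : ι → Ω → ℝ}
    (hf : ∀ i ∈ s, IsBddMeasurable (f i)) : IsBddMeasurable (fun x => ∑ i ∈ s, f i x) := by
  classical
  induction s using Finset.induction_on with
  | empty => simpa using const 0
  | insert a s ha ih =>
    simp only [Finset.sum_insert ha]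
    exact (hf a (by simp)).add (ih fun i hi => hf i (by simp [hi]))

theorem birkhoffSum (hf : IsBddMeasurable f) {F : Ω → Ω} (hF : Measurable F) (k : ℕ) :
    IsBddMeasurable (fun x => birkhoffSum F f k x) :=
  finset_sum _ fun i _ => hf.comp (hF.iterate i)

variable {μ : Measure Ω} [IsFiniteMeasure μ]

theorem integrable (hf : IsBddMeasurable f) : Integrable f μ := by
  obtain ⟨hf, C, hC⟩ := hf
  exact Integrable.of_bound hf.aestronglyMeasurable C (.of_forall hC)

theorem memLp (hf : IsBddMeasurable f) (p : ℝ≥0∞) : MemLp f p μ := by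
  obtain ⟨hf, C, hC⟩ := hf
  exact MemLp.of_bound hf.aestronglyMeasurable C (.of_forall hC)

end IsBddMeasurable

/-- The weighted geometric mean form of Hölder's inequality. -/
theorem integral_rpow_mul_rpow_le {Ω : Type*} [MeasurableSpace Ω] {μ : Measure Ω}
    [IsProbabilityMeasure μ] {f g : Ω → ℝ} (hf : IsBddMeasurable f) (hg : IsBddMeasurable g)
    (hf0 : ∀ x, 0 ≤ f x) (hg0 : ∀ x, 0 ≤ g x) {θ : ℝ} (h0 : 0 ≤ θ) (h1 : θ ≤ 1) :
    ∫ x, f x ^ θ * g x ^ (1 - θ) ∂μ ≤ (∫ x, f x ∂μ) ^ θ * (∫ x, g x ∂μ) ^ (1 - θ) := by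
  rcases eq_or_lt_of_le h0 with rfl | h0
  · simp
  rcases eq_or_lt_of_le h1 with rfl | h1
  · simp
  have hpq : (1 / θ).HolderConjugate (1 / (1 - θ)) := by
    rw [Real.holderConjugate_iff]
    refine ⟨by rw [lt_div_iff₀ h0]; linarith, by simp⟩
  have h2 : 0 < 1 - θ := by linarith
  have := integral_mul_le_Lp_mul_Lq_of_nonneg (μ := μ) hpq
    (f := fun x => f x ^ θ) (g := fun x => g x ^ (1 - θ))
    (.of_forall fun x => Real.rpow_nonneg (hf0 x) _)
    (.of_forall fun x => Real.rpow_nonneg (hg0 x) _)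
    ((hf.rpow hf0 h0.le).memLp _) ((hg.rpow hg0 h2.le).memLp _)
  have e1 : ∀ x, (f x ^ θ) ^ (1 / θ) = f x := fun x => by
    rw [← Real.rpow_mul (hf0 x), mul_one_div_cancel h0.ne', Real.rpow_one]
  have e2 : ∀ x, (g x ^ (1 - θ)) ^ (1 / (1 - θ)) = g x := fun x => by
    rw [← Real.rpow_mul (hg0 x), mul_one_div_cancel h2.ne', Real.rpow_one]
  simp only [e1, e2, one_div_one_div] at this
  exact this

theorem integral_rpow_le_rpow_integral {Ω : Type*} [MeasurableSpace Ω] {μ : Measure Ω}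
    [IsProbabilityMeasure μ] {f : Ω → ℝ} (hf : IsBddMeasurable f)
    (hf0 : ∀ x, 0 ≤ f x) {θ : ℝ} (h0 : 0 ≤ θ) (h1 : θ ≤ 1) :
    ∫ x, f x ^ θ ∂μ ≤ (∫ x, f x ∂μ) ^ θ := by
  simpa using integral_rpow_mul_rpow_le (μ := μ) hf (.const 1) hf0 (fun _ => zero_le_one) h0 h1

theorem integral_comp_of_measurePreserving {Ω : Type*} [MeasurableSpace Ω] {μ : Measure Ω}
    {F : Ω → Ω} (hF : MeasurePreserving F μ μ) {f : Ω → ℝ} (hf : IsBddMeasurable f) :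
    ∫ x, f (F x) ∂μ = ∫ x, f x ∂μ := by
  have h := integral_map (μ := μ) hF.measurable.aemeasurable (f := f)
    (by rw [hF.map_eq]; exact hf.1.aestronglyMeasurable)
  rw [hF.map_eq] at h
  exact h.symm

/-! ### Reverse martingales along the orbits of a measure preserving map -/

/-- The reverse martingale transform `∑_{i < k} m ∘ F^i * e_{k-1-i} ∘ F^(i+1)`. -/
def reverseTransform {Ω : Type*} (F : Ω → Ω) (m : Ω → ℝ) (e : ℕ → Ω → ℝ) : ℕ → Ω → ℝ
  | 0 => fun _ => 0
  | k + 1 => fun x => m x * e k (F x) + reverseTransform F m e k (F x)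

/-- `suffixMax F g n x = max_{k + l = n} |g k (F^l x)|`. -/
def suffixMax {Ω : Type*} (F : Ω → Ω) (g : ℕ → Ω → ℝ) : ℕ → Ω → ℝ
  | 0 => fun x => |g 0 x|
  | k + 1 => fun x => max |g (k + 1) x| (suffixMax F g k (F x))

section suffixMax

variable {Ω : Type*} {F : Ω → Ω} {g : ℕ → Ω → ℝ}

theorem abs_le_suffixMax (k l : ℕ) (x : Ω) : |g k (F^[l] x)| ≤ suffixMax F g (k + l) x := by
  induction l generalizing x with
  | zero => cases k <;> simp [suffixMax]
  | succ l ih => exact (ih (F x)).trans (le_max_right _ _)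

theorem suffixMax_le {n : ℕ} {x : Ω} {B : ℝ}
    (h : ∀ k l, k + l = n → |g k (F^[l] x)| ≤ B) : suffixMax F g n x ≤ B := by
  induction n generalizing x with
  | zero => exact h 0 0 rfl
  | succ n ih =>
    refine max_le (h (n + 1) 0 rfl) (ih fun k l hkl => ?_)
    exact h k (l + 1) (by omega)

theorem suffixMax_nonneg (n : ℕ) (x : Ω) : 0 ≤ suffixMax F g n x :=
  (abs_nonneg _).trans (abs_le_suffixMax (F := F) (g := g) n 0 x)

theorem abs_le_suffixMax_self (n : ℕ) (x : Ω) : |g n x| ≤ suffixMax F g n x :=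
  abs_le_suffixMax (F := F) (g := g) n 0 x

variable [MeasurableSpace Ω]

theorem IsBddMeasurable.suffixMax (hF : Measurable F) (hg : ∀ k, IsBddMeasurable (g k)) (n : ℕ) :
    IsBddMeasurable (suffixMax F g n) := by
  induction n with
  | zero => exact (hg 0).abs
  | succ n ih => exact (hg (n + 1)).abs.max (ih.comp hF)

theorem IsBddMeasurable.reverseTransform {m : Ω → ℝ} {e : ℕ → Ω → ℝ} (hF : Measurable F)
    (hm : IsBddMeasurable m) (he : ∀ k, IsBddMeasurable (e k)) (n : ℕ) :
    IsBddMeasurable (reverseTransform F m e n) := by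
  induction n with
  | zero => exact .const 0
  | succ n ih => exact (hm.mul ((he n).comp hF)).add (ih.comp hF)

end suffixMax

/-! ### Rosenthal and Doob inequalities for reverse martingales. -/

section moments

variable {Ω : Type*} [MeasurableSpace Ω] {μ : Measure Ω} [IsProbabilityMeasure μ] {F : Ω → Ω}

/-- A Rosenthal inequality: σ and κ bound the conditional second and q-th moments of m given F, and
ε the L^q norm of the coefficients. The new increment m · e∘F is added to g∘F and `abs_add_rpow_le`
is applied; the first-order term vanishes, since its coefficient is a function of F x, and what
remains is the recursion of `le_of_recursion` with s = q/2. -/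
theorem integral_reverseTransform_rpow_le (hF : MeasurePreserving F μ μ) {m : Ω → ℝ}
    {e : ℕ → Ω → ℝ} (hm : IsBddMeasurable m) (he : ∀ k, IsBddMeasurable (e k))
    (horth : ∀ h : Ω → ℝ, IsBddMeasurable h → ∫ x, m x * h (F x) ∂μ = 0)
    {q Q σ κ ε : ℝ} (hq : 2 ≤ q) (hqQ : q ≤ Q) (hσ0 : 0 ≤ σ) (hκ0 : 0 ≤ κ) (hε0 : 0 ≤ ε)
    (hσ : ∀ h : Ω → ℝ, IsBddMeasurable h → (∀ x, 0 ≤ h x) →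
      ∫ x, m x ^ 2 * h (F x) ∂μ ≤ σ * ∫ x, h x ∂μ)
    (hκ : ∀ h : Ω → ℝ, IsBddMeasurable h → (∀ x, 0 ≤ h x) →
      ∫ x, |m x| ^ q * h (F x) ∂μ ≤ κ * ∫ x, h x ∂μ)
    {n : ℕ} (hE : ∀ k < n, ∫ x, |e k x| ^ q ∂μ ≤ ε ^ q) {c : ℝ}
    (hc : c = 2 * Q * (4 * Q + 1) ^ Q + 3 * Q ^ 2) :
    ∀ k ≤ n, ∫ x, |reverseTransform F m e k x| ^ q ∂μ
      ≤ (2 * n * (c * (σ * ε ^ 2))) ^ (q / 2) + 2 * n * (c * (κ * ε ^ q)) := by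
  have hq0 : 0 < q := by linarith
  have hc0 : 0 ≤ c := by
    have : 0 ≤ Q := by linarith
    rw [hc]; positivity
  set g := reverseTransform F m e with hg
  have hgB : ∀ k, IsBddMeasurable (g k) := fun k => .reverseTransform hF.measurable hm he k
  have hgq : ∀ k, IsBddMeasurable (fun x => |g k x| ^ q) := fun k =>
    (hgB k).abs.rpow (fun _ => abs_nonneg _) hq0.le
  have hgq2 : ∀ k, IsBddMeasurable (fun x => |g k x| ^ (q - 2)) := fun k =>
    (hgB k).abs.rpow (fun _ => abs_nonneg _) (by linarith)
  refine le_of_recursion (u := fun k => ∫ x, |g k x| ^ q ∂μ) (by linarith) (by positivity)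
    (by positivity) (fun k => integral_nonneg fun x => by positivity) ?_ fun k hk => ?_
  · simp [hg, reverseTransform, Real.zero_rpow hq0.ne']
  have hb : IsBddMeasurable (fun x => m x * e k (F x)) := hm.mul ((he k).comp hF.measurable)
  have hmq : IsBddMeasurable (fun x => |m x * e k (F x)| ^ q) :=
    hb.abs.rpow (fun _ => abs_nonneg _) hq0.le
  have i1 := ((hgq k).comp hF.measurable).integrable (μ := μ)
  have B2 : IsBddMeasurable (fun x => |g k (F x)| ^ (q - 2) * g k (F x) * (m x * e k (F x))) :=
    (((hgq2 k).comp hF.measurable).mul ((hgB k).comp hF.measurable)).mul hb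
  have B3 : IsBddMeasurable (fun x => |g k (F x)| ^ (q - 2) * (m x * e k (F x)) ^ 2) :=
    ((hgq2 k).comp hF.measurable).mul hb.sq
  have step : ∫ x, |g (k + 1) x| ^ q ∂μ ≤ ∫ x, (|g k (F x)| ^ q
      + q * (|g k (F x)| ^ (q - 2) * g k (F x) * (m x * e k (F x))))
      + c * (|g k (F x)| ^ (q - 2) * (m x * e k (F x)) ^ 2 + |m x * e k (F x)| ^ q) ∂μ := by
    refine integral_mono (hgq (k + 1)).integrable
      ((i1.add (B2.integrable.const_mul q)).add ((B3.add hmq).integrable.const_mul c)) fun x => ?_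
    have := abs_add_rpow_le hq hqQ (g k (F x)) (m x * e k (F x))
    rw [← hc] at this
    change |m x * e k (F x) + g k (F x)| ^ q ≤ _
    rw [add_comm]; exact this
  have B4 : IsBddMeasurable (fun x => |g k (F x)| ^ q
      + q * (|g k (F x)| ^ (q - 2) * g k (F x) * (m x * e k (F x)))) :=
    ((hgq k).comp hF.measurable).add ((IsBddMeasurable.const q).mul B2)
  rw [integral_add B4.integrable ((B3.add hmq).integrable.const_mul c),
    integral_add i1 (B2.integrable.const_mul q), integral_const_mul, integral_const_mul,
    integral_add B3.integrable hmq.integrable,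
    integral_comp_of_measurePreserving hF (hgq k)] at step
  have z1 : ∫ x, |g k (F x)| ^ (q - 2) * g k (F x) * (m x * e k (F x)) ∂μ = 0 := by
    rw [← horth _ (((hgq2 k).mul (hgB k)).mul (he k))]
    congr 1; funext x; ring
  have hθ0 : 0 ≤ 2 / q := by positivity
  have hθ1 : 2 / q ≤ 1 := by rw [div_le_one hq0]; exact hq
  have heq : IsBddMeasurable (fun x => |e k x| ^ q) :=
    (he k).abs.rpow (fun _ => abs_nonneg _) hq0.le
  -- The hypothesis on σ removes m², and Hölder with weights 2/q and 1 - 2/q separates the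
  -- coefficient from the accumulated sum.
  have z2 : ∫ x, |g k (F x)| ^ (q - 2) * (m x * e k (F x)) ^ 2 ∂μ
      ≤ σ * (ε ^ 2 * (∫ x, |g k x| ^ q ∂μ) ^ (1 - 1 / (q / 2))) := by
    calc ∫ x, |g k (F x)| ^ (q - 2) * (m x * e k (F x)) ^ 2 ∂μ
        = ∫ x, m x ^ 2 * (e k (F x) ^ 2 * |g k (F x)| ^ (q - 2)) ∂μ := by
          congr 1; funext x; ring
      _ ≤ σ * ∫ x, e k x ^ 2 * |g k x| ^ (q - 2) ∂μ :=
          hσ (fun x => e k x ^ 2 * |g k x| ^ (q - 2)) ((he k).sq.mul (hgq2 k))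
            (fun x => by positivity)
      _ = σ * ∫ x, (|e k x| ^ q) ^ (2 / q) * (|g k x| ^ q) ^ (1 - 2 / q) ∂μ := by
          congr 2; funext x
          rw [← Real.rpow_mul (abs_nonneg _), ← Real.rpow_mul (abs_nonneg _),
            mul_div_cancel₀ _ hq0.ne', mul_sub, mul_div_cancel₀ _ hq0.ne', mul_one]
          congr 1
          rw [← sq_abs]; norm_num
      _ ≤ σ * ((∫ x, |e k x| ^ q ∂μ) ^ (2 / q) * (∫ x, |g k x| ^ q ∂μ) ^ (1 - 2 / q)) := by
          gcongr
          exact integral_rpow_mul_rpow_le heq (hgq k) (fun _ => by positivity)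
            (fun _ => by positivity) hθ0 hθ1
      _ ≤ σ * ((ε ^ q) ^ (2 / q) * (∫ x, |g k x| ^ q ∂μ) ^ (1 - 2 / q)) := by
          have : 0 ≤ (∫ x, |g k x| ^ q ∂μ) ^ (1 - 2 / q) :=
            Real.rpow_nonneg (integral_nonneg fun _ => by positivity) _
          have h2 := Real.rpow_le_rpow (integral_nonneg fun _ => by positivity) (hE k hk) hθ0
          gcongr
      _ = _ := by
          rw [← Real.rpow_mul hε0, mul_div_cancel₀ _ hq0.ne', one_div_div]; norm_num
  have z3 : ∫ x, |m x * e k (F x)| ^ q ∂μ ≤ κ * ε ^ q := by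
    calc ∫ x, |m x * e k (F x)| ^ q ∂μ = ∫ x, |m x| ^ q * |e k (F x)| ^ q ∂μ := by
          congr 1; funext x
          rw [abs_mul, Real.mul_rpow (abs_nonneg _) (abs_nonneg _)]
      _ ≤ κ * ∫ x, |e k x| ^ q ∂μ := hκ (fun x => |e k x| ^ q) heq (fun _ => by positivity)
      _ ≤ κ * ε ^ q := by gcongr; exact hE k hk
  rw [z1, mul_zero, add_zero] at step
  calc ∫ x, |g (k + 1) x| ^ q ∂μ
      ≤ ∫ x, |g k x| ^ q ∂μ + c * (σ * (ε ^ 2 * (∫ x, |g k x| ^ q ∂μ) ^ (1 - 1 / (q / 2)))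
        + κ * ε ^ q) := by
        refine step.trans ?_; gcongr
    _ = _ := by ring

/-- Doob's inequality without stopping times: by `doob_pointwise` and orthogonality the integral of
W^q - q/(q-1) · W^(q-1)|g| does not increase from one step to the next, so it stays nonpositive.
Hölder then bounds the L^q norm of W by q/(q-1) ≤ 2 times that of g. -/
theorem integral_suffixMax_reverseTransform_le (hF : MeasurePreserving F μ μ) {m : Ω → ℝ}
    {e : ℕ → Ω → ℝ} (hm : IsBddMeasurable m) (he : ∀ k, IsBddMeasurable (e k))
    (horth : ∀ h : Ω → ℝ, IsBddMeasurable h → ∫ x, m x * h (F x) ∂μ = 0)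
    {q : ℝ} (hq : 2 ≤ q) (n : ℕ) :
    ∫ x, suffixMax F (reverseTransform F m e) n x ^ q ∂μ
      ≤ 2 ^ q * ∫ x, |reverseTransform F m e n x| ^ q ∂μ := by
  have hq0 : 0 < q := by linarith
  set g := reverseTransform F m e with hg
  have hgB : ∀ k, IsBddMeasurable (g k) := fun k => .reverseTransform hF.measurable hm he k
  set W := suffixMax F g with hW
  have hWB : ∀ k, IsBddMeasurable (W k) := fun k => .suffixMax hF.measurable hgB k
  have hW0 : ∀ k x, 0 ≤ W k x := fun k x => suffixMax_nonneg k x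
  have hWq : ∀ k, IsBddMeasurable (fun x => W k x ^ q) := fun k =>
    (hWB k).rpow (hW0 k) hq0.le
  have hWq1 : ∀ k, IsBddMeasurable (fun x => W k x ^ (q - 1)) := fun k =>
    (hWB k).rpow (hW0 k) (by linarith)
  have hUB : ∀ k, IsBddMeasurable
      (fun x => W k x ^ q - q / (q - 1) * (W k x ^ (q - 1) * |g k x|)) := fun k =>
    (hWq k).sub ((IsBddMeasurable.const _).mul ((hWq1 k).mul (hgB k).abs))
  have hU : ∀ k, ∫ x, W k x ^ q - q / (q - 1) * (W k x ^ (q - 1) * |g k x|) ∂μ ≤ 0 := by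
    intro k
    induction k with
    | zero =>
      apply le_of_eq
      have : ∀ x, W 0 x = 0 := fun x => by simp [hW, hg, suffixMax, reverseTransform]
      simp [this, Real.zero_rpow hq0.ne', Real.zero_rpow (by linarith : q - 1 ≠ 0)]
    | succ k ih =>
      have hh : IsBddMeasurable
          (fun x => W k x ^ (q - 1) * (SignType.sign (g k x) : ℝ) * e k x) :=
        ((hWq1 k).mul (hgB k).sign).mul (he k)
      have hb : IsBddMeasurable (fun x => q / (q - 1) *
          (m x * (W k (F x) ^ (q - 1) * (SignType.sign (g k (F x)) : ℝ) * e k (F x)))) :=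
        (IsBddMeasurable.const _).mul (hm.mul (hh.comp hF.measurable))
      have h1 : ∫ x, W (k + 1) x ^ q - q / (q - 1) * (W (k + 1) x ^ (q - 1) * |g (k + 1) x|) ∂μ
        ≤ ∫ x, (W k (F x) ^ q - q / (q - 1) * (W k (F x) ^ (q - 1) * |g k (F x)|))
          - q / (q - 1) *
          (m x * (W k (F x) ^ (q - 1) * (SignType.sign (g k (F x)) : ℝ) * e k (F x))) ∂μ := by
        refine integral_mono (hUB (k + 1)).integrable
          (((hUB k).comp hF.measurable).sub hb).integrable fun x => ?_
        have h2 := doob_pointwise (q := q) (y := W k (F x)) (g := g k (F x))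
          (d := m x * e k (F x)) (by linarith) (abs_le_suffixMax_self k (F x))
        have e1 : g (k + 1) x = g k (F x) + m x * e k (F x) := by
          simp only [hg, reverseTransform]; ring
        have e2 : W (k + 1) x = max |g k (F x) + m x * e k (F x)| (W k (F x)) := by
          rw [← e1]; simp only [hW, suffixMax]
        beta_reduce
        rw [e2, e1]
        refine h2.trans (le_of_eq ?_)
        ring
      rw [integral_sub ((hUB k).comp hF.measurable).integrable hb.integrable,
        integral_const_mul, horth _ hh, mul_zero, sub_zero,
        integral_comp_of_measurePreserving hF (hUB k)] at h1
      exact h1.trans ih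
  set A := ∫ x, W n x ^ q ∂μ with hA
  set G := ∫ x, |g n x| ^ q ∂μ with hG
  have hA0 : 0 ≤ A := integral_nonneg fun x => Real.rpow_nonneg (hW0 n x) q
  have hG0 : 0 ≤ G := integral_nonneg fun x => by positivity
  have h1 := hU n
  have hmul : IsBddMeasurable (fun x => q / (q - 1) * (W n x ^ (q - 1) * |g n x|)) :=
    (IsBddMeasurable.const _).mul ((hWq1 n).mul (hgB n).abs)
  rw [integral_sub (hWq n).integrable hmul.integrable, integral_const_mul] at h1
  have h2 : ∫ x, W n x ^ (q - 1) * |g n x| ∂μ ≤ A ^ (1 - 1 / q) * G ^ (1 / q) := by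
    have hθ1 : 1 - 1 / q ≤ 1 := by simp; linarith
    have hθ0 : 0 ≤ 1 - 1 / q := by
      rw [sub_nonneg, div_le_one hq0]; linarith
    have := integral_rpow_mul_rpow_le (μ := μ) (hWq n) ((hgB n).abs.rpow (fun _ => abs_nonneg _)
      hq0.le) (fun x => Real.rpow_nonneg (hW0 n x) q) (fun x => Real.rpow_nonneg (abs_nonneg _) q)
      hθ0 hθ1
    rw [sub_sub_cancel] at this
    refine le_trans (le_of_eq ?_) this
    congr 1; funext x
    rw [← Real.rpow_mul (hW0 n x), ← Real.rpow_mul (abs_nonneg _), mul_sub,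
      mul_one_div_cancel hq0.ne', mul_one, Real.rpow_one]
  have h3 : q / (q - 1) ≤ 2 := by
    rw [div_le_iff₀ (by linarith)]; linarith
  have h4 : A ≤ 2 * (A ^ (1 - 1 / q) * G ^ (1 / q)) := by
    have h5 : 0 ≤ A ^ (1 - 1 / q) * G ^ (1 / q) := by positivity
    have h6 : 0 < q / (q - 1) := div_pos hq0 (by linarith)
    nlinarith
  rcases eq_or_lt_of_le hA0 with hA00 | hApos
  · rw [← hA00]; positivity
  have h5 : A ^ (1 / q) ≤ 2 * G ^ (1 / q) := by
    have e : A = A ^ (1 - 1 / q) * A ^ (1 / q) := by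
      rw [← Real.rpow_add hApos]; simp
    have hp : 0 < A ^ (1 - 1 / q) := by positivity
    have : A ^ (1 - 1 / q) * A ^ (1 / q) ≤ A ^ (1 - 1 / q) * (2 * G ^ (1 / q)) := by
      rw [← e]; linarith
    exact le_of_mul_le_mul_left this hp
  calc A = (A ^ (1 / q)) ^ q := by
        rw [← Real.rpow_mul hA0, one_div_mul_cancel hq0.ne', Real.rpow_one]
    _ ≤ (2 * G ^ (1 / q)) ^ q := Real.rpow_le_rpow (by positivity) h5 hq0.le
    _ = 2 ^ q * G := by
        rw [Real.mul_rpow (by norm_num) (by positivity), ← Real.rpow_mul hG0,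
          one_div_mul_cancel hq0.ne', Real.rpow_one]

/-- For nonnegative summands there is no cancellation to exploit, so a first-order expansion
suffices; ζ bounds the conditional mean of Z given F. It serves for sums of squared excursion
lengths. -/
theorem integral_birkhoffSum_rpow_le (hF : MeasurePreserving F μ μ) {Z : Ω → ℝ}
    (hZ : IsBddMeasurable Z) (hZ0 : ∀ x, 0 ≤ Z x) {r Q ζ : ℝ} (hr : 1 ≤ r) (hrQ : r ≤ Q)
    (hζ0 : 0 ≤ ζ)
    (hζ : ∀ h : Ω → ℝ, IsBddMeasurable h → (∀ x, 0 ≤ h x) →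
      ∫ x, Z x * h (F x) ∂μ ≤ ζ * ∫ x, h x ∂μ) (n : ℕ) :
    ∫ x, birkhoffSum F Z n x ^ r ∂μ
      ≤ (2 * n * (Q * 2 ^ Q * ζ)) ^ r + 2 * n * (Q * 2 ^ Q * ∫ x, Z x ^ r ∂μ) := by
  have hr0 : 0 < r := by linarith
  have hQ : 0 ≤ Q := by linarith
  have hB : ∀ k, IsBddMeasurable (fun x => birkhoffSum F Z k x) := fun k =>
    hZ.birkhoffSum hF.measurable k
  have hB0 : ∀ k x, 0 ≤ birkhoffSum F Z k x := fun k x =>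
    Finset.sum_nonneg fun i _ => hZ0 _
  have hBr : ∀ k, IsBddMeasurable (fun x => birkhoffSum F Z k x ^ r) := fun k =>
    (hB k).rpow (hB0 k) hr0.le
  have hBr1 : ∀ k, IsBddMeasurable (fun x => birkhoffSum F Z k x ^ (r - 1)) := fun k =>
    (hB k).rpow (hB0 k) (by linarith)
  have hZr : IsBddMeasurable (fun x => Z x ^ r) := hZ.rpow hZ0 hr0.le
  have hZi : 0 ≤ ∫ x, Z x ^ r ∂μ := integral_nonneg fun x => Real.rpow_nonneg (hZ0 x) r
  refine le_of_recursion (u := fun k => ∫ x, birkhoffSum F Z k x ^ r ∂μ) hr (by positivity)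
    (by positivity) (fun k => integral_nonneg fun x => Real.rpow_nonneg (hB0 k x) r) ?_
    (fun k hk => ?_) n le_rfl
  · simp [Real.zero_rpow hr0.ne']
  have i2 : IsBddMeasurable (fun x => birkhoffSum F Z k (F x) ^ (r - 1) * Z x) :=
    ((hBr1 k).comp hF.measurable).mul hZ
  have h1 : ∫ x, birkhoffSum F Z (k + 1) x ^ r ∂μ ≤ ∫ x, birkhoffSum F Z k (F x) ^ r
      + Q * 2 ^ Q * (birkhoffSum F Z k (F x) ^ (r - 1) * Z x + Z x ^ r) ∂μ := by
    refine integral_mono (hBr _).integrable (((hBr k).comp hF.measurable).add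
      ((IsBddMeasurable.const _).mul (i2.add hZr))).integrable fun x => ?_
    have := rpow_add_le_of_nonneg hr hrQ (hB0 k (F x)) (hZ0 x)
    beta_reduce
    rw [birkhoffSum_succ', add_comm]
    exact this
  rw [integral_add ((hBr k).comp hF.measurable).integrable
    ((IsBddMeasurable.const _).mul (i2.add hZr)).integrable, integral_const_mul,
    integral_add i2.integrable hZr.integrable,
    integral_comp_of_measurePreserving hF (hBr k)] at h1
  have h2 : ∫ x, birkhoffSum F Z k (F x) ^ (r - 1) * Z x ∂μ
      ≤ ζ * (∫ x, birkhoffSum F Z k x ^ r ∂μ) ^ (1 - 1 / r) := by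
    calc ∫ x, birkhoffSum F Z k (F x) ^ (r - 1) * Z x ∂μ
        = ∫ x, Z x * birkhoffSum F Z k (F x) ^ (r - 1) ∂μ := by
          congr 1; funext x; ring
      _ ≤ ζ * ∫ x, birkhoffSum F Z k x ^ (r - 1) ∂μ := hζ (fun x => birkhoffSum F Z k x ^ (r - 1))
          (hBr1 k) (fun x => Real.rpow_nonneg (hB0 k x) _)
      _ = ζ * ∫ x, (birkhoffSum F Z k x ^ r) ^ (1 - 1 / r) ∂μ := by
          congr 2; funext x
          rw [← Real.rpow_mul (hB0 k x), mul_sub, mul_one_div_cancel hr0.ne', mul_one]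
      _ ≤ _ := by
          gcongr
          refine integral_rpow_le_rpow_integral (hBr k) (fun x => Real.rpow_nonneg (hB0 k x) r)
            ?_ ?_
          · rw [sub_nonneg, div_le_one hr0]; exact hr
          · simp; linarith
  calc ∫ x, birkhoffSum F Z (k + 1) x ^ r ∂μ
      ≤ ∫ x, birkhoffSum F Z k x ^ r ∂μ + Q * 2 ^ Q *
        (ζ * (∫ x, birkhoffSum F Z k x ^ r ∂μ) ^ (1 - 1 / r) + ∫ x, Z x ^ r ∂μ) := by
        refine h1.trans ?_
        gcongr
    _ = _ := by ring

end moments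

/-! ### Measures with log-Hölder densities -/

/-- The measure `ν` has, relative to `m`, a density whose logarithm is `η`-Hölder with
constant `R`. -/
def IsLogHolder {Λ : Type*} [MetricSpace Λ] [MeasurableSpace Λ] (m : Measure Λ) (η R : ℝ)
    (ν : Measure Λ) : Prop :=
  ∀ E E', MeasurableSet E → MeasurableSet E' → ∀ δ : ℝ, 0 ≤ δ →
    (∀ x ∈ E, ∀ y ∈ E', dist x y ^ η ≤ δ) →
    ν E * m E' ≤ ENNReal.ofReal (Real.exp (R * δ)) * (ν E' * m E)

/-- Full branch Gibbs–Markov maps with respect to the measure `m`. The function `j` is the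
Jacobian of the map on the elements of the partition `α`. -/
structure IsGibbsMarkov {Λ : Type*} [MetricSpace Λ] [MeasurableSpace Λ] (m : Measure Λ)
    (F : Λ → Λ) (α : Set (Set Λ)) (j : Λ → ℝ≥0∞) (η θ K t₀ : ℝ) : Prop where
  measurable : Measurable F
  countable : α.Countable
  measurableSet : ∀ a ∈ α, MeasurableSet a
  pairwiseDisjoint : α.PairwiseDisjoint id
  measure_compl : m (⋃₀ α)ᶜ = 0
  theta_nonneg : 0 ≤ θ
  theta_lt_one : θ < 1
  K_pos : 0 < K
  contraction : ∀ a ∈ α, ∀ x ∈ a, ∀ y ∈ a, dist x y ^ η ≤ θ * dist (F x) (F y) ^ η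
  branch : ∀ a ∈ α, ∀ E, MeasurableSet E → ∫⁻ x in a ∩ F ⁻¹' E, j x ∂m = m E
  distortion : ∀ a ∈ α, ∀ x ∈ a, ∀ y ∈ a,
    j x ≤ ENNReal.ofReal (Real.exp (K * dist (F x) (F y) ^ η)) * j y
  dist_rpow_le : ∀ x y : Λ, dist x y ^ η ≤ t₀
  t₀_nonneg : 0 ≤ t₀
  dist_le : ∃ D, 0 ≤ D ∧ ∀ x y : Λ, dist x y ≤ D * dist x y ^ η

/-- Replace w on A and j on A' by their suprema; the oscillation bounds turn these back into
integrals over the other set. Like `IsLogHolder`, the inequality is cross-multiplied and speaks of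
sets, so no version of a density of ν has to be chosen. -/
theorem setLIntegral_mul_setLIntegral_le {Λ : Type*} [MeasurableSpace Λ] {ν m : Measure Λ}
    {A A' : Set Λ} (hA : MeasurableSet A) {w j : Λ → ℝ≥0∞}
    (hw : Measurable w) {c c' c'' : ℝ≥0∞} (hν : ν A * m A' ≤ c'' * (ν A' * m A))
    (hwA : ∀ x ∈ A, ∀ y ∈ A', w x ≤ c * w y) (hjA : ∀ x ∈ A, ∀ y ∈ A', j y ≤ c' * j x)
    (hc' : c' ≠ ∞) :
    (∫⁻ x in A, w x ∂ν) * (∫⁻ x in A', j x ∂m)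
      ≤ c * c' * c'' * ((∫⁻ x in A', w x ∂ν) * ∫⁻ x in A, j x ∂m) := by
  set s := ⨆ x : A, w x
  set J := ⨆ x : A', j x
  have h1 : ∫⁻ x in A, w x ∂ν ≤ s * ν A := by
    rw [← setLIntegral_const]
    exact setLIntegral_mono measurable_const fun x hx => le_iSup (fun x : A => w x) ⟨x, hx⟩
  have h2 : ∫⁻ x in A', j x ∂m ≤ J * m A' := by
    rw [← setLIntegral_const]
    exact setLIntegral_mono measurable_const fun x hx => le_iSup (fun x : A' => j x) ⟨x, hx⟩
  have h3 : s * ν A' ≤ c * ∫⁻ x in A', w x ∂ν := by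
    rw [ENNReal.iSup_mul]
    refine iSup_le fun x => ?_
    rw [← setLIntegral_const, ← lintegral_const_mul _ hw]
    exact setLIntegral_mono (hw.const_mul c) fun y hy => hwA x x.2 y hy
  have h4 : J * m A ≤ c' * ∫⁻ x in A, j x ∂m := by
    rw [ENNReal.iSup_mul]
    refine iSup_le fun y => ?_
    rw [← setLIntegral_const, ← lintegral_const_mul' _ _ hc']
    exact setLIntegral_mono' hA fun x hx => hjA x hx y y.2
  calc (∫⁻ x in A, w x ∂ν) * (∫⁻ x in A', j x ∂m) ≤ (s * ν A) * (J * m A') := by gcongr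
    _ = s * J * (ν A * m A') := by ring
    _ ≤ s * J * (c'' * (ν A' * m A)) := by gcongr
    _ = c'' * ((s * ν A') * (J * m A)) := by ring
    _ ≤ c'' * ((c * ∫⁻ x in A', w x ∂ν) * (c' * ∫⁻ x in A, j x ∂m)) := by gcongr
    _ = _ := by ring

namespace IsLogHolder

variable {Λ : Type*} [MetricSpace Λ] [MeasurableSpace Λ] {m ν : Measure Λ} {η R R' L t₀ : ℝ}

theorem mono (h : IsLogHolder m η R ν) (hR : R ≤ R') : IsLogHolder m η R' ν := by
  intro E E' hE hE' δ hδ hd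
  refine (h E E' hE hE' δ hδ hd).trans ?_
  gcongr

theorem self : IsLogHolder m η 0 m := by
  intro E E' hE hE' δ hδ hd
  simp [mul_comm]

theorem withDensity (h : IsLogHolder m η R ν) {w : Λ → ℝ≥0∞} (hw : Measurable w) (hL : 0 ≤ L)
    (hwL : ∀ x y, w x ≤ ENNReal.ofReal (Real.exp (L * dist x y ^ η)) * w y) :
    IsLogHolder m η (R + L) (ν.withDensity w) := by
  intro E E' hE hE' δ hδ hd
  have := setLIntegral_mul_setLIntegral_le (ν := ν) (m := m) (w := w) (j := fun _ => 1)
    (c := ENNReal.ofReal (Real.exp (L * δ))) (c' := 1) hE hw (h E E' hE hE' δ hδ hd)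
    (fun x hx y hy => (hwL x y).trans (by
      have := hd x hx y hy
      gcongr)) (fun _ _ _ _ => by simp) (by simp)
  rw [withDensity_apply _ hE, withDensity_apply _ hE']
  simp only [setLIntegral_one, mul_one] at this
  rw [← ENNReal.ofReal_mul (Real.exp_nonneg _), ← Real.exp_add] at this
  rw [add_mul, add_comm]
  exact this

variable [IsProbabilityMeasure m]

theorem le_mul (h : IsLogHolder m η R ν) (ht : ∀ x y : Λ, dist x y ^ η ≤ t₀) (ht0 : 0 ≤ t₀)
    {E : Set Λ} (hE : MeasurableSet E) :
    ν E ≤ ENNReal.ofReal (Real.exp (R * t₀)) * (ν univ * m E) := by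
  simpa using h E univ hE .univ t₀ ht0 fun x _ y _ => ht x y

theorem mul_le (h : IsLogHolder m η R ν) (ht : ∀ x y : Λ, dist x y ^ η ≤ t₀) (ht0 : 0 ≤ t₀)
    {E : Set Λ} (hE : MeasurableSet E) :
    ν univ * m E ≤ ENNReal.ofReal (Real.exp (R * t₀)) * ν E := by
  simpa using h univ E .univ hE t₀ ht0 fun x _ y _ => ht x y

theorem absolutelyContinuous (h : IsLogHolder m η R ν) (ht : ∀ x y : Λ, dist x y ^ η ≤ t₀)
    (ht0 : 0 ≤ t₀) : ν ≪ m := by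
  refine Measure.AbsolutelyContinuous.mk fun E hE h0 => ?_
  have := h.le_mul ht ht0 hE
  simpa [h0] using this

end IsLogHolder

namespace IsGibbsMarkov

variable {Λ : Type*} [MetricSpace Λ] [MeasurableSpace Λ] {m ν : Measure Λ}
  {F : Λ → Λ} {α : Set (Set Λ)} {j : Λ → ℝ≥0∞} {η θ K t₀ R L : ℝ}

theorem measure_eq_tsum (h : IsGibbsMarkov m F α j η θ K t₀) (hν : ν ≪ m) {E : Set Λ}
    (hE : MeasurableSet E) : ν E = ∑' a : α, ν (a ∩ E) := by
  have : Countable α := h.countable.to_subtype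
  rw [← measure_iUnion (f := fun a : α => (a : Set Λ) ∩ E) (fun a b hab => ?_)
    (fun a => (h.measurableSet a a.2).inter hE),
    ← iUnion_inter, ← sUnion_eq_iUnion]
  · refine le_antisymm ?_ (measure_mono inter_subset_right)
    calc ν E ≤ ν (⋃₀ α ∩ E ∪ (⋃₀ α)ᶜ) := measure_mono fun x hx => by
          by_cases h : x ∈ ⋃₀ α
          · exact .inl ⟨h, hx⟩
          · exact .inr h
      _ ≤ ν (⋃₀ α ∩ E) + ν (⋃₀ α)ᶜ := measure_union_le _ _
      _ = ν (⋃₀ α ∩ E) := by rw [hν h.measure_compl, add_zero]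
  · exact (h.pairwiseDisjoint a.2 b.2 (fun e => hab (Subtype.ext e))).mono
      inter_subset_left inter_subset_left

/-- On one inverse branch, distances raised to η shrink by θ, which turns R into Rθ; the Jacobian
adds its distortion K and the weight adds L. By `branch` the integral of the Jacobian is m E on
every branch, so the branchwise inequalities can be summed. -/
theorem isLogHolder_map_withDensity (h : IsGibbsMarkov m F α j η θ K t₀) (hm : ν ≪ m)
    (hν : IsLogHolder m η R ν) {w : Λ → ℝ≥0∞} (hw : Measurable w) (hL : 0 ≤ L)
    (hwL : ∀ a ∈ α, ∀ x ∈ a, ∀ y ∈ a,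
      w x ≤ ENNReal.ofReal (Real.exp (L * dist (F x) (F y) ^ η)) * w y) :
    IsLogHolder m η (R * θ + K + L) ((ν.withDensity w).map F) := by
  intro E E' hE hE' δ hδ hd
  have hac : ν.withDensity w ≪ m := (withDensity_absolutelyContinuous ν w).trans hm
  have hFE := h.measurable hE
  have hFE' := h.measurable hE'
  rw [Measure.map_apply h.measurable hE, Measure.map_apply h.measurable hE',
    h.measure_eq_tsum hac hFE, h.measure_eq_tsum hac hFE', ← ENNReal.tsum_mul_right,
    ← ENNReal.tsum_mul_right, ← ENNReal.tsum_mul_left]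
  refine ENNReal.tsum_le_tsum fun ⟨a, ha⟩ => ?_
  have hA : MeasurableSet (a ∩ F ⁻¹' E) := (h.measurableSet a ha).inter hFE
  have hA' : MeasurableSet (a ∩ F ⁻¹' E') := (h.measurableSet a ha).inter hFE'
  have := setLIntegral_mul_setLIntegral_le (ν := ν) (m := m) (w := w) (j := j)
    (c := ENNReal.ofReal (Real.exp (L * δ))) (c' := ENNReal.ofReal (Real.exp (K * δ))) hA hw
    (hν _ _ hA hA' (θ * δ) (mul_nonneg h.theta_nonneg hδ) fun x hx y hy =>
      (h.contraction a ha x hx.1 y hy.1).trans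
        (mul_le_mul_of_nonneg_left (hd _ hx.2 _ hy.2) h.theta_nonneg))
    (fun x hx y hy => (hwL a ha x hx.1 y hy.1).trans (by
      have := hd _ hx.2 _ hy.2
      gcongr))
    (fun x hx y hy => (h.distortion a ha y hy.1 x hx.1).trans (by
      have := hd _ hx.2 _ hy.2
      have := h.K_pos
      rw [dist_comm]
      gcongr)) (by simp)
  rw [h.branch a ha E hE, h.branch a ha E' hE', ← ENNReal.ofReal_mul (Real.exp_nonneg _),
    ← ENNReal.ofReal_mul (by positivity), ← Real.exp_add, ← Real.exp_add] at this
  rw [withDensity_apply _ hA, withDensity_apply _ hA']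
  convert this using 4
  ring

theorem isLogHolder_map (h : IsGibbsMarkov m F α j η θ K t₀) [IsProbabilityMeasure m]
    (hν : IsLogHolder m η R ν) : IsLogHolder m η (R * θ + K) (ν.map F) := by
  have := h.isLogHolder_map_withDensity (hν.absolutelyContinuous h.dist_rpow_le h.t₀_nonneg) hν
    (w := 1) measurable_one le_rfl (by simp)
  simpa using this

/-- Iteration of R ↦ Rθ + K, whose fixed point is K/(1 - θ): the initial irregularity is forgotten
geometrically. -/
theorem isLogHolder_map_iterate (h : IsGibbsMarkov m F α j η θ K t₀) [IsProbabilityMeasure m]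
    (hν : IsLogHolder m η R ν) (n : ℕ) :
    IsLogHolder m η (R * θ ^ n + K / (1 - θ)) (ν.map F^[n]) := by
  have h1 : 0 < 1 - θ := by linarith [h.theta_lt_one]
  have hK := h.K_pos
  have hθ := h.theta_nonneg
  induction n with
  | zero =>
    simp only [pow_zero, mul_one, Function.iterate_zero, Measure.map_id]
    exact hν.mono (by linarith [div_pos hK h1])
  | succ n ih =>
    have := h.isLogHolder_map ih
    rw [Measure.map_map h.measurable (h.measurable.iterate n), ← Function.iterate_succ'] at this
    refine this.mono (le_of_eq ?_)
    field_simp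
    ring

end IsGibbsMarkov

/-! ### Regularity of absolutely continuous invariant measures. -/

theorem exists_lipschitz_eLpNorm_sub_le {Λ : Type*} [MetricSpace Λ] [MeasurableSpace Λ]
    [BorelSpace Λ] {m : Measure Λ} [IsFiniteMeasure m] {f : Λ → ℝ} (hf : Integrable f m)
    {ε : ℝ≥0∞} (hε : ε ≠ 0) :
    ∃ g : Λ → ℝ, eLpNorm (f - g) 1 m ≤ ε ∧ ∃ C, LipschitzWith C g := by
  refine MemLp.induction_dense (μ := m) (p := 1) (by simp) (fun g => ∃ C, LipschitzWith C g)
    ?_ ?_ ?_ (memLp_one_iff_integrable.2 hf) hε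
  · intro c s hs hms ε hε
    by_cases hc : c = 0
    · subst hc
      exact ⟨0, by simp, 0, LipschitzWith.const 0⟩
    have hc' : ‖c‖ₑ ≠ 0 := by simpa using hc
    -- One half is spent on the part of s outside the closed set C, the other on the shell added by
    -- thickening C; both errors are multiplied by ‖c‖ₑ.
    set ε' := ε / ‖c‖ₑ / 2 with hε'
    have hε'0 : ε' ≠ 0 := by
      simp [hε', hε, ENNReal.div_eq_zero_iff]
    obtain ⟨C, hCs, hC, hmC⟩ := hs.exists_isClosed_sdiff_lt (μ := m) hms.ne hε'0
    obtain ⟨δ, hδpos, hδ⟩ : ∃ δ : ℝ, 0 < δ ∧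
        m (Metric.thickening δ C) < m C + ε' := by
      have ht := tendsto_measure_thickening_of_isClosed (μ := m) (s := C)
        ⟨1, one_pos, measure_ne_top _ _⟩ hC
      have := (ht.eventually_lt_const (ENNReal.lt_add_right (measure_ne_top m C) hε'0)).and
        self_mem_nhdsWithin
      obtain ⟨δ, h1, h2⟩ := this.exists
      exact ⟨δ, h2, h1⟩
    refine ⟨fun x => c * (thickenedIndicator hδpos C x : ℝ), ?_, ?_⟩
    · rw [eLpNorm_one_eq_lintegral_enorm]
      have hT : m (Metric.thickening δ C \ C) ≤ ε' := by
        rw [measure_sdiff (Metric.self_subset_thickening hδpos C) hC.measurableSet.nullMeasurableSet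
          (measure_ne_top _ _)]
        exact tsub_le_iff_left.2 hδ.le
      have hpt : ∀ x, ‖((fun x => c * (thickenedIndicator hδpos C x : ℝ))
          - s.indicator fun _ => c) x‖ₑ ≤ ((Metric.thickening δ C \ C) ∪ (s \ C)).indicator
            (fun _ => ‖c‖ₑ) x := by
        intro x
        simp only [Pi.sub_apply]
        have hle := thickenedIndicator_le_one hδpos C x
        by_cases hxC : x ∈ C
        · rw [thickenedIndicator_one hδpos C hxC]
          simp [hCs hxC]
        · by_cases hxs : x ∈ s
          · rw [indicator_of_mem hxs, indicator_of_mem (.inr ⟨hxs, hxC⟩)]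
            have : c * (thickenedIndicator hδpos C x : ℝ) - c
              = c * ((thickenedIndicator hδpos C x : ℝ) - 1) := by ring
            rw [this, enorm_mul]
            refine mul_le_of_le_one_right' ?_
            rw [← ofReal_norm, ENNReal.ofReal_le_one, Real.norm_eq_abs, abs_le]
            have hle' : (thickenedIndicator hδpos C x : ℝ) ≤ 1 := by exact_mod_cast hle
            constructor <;> linarith [NNReal.coe_nonneg (thickenedIndicator hδpos C x)]
          · rw [indicator_of_notMem hxs, sub_zero]
            by_cases hxT : x ∈ Metric.thickening δ C
            · rw [indicator_of_mem (.inl ⟨hxT, hxC⟩), enorm_mul]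
              refine mul_le_of_le_one_right' ?_
              rw [← ofReal_norm, ENNReal.ofReal_le_one, Real.norm_eq_abs, abs_le]
              have hle' : (thickenedIndicator hδpos C x : ℝ) ≤ 1 := by exact_mod_cast hle
              constructor <;> linarith [NNReal.coe_nonneg (thickenedIndicator hδpos C x)]
            · rw [thickenedIndicator_zero hδpos C hxT]
              simp
      have hdiv : ‖c‖ₑ * (ε' + ε') = ε := by
        rw [hε', ENNReal.add_halves, ENNReal.mul_div_cancel hc' (by simp)]
      calc ∫⁻ x, ‖((fun x => c * (thickenedIndicator hδpos C x : ℝ))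
          - s.indicator fun _ => c) x‖ₑ ∂m ≤ ∫⁻ x, ((Metric.thickening δ C \ C) ∪ (s \ C)).indicator
            (fun _ => ‖c‖ₑ) x ∂m := lintegral_mono hpt
        _ = ‖c‖ₑ * m ((Metric.thickening δ C \ C) ∪ (s \ C)) := by
            rw [lintegral_indicator_const]
            exact (Metric.isOpen_thickening.measurableSet.diff hC.measurableSet).union
              (hs.diff hC.measurableSet)
        _ ≤ ‖c‖ₑ * (ε' + ε') := by
            gcongr
            exact (measure_union_le _ _).trans (add_le_add hT hmC.le)
        _ = ε := hdiv
    · have h1 := lipschitzWith_thickenedIndicator hδpos C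
      exact ⟨‖c‖₊ * δ.toNNReal⁻¹, LipschitzWith.of_dist_le_mul fun x y => by
        have := h1.dist_le_mul x y
        rw [NNReal.dist_eq] at this
        rw [Real.dist_eq, ← mul_sub, abs_mul, NNReal.coe_mul, mul_assoc]
        exact mul_le_mul_of_nonneg_left this (abs_nonneg c)⟩
  · rintro f g ⟨C, hC⟩ ⟨D, hD⟩
    exact ⟨C + D, hC.add hD⟩
  · rintro f ⟨C, hC⟩
    exact hC.continuous.measurable.aestronglyMeasurable

namespace IsGibbsMarkov

variable {Λ : Type*} [MetricSpace Λ] [MeasurableSpace Λ] {m μ ν : Measure Λ}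
  {F : Λ → Λ} {α : Set (Set Λ)} {j : Λ → ℝ≥0∞} {η θ K t₀ R L : ℝ}

/-- A finite measure absolutely continuous with respect to `m` is approximated, uniformly on
measurable sets, by measures with log-Hölder densities. -/
theorem exists_isLogHolder_approx [BorelSpace Λ] (h : IsGibbsMarkov m F α j η θ K t₀)
    [IsProbabilityMeasure m] [IsFiniteMeasure μ] (hμ : μ ≪ m) {ε : ℝ} (hε : 0 < ε) :
    ∃ ν : Measure Λ, (∃ L, 0 ≤ L ∧ IsLogHolder m η L ν) ∧ ∀ E, MeasurableSet E →
      μ E ≤ ν E + ENNReal.ofReal ε ∧ ν E ≤ μ E + ENNReal.ofReal ε := by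
  set f : Λ → ℝ := fun x => (μ.rnDeriv m x).toReal with hf
  have hfi : Integrable f m := Measure.integrable_toReal_rnDeriv
  obtain ⟨g, hg, C, hC⟩ := exists_lipschitz_eLpNorm_sub_le hfi
    (ε := ENNReal.ofReal (ε / 2)) (by simpa using hε)
  rw [eLpNorm_one_eq_lintegral_enorm] at hg
  have hgm : Measurable g := hC.continuous.measurable
  -- The lower bound ε/2 turns a Lipschitz estimate into a log-Lipschitz one; `D` below converts
  -- distance into distance to the power η.
  set g' : Λ → ℝ := fun x => max (g x) 0 + ε / 2 with hg'
  have hg'pos : ∀ x, ε / 2 ≤ g' x := fun x => by simp [hg']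
  have hg'm : Measurable g' := (hgm.max measurable_const).add_const _
  obtain ⟨D, hD0, hD⟩ := h.dist_le
  set L : ℝ := C / (ε / 2) * D with hL
  have hL0 : 0 ≤ L := by positivity
  have hlip : ∀ x y, g' x ≤ Real.exp (L * dist x y ^ η) * g' y := by
    intro x y
    have h1 : g' x - g' y ≤ C * dist x y := by
      have h1 := hC.dist_le_mul x y
      rw [Real.dist_eq] at h1
      have h2 : max (g x) 0 - max (g y) 0 ≤ |g x - g y| :=
        (le_abs_self _).trans (abs_max_sub_max_le_abs _ _ _)
      simp only [hg']; linarith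
    have h2 : C * dist x y ≤ g' y * (L * dist x y ^ η) := by
      calc C * dist x y ≤ C * (D * dist x y ^ η) := by gcongr; exact hD x y
        _ = (ε / 2) * (L * dist x y ^ η) := by rw [hL]; field_simp
        _ ≤ _ := by
          gcongr
          exact hg'pos y
    have h3 := Real.add_one_le_exp (L * dist x y ^ η)
    have h4 : 0 < g' y := by linarith [hg'pos y]
    nlinarith
  refine ⟨m.withDensity fun x => ENNReal.ofReal (g' x), ⟨0 + L, by simpa using hL0,
    IsLogHolder.self.withDensity hg'm.ennreal_ofReal hL0 fun x y => ?_⟩, fun E hE => ?_⟩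
  · rw [← ENNReal.ofReal_mul (Real.exp_nonneg _)]
    exact ENNReal.ofReal_le_ofReal (hlip x y)
  rw [withDensity_apply _ hE]
  have hμE : μ E = ∫⁻ x in E, ENNReal.ofReal (f x) ∂m := by
    rw [← Measure.setLIntegral_rnDeriv hμ]
    refine lintegral_congr_ae (ae_restrict_of_ae ?_)
    filter_upwards [Measure.rnDeriv_lt_top μ m] with x hx
    rw [hf, ENNReal.ofReal_toReal hx.ne]
  have hfm : Measurable f := (Measure.measurable_rnDeriv μ m).ennreal_toReal
  have hf0 : ∀ x, 0 ≤ f x := fun x => ENNReal.toReal_nonneg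
  have hem : Measurable fun x => ‖(f - g) x‖ₑ := (hfm.sub hgm).enorm
  have hle : ∫⁻ x in E, ‖(f - g) x‖ₑ ∂m ≤ ENNReal.ofReal (ε / 2) :=
    (setLIntegral_le_lintegral _ _).trans hg
  have hcst : ∫⁻ x in E, ENNReal.ofReal (ε / 2) ∂m ≤ ENNReal.ofReal (ε / 2) := by
    rw [setLIntegral_const]
    exact mul_le_of_le_one_right' prob_le_one
  have hadd : ENNReal.ofReal ε = ENNReal.ofReal (ε / 2) + ENNReal.ofReal (ε / 2) := by
    rw [← ENNReal.ofReal_add (by positivity) (by positivity)]; ring_nf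
  have habs : ∀ x, ‖(f - g) x‖ₑ = ENNReal.ofReal |f x - g x| := fun x => by
    rw [Pi.sub_apply, ← ofReal_norm, Real.norm_eq_abs]
  constructor
  · rw [hμE]
    calc ∫⁻ x in E, ENNReal.ofReal (f x) ∂m
        ≤ ∫⁻ x in E, (ENNReal.ofReal (g' x) + ‖(f - g) x‖ₑ) ∂m := by
          refine lintegral_mono fun x => ?_
          beta_reduce
          rw [habs, ← ENNReal.ofReal_add (by linarith [hg'pos x]) (abs_nonneg _)]
          refine ENNReal.ofReal_le_ofReal ?_
          simp only [hg']
          linarith [le_max_left (g x) 0, le_abs_self (f x - g x)]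
      _ = ∫⁻ x in E, ENNReal.ofReal (g' x) ∂m + ∫⁻ x in E, ‖(f - g) x‖ₑ ∂m :=
          lintegral_add_right _ hem
      _ ≤ _ := by
          gcongr
          refine hle.trans (ENNReal.ofReal_le_ofReal (by linarith))
  · rw [hμE]
    calc ∫⁻ x in E, ENNReal.ofReal (g' x) ∂m
        ≤ ∫⁻ x in E, (ENNReal.ofReal (f x) + (‖(f - g) x‖ₑ + ENNReal.ofReal (ε / 2))) ∂m := by
          refine lintegral_mono fun x => ?_
          beta_reduce
          rw [habs, ← ENNReal.ofReal_add (abs_nonneg _) (by positivity),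
            ← ENNReal.ofReal_add (hf0 x) (by positivity)]
          refine ENNReal.ofReal_le_ofReal ?_
          simp only [hg']
          have h1 := neg_abs_le (f x - g x)
          have h2 : max (g x) 0 ≤ f x + |f x - g x| :=
            max_le (by linarith) (add_nonneg (hf0 x) (abs_nonneg _))
          linarith
      _ = ∫⁻ x in E, ENNReal.ofReal (f x) ∂m + (∫⁻ x in E, ‖(f - g) x‖ₑ ∂m
            + ∫⁻ x in E, ENNReal.ofReal (ε / 2) ∂m) := by
          rw [← lintegral_add_right _ measurable_const]
          exact lintegral_add_right _ (hem.add measurable_const)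
      _ ≤ _ := by
          rw [hadd]
          gcongr

/-- An absolutely continuous invariant measure has a log-Hölder density. -/
theorem isLogHolder_of_invariant [BorelSpace Λ] (h : IsGibbsMarkov m F α j η θ K t₀)
    [IsProbabilityMeasure m] [IsFiniteMeasure μ] (hμ : μ ≪ m) (hF : MeasurePreserving F μ μ)
    (hR : K / (1 - θ) < R) : IsLogHolder m η R μ := by
  intro E E' hE hE' δ hδ hd
  refine ENNReal.le_of_forall_pos_le_add fun ε hε _ => ?_
  -- The approximation error enters twice, once as it is and once multiplied by exp(Rδ).
  set c : ℝ := ε / (Real.exp (R * δ) + 1) with hc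
  have hcpos : 0 < c := by positivity
  obtain ⟨ν, ⟨L, hL0, hL⟩, happ⟩ := h.exists_isLogHolder_approx hμ hcpos
  -- The constant of the approximating measure is uncontrolled. Pushing forward by F^n brings it
  -- below R, while invariance of μ keeps the error, uniform over measurable sets, unchanged.
  obtain ⟨n, hn⟩ : ∃ n : ℕ, L * θ ^ n + K / (1 - θ) < R := by
    have ht : Filter.Tendsto (fun n : ℕ => L * θ ^ n + K / (1 - θ)) Filter.atTop
        (nhds (L * 0 + K / (1 - θ))) :=
      ((tendsto_pow_atTop_nhds_zero_of_lt_one h.theta_nonneg h.theta_lt_one).const_mul L).add_const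
        _
    exact (ht.eventually_lt_const (by simpa using hR)).exists
  have hn' := (h.isLogHolder_map_iterate hL n).mono hn.le
  have hit := hF.iterate n
  have hFn := h.measurable.iterate n
  have key := hn' E E' hE hE' δ hδ hd
  rw [Measure.map_apply hFn hE, Measure.map_apply hFn hE'] at key
  have a1 := (happ _ (hFn hE)).1
  have a2 := (happ _ (hFn hE')).2
  rw [hit.measure_preimage hE.nullMeasurableSet] at a1
  rw [hit.measure_preimage hE'.nullMeasurableSet] at a2
  calc μ E * m E' ≤ (ν (F^[n] ⁻¹' E) + ENNReal.ofReal c) * m E' := by gcongr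
    _ = ν (F^[n] ⁻¹' E) * m E' + ENNReal.ofReal c * m E' := add_mul _ _ _
    _ ≤ ENNReal.ofReal (Real.exp (R * δ)) * (ν (F^[n] ⁻¹' E') * m E)
        + ENNReal.ofReal c * 1 := by gcongr; exact prob_le_one
    _ ≤ ENNReal.ofReal (Real.exp (R * δ)) * ((μ E' + ENNReal.ofReal c) * m E)
        + ENNReal.ofReal c * 1 := by gcongr
    _ = ENNReal.ofReal (Real.exp (R * δ)) * (μ E' * m E)
        + (ENNReal.ofReal (Real.exp (R * δ)) * ENNReal.ofReal c * m E + ENNReal.ofReal c) := by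
        ring
    _ ≤ ENNReal.ofReal (Real.exp (R * δ)) * (μ E' * m E)
        + (ENNReal.ofReal (Real.exp (R * δ)) * ENNReal.ofReal c * 1 + ENNReal.ofReal c) := by
        gcongr; exact prob_le_one
    _ = ENNReal.ofReal (Real.exp (R * δ)) * (μ E' * m E) + ε := by
        rw [mul_one, ← ENNReal.ofReal_mul (Real.exp_nonneg _),
          ← ENNReal.ofReal_add (by positivity) hcpos.le]
        congr 1
        have : Real.exp (R * δ) * c + c = ε := by rw [hc]; field_simp
        rw [this, ENNReal.ofReal_coe_nnreal]

end IsGibbsMarkov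

/-! ### Exponential loss of memory by coupling. -/

/-- The real inequality that allows a multiple of `m` to be subtracted from a measure with a
log-Hölder density. -/
theorem exp_sub_mul_le {R K t₀ δ a b e e' M c : ℝ} (hK : 0 < K) (hKR : K < R) (hδ : 0 ≤ δ)
    (hδt : δ ≤ t₀) (he : 0 ≤ e) (he' : 0 ≤ e') (hM : 0 ≤ M)
    (hab : a * e' ≤ Real.exp ((R - K) * δ) * (b * e))
    (hb : M * e' ≤ Real.exp ((R - K) * t₀) * b)
    (hc : c = Real.exp (-(2 * R * t₀)) * (K / R)) :
    (a - c * M * e) * e' ≤ Real.exp (R * δ) * ((b - c * M * e') * e) := by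
  have hR : 0 < R := hK.trans hKR
  have ht₀ : 0 ≤ t₀ := hδ.trans hδt
  -- Relaxing R - K to R gains at least Kδ, while removing a multiple of m costs a multiple of
  -- exp(Rδ) - 1, which `h2` bounds by Rδ exp(Rt₀). This explains the K/R in `c`; of its two factors
  -- exp(-Rt₀), one pays for `h2` and the other for the lower bound `h4`.
  have h1 : K * δ ≤ Real.exp (R * δ) - Real.exp ((R - K) * δ) := by
    have e1 : Real.exp (R * δ) = Real.exp ((R - K) * δ) * Real.exp (K * δ) := by
      rw [← Real.exp_add]; ring_nf
    have e2 := Real.add_one_le_exp (K * δ)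
    have e3 : 1 ≤ Real.exp ((R - K) * δ) :=
      Real.one_le_exp (mul_nonneg (by linarith) hδ)
    have e4 : 0 ≤ K * δ := by positivity
    rw [e1]; nlinarith
  have h2 : Real.exp (R * δ) - 1 ≤ R * δ * Real.exp (R * t₀) := by
    have e1 := Real.add_one_le_exp (-(R * δ))
    have e2 : Real.exp (R * δ) * Real.exp (-(R * δ)) = 1 := by rw [← Real.exp_add]; simp
    have e3 : Real.exp (R * δ) ≤ Real.exp (R * t₀) := by gcongr
    have e4 := Real.exp_pos (R * δ)
    have e5 : 0 ≤ R * δ := by positivity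
    nlinarith
  have h3 : c * (Real.exp (R * δ) - 1) ≤
      Real.exp (-(R * t₀)) * (Real.exp (R * δ) - Real.exp ((R - K) * δ)) := by
    have hc0 : 0 ≤ c := by rw [hc]; positivity
    calc c * (Real.exp (R * δ) - 1) ≤ c * (R * δ * Real.exp (R * t₀)) := by gcongr
      _ = Real.exp (-(R * t₀)) * (K * δ) := by
        have : Real.exp (-(2 * R * t₀)) * Real.exp (R * t₀) = Real.exp (-(R * t₀)) := by
          rw [← Real.exp_add]; ring_nf
        rw [hc, ← this]; field_simp
      _ ≤ _ := by gcongr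
  have h4 : Real.exp (-(R * t₀)) * (M * e') ≤ b := by
    have hb0 : 0 ≤ b := by
      have : 0 ≤ Real.exp ((R - K) * t₀) * b := le_trans (by positivity) hb
      exact nonneg_of_mul_nonneg_right this (Real.exp_pos _)
    calc Real.exp (-(R * t₀)) * (M * e')
        ≤ Real.exp (-(R * t₀)) * (Real.exp ((R - K) * t₀) * b) := by gcongr
      _ = Real.exp (-(K * t₀)) * b := by
        rw [← mul_assoc, ← Real.exp_add]; ring_nf
      _ ≤ 1 * b := by
        gcongr
        rw [Real.exp_le_one_iff]
        have : 0 ≤ K * t₀ := by positivity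
        linarith
      _ = b := one_mul b
  have h5 : c * M * e * e' * (Real.exp (R * δ) - 1)
      ≤ (b * e) * (Real.exp (R * δ) - Real.exp ((R - K) * δ)) := by
    have h6 : 0 ≤ Real.exp (R * δ) - Real.exp ((R - K) * δ) :=
      le_trans (by positivity) h1
    calc c * M * e * e' * (Real.exp (R * δ) - 1)
        = M * e * e' * (c * (Real.exp (R * δ) - 1)) := by ring
      _ ≤ M * e * e' * (Real.exp (-(R * t₀)) *
          (Real.exp (R * δ) - Real.exp ((R - K) * δ))) := by gcongr
      _ = (Real.exp (-(R * t₀)) * (M * e')) * e *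
          (Real.exp (R * δ) - Real.exp ((R - K) * δ)) := by ring
      _ ≤ b * e * (Real.exp (R * δ) - Real.exp ((R - K) * δ)) := by gcongr
  linarith

/-- Splitting off a multiple of `m` from a measure with a log-Hölder density. -/
theorem IsLogHolder.exists_eq_smul_add {Λ : Type*} [MetricSpace Λ] [MeasurableSpace Λ]
    {m ν : Measure Λ} [IsProbabilityMeasure m] [IsFiniteMeasure ν] {η R K t₀ : ℝ}
    (hν : IsLogHolder m η (R - K) ν) (hK : 0 < K) (hKR : K < R)
    (ht : ∀ x y : Λ, dist x y ^ η ≤ t₀) (ht0 : 0 ≤ t₀) {c : ℝ}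
    (hc : c = Real.exp (-(2 * R * t₀)) * (K / R)) :
    ∃ ν' : Measure Λ, IsLogHolder m η R ν' ∧ IsFiniteMeasure ν' ∧
      ν = (ENNReal.ofReal c * ν univ) • m + ν' ∧
      ν' univ = ENNReal.ofReal (1 - c) * ν univ := by
  have hR : 0 < R := hK.trans hKR
  have hc0 : 0 ≤ c := by rw [hc]; positivity
  have hc1 : c ≤ 1 := by
    rw [hc]
    refine mul_le_one₀ ?_ (by positivity) ?_
    · rw [Real.exp_le_one_iff]
      have : 0 ≤ 2 * R * t₀ := by positivity
      linarith
    · rw [div_le_one hR]; exact hKR.le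
  set M := (ν univ).toReal with hM
  have hM0 : 0 ≤ M := ENNReal.toReal_nonneg
  have hMν : ν univ = ENNReal.ofReal M := (ENNReal.ofReal_toReal (measure_ne_top _ _)).symm
  have hreal : ∀ E, ν E = ENNReal.ofReal (ν E).toReal := fun E =>
    (ENNReal.ofReal_toReal (measure_ne_top _ _)).symm
  have hrealm : ∀ E, m E = ENNReal.ofReal (m E).toReal := fun E =>
    (ENNReal.ofReal_toReal (measure_ne_top _ _)).symm
  have hlow : ∀ E, MeasurableSet E →
      M * (m E).toReal ≤ Real.exp ((R - K) * t₀) * (ν E).toReal := fun E hE => by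
    have := hν.mul_le ht ht0 hE
    have h2 := ENNReal.toReal_mono (ENNReal.mul_ne_top (by simp) (measure_ne_top _ _)) this
    simpa [ENNReal.toReal_mul, Real.exp_nonneg, hM] using h2
  have hcM : ENNReal.ofReal c * ν univ = ENNReal.ofReal (c * M) := by
    rw [hMν, ENNReal.ofReal_mul hc0]
  have hlow' : ∀ E, MeasurableSet E → c * M * (m E).toReal ≤ (ν E).toReal := fun E hE => by
    have h1 := hlow E hE
    have h2 : c * Real.exp ((R - K) * t₀) ≤ 1 := by
      calc c * Real.exp ((R - K) * t₀)
          = Real.exp (-(2 * R * t₀) + (R - K) * t₀) * (K / R) := by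
            rw [hc, Real.exp_add]; ring
        _ ≤ 1 := by
          refine mul_le_one₀ ?_ (by positivity) ((div_le_one hR).2 hKR.le)
          rw [Real.exp_le_one_iff]
          nlinarith
    calc c * M * (m E).toReal = c * (M * (m E).toReal) := by ring
      _ ≤ c * (Real.exp ((R - K) * t₀) * (ν E).toReal) := by gcongr
      _ = c * Real.exp ((R - K) * t₀) * (ν E).toReal := by ring
      _ ≤ 1 * (ν E).toReal := by gcongr
      _ = _ := one_mul _
  have hle : ENNReal.ofReal (c * M) • m ≤ ν := by
    refine Measure.le_iff.2 fun E hE => ?_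
    rw [Measure.smul_apply, smul_eq_mul, hrealm E, ← ENNReal.ofReal_mul (by positivity), hreal E]
    exact ENNReal.ofReal_le_ofReal (hlow' E hE)
  have hfin : IsFiniteMeasure (ENNReal.ofReal (c * M) • m) := m.smul_finite (by simp)
  have hsub : ∀ E, MeasurableSet E → (ν - ENNReal.ofReal (c * M) • m) E
      = ENNReal.ofReal ((ν E).toReal - c * M * (m E).toReal) := fun E hE => by
    rw [Measure.sub_apply hE hle, Measure.smul_apply, smul_eq_mul,
      ENNReal.ofReal_sub _ (by positivity), ENNReal.ofReal_mul (p := c * M) (by positivity),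
      ← hrealm, ← hreal]
  refine ⟨ν - ENNReal.ofReal (c * M) • m, ?_, inferInstance, ?_, ?_⟩
  · intro E E' hE hE' δ hδ hd
    -- The real inequality needs δ ≤ t₀, and all distances to the power η are at most t₀ anyway.
    have hd' : ∀ x ∈ E, ∀ y ∈ E', dist x y ^ η ≤ min δ t₀ := fun x hx y hy =>
      le_min (hd x hx y hy) (ht x y)
    have hδ' : 0 ≤ min δ t₀ := le_min hδ ht0
    have h1 := hν E E' hE hE' (min δ t₀) hδ' hd'
    have h2 := ENNReal.toReal_mono (ENNReal.mul_ne_top (by simp)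
      (ENNReal.mul_ne_top (measure_ne_top _ _) (measure_ne_top _ _))) h1
    simp only [ENNReal.toReal_mul, ENNReal.toReal_ofReal (Real.exp_nonneg _)] at h2
    have h3 := exp_sub_mul_le hK hKR hδ' (min_le_right _ _) ENNReal.toReal_nonneg
      ENNReal.toReal_nonneg hM0 h2 (hlow E' hE') hc
    have h5 := hlow' E hE
    have h6 := hlow' E' hE'
    rw [hsub E hE, hsub E' hE']
    conv_lhs => rw [hrealm E', ← ENNReal.ofReal_mul (by linarith)]
    conv_rhs => rw [hrealm E, ← ENNReal.ofReal_mul (by linarith),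
      ← ENNReal.ofReal_mul (Real.exp_nonneg _)]
    refine ENNReal.ofReal_le_ofReal (h3.trans ?_)
    have h4 : 0 ≤ (ν E').toReal - c * M * (m E').toReal := by linarith [hlow' E' hE']
    gcongr
    exact min_le_left _ _
  · rw [hcM, add_comm]
    exact (Measure.sub_add_cancel_of_le hle).symm
  · rw [hsub univ .univ, hMν, ← ENNReal.ofReal_mul (by linarith)]
    simp only [measure_univ, ENNReal.toReal_one]
    congr 1; rw [ENNReal.toReal_ofReal hM0]; ring

namespace IsGibbsMarkov

variable {Λ : Type*} [MetricSpace Λ] [MeasurableSpace Λ] {m μ : Measure Λ}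
  {F : Λ → Λ} {α : Set (Set Λ)} {j : Λ → ℝ≥0∞} {η θ K t₀ R : ℝ}

/-- Exponential loss of memory. -/
theorem map_iterate_le_add (h : IsGibbsMarkov m F α j η θ K t₀) [IsProbabilityMeasure m]
    (hKR : K < R) (hRθ : R * θ + K ≤ R - K) {c : ℝ}
    (hc : c = Real.exp (-(2 * R * t₀)) * (K / R)) (k : ℕ) :
    ∀ ν₁ ν₂ : Measure Λ, IsFiniteMeasure ν₁ → IsFiniteMeasure ν₂ →
      IsLogHolder m η (R - K) ν₁ → IsLogHolder m η (R - K) ν₂ → ν₁ univ = ν₂ univ →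
      ν₁.map F^[k] ≤ ν₂.map F^[k]
        + (ENNReal.ofReal ((1 - c) ^ k * Real.exp (R * t₀)) * ν₁ univ) • m := by
  have hR : 0 < R := h.K_pos.trans hKR
  induction k with
  | zero =>
    intro ν₁ ν₂ _ _ h1 _ _
    refine Measure.le_iff.2 fun E hE => ?_
    have := (h1.mono (by linarith [h.K_pos] : R - K ≤ R)).le_mul h.dist_rpow_le h.t₀_nonneg hE
    simp only [Function.iterate_zero, Measure.map_id, pow_zero, one_mul, Measure.add_apply,
      Measure.smul_apply, smul_eq_mul]
    rw [← mul_assoc] at this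
    exact this.trans le_add_self
  | succ k ih =>
    intro ν₁ ν₂ hf1 hf2 h1 h2 h12
    -- As the masses agree, both measures contain the same multiple of m, and these parts have equal
    -- images forever. Only the remainders, with a fraction 1 - c of the mass, still have to be
    -- compared; applying F brings their constant from R back to R - K.
    obtain ⟨ν₁', hl1, hf1', e1, m1⟩ :=
      h1.exists_eq_smul_add h.K_pos hKR h.dist_rpow_le h.t₀_nonneg hc
    obtain ⟨ν₂', hl2, hf2', e2, m2⟩ :=
      h2.exists_eq_smul_add h.K_pos hKR h.dist_rpow_le h.t₀_nonneg hc
    have hFk := h.measurable.iterate k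
    have hmap : ∀ ν : Measure Λ, ν.map F^[k + 1] = (ν.map F).map F^[k] := fun ν => by
      rw [Measure.map_map hFk h.measurable, ← Function.iterate_succ]
    have hmass : ∀ ν : Measure Λ, (ν.map F) univ = ν univ := fun ν => by
      rw [Measure.map_apply h.measurable .univ, preimage_univ]
    have key := ih (ν₁'.map F) (ν₂'.map F) inferInstance inferInstance
      ((h.isLogHolder_map hl1).mono hRθ) ((h.isLogHolder_map hl2).mono hRθ)
      (by rw [hmass, hmass, m1, m2, h12])
    have hdec : ∀ (ν ν' : Measure Λ) (a : ℝ≥0∞), ν = a • m + ν' →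
        ν.map F^[k + 1] = a • m.map F^[k + 1] + (ν'.map F).map F^[k] := fun ν ν' a e => by
      rw [e, Measure.map_add _ _ (h.measurable.iterate _), Measure.map_smul, hmap ν']
    rw [hdec ν₁ ν₁' _ e1, hdec ν₂ ν₂' _ e2, h12, add_assoc]
    refine add_le_add_right (key.trans (le_of_eq ?_)) _
    congr 2
    rw [hmass, m1, h12, ← mul_assoc, ← ENNReal.ofReal_mul']
    · congr 2; ring
    · have hc0 : c ≤ 1 := by
        rw [hc]
        refine mul_le_one₀ ?_ (div_nonneg h.K_pos.le hR.le) ?_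
        · rw [Real.exp_le_one_iff]
          have := mul_nonneg hR.le h.t₀_nonneg
          linarith
        · rw [div_le_one hR]; exact hKR.le
      linarith

end IsGibbsMarkov

/-! ### Quasi-independence and decay of correlations. -/

theorem IsLogHolder.smul {Λ : Type*} [MetricSpace Λ] [MeasurableSpace Λ] {m ν : Measure Λ}
    {η R : ℝ} (h : IsLogHolder m η R ν) (c : ℝ≥0∞) : IsLogHolder m η R (c • ν) := by
  intro E E' hE hE' δ hδ hd
  have := h E E' hE hE' δ hδ hd
  simp only [Measure.smul_apply, smul_eq_mul]
  calc c * ν E * m E' = c * (ν E * m E') := by ring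
    _ ≤ c * (ENNReal.ofReal (Real.exp (R * δ)) * (ν E' * m E)) := by gcongr
    _ = _ := by ring

/-- Bounded nonnegative weights with log-Hölder regularity on the elements of the partition. -/
structure IsRegularWeight {Λ : Type*} [MetricSpace Λ] [MeasurableSpace Λ] (F : Λ → Λ)
    (α : Set (Set Λ)) (η K : ℝ) (w : Λ → ℝ) : Prop where
  bdd : IsBddMeasurable w
  nonneg : ∀ x, 0 ≤ w x
  le_mul : ∀ a ∈ α, ∀ x ∈ a, ∀ y ∈ a, w x ≤ Real.exp (K * dist (F x) (F y) ^ η) * w y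

namespace IsGibbsMarkov

variable {Λ : Type*} [MetricSpace Λ] [MeasurableSpace Λ] {m μ : Measure Λ}
  {F : Λ → Λ} {α : Set (Set Λ)} {j : Λ → ℝ≥0∞} {η θ K t₀ R c : ℝ}

/-- The choice R = 3K/(1 - θ) is made for this: the contraction has to absorb one K from the
Jacobian, one from the weight, and one kept in reserve for the coupling. -/
theorem isLogHolder_map_of_weight (h : IsGibbsMarkov m F α j η θ K t₀) (hμm : μ ≪ m)
    (hμ : IsLogHolder m η (R - K) μ) (hR : R = 3 * K / (1 - θ)) {w : Λ → ℝ}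
    (hw : IsRegularWeight F α η K w) :
    IsLogHolder m η (R - K) ((μ.withDensity fun x => ENNReal.ofReal (w x)).map F) := by
  have h1 : 0 < 1 - θ := by linarith [h.theta_lt_one]
  have hRθ : R * (1 - θ) = 3 * K := by rw [hR]; field_simp
  refine (h.isLogHolder_map_withDensity hμm hμ hw.bdd.1.ennreal_ofReal h.K_pos.le
    fun a ha x hx y hy => ?_).mono (R := (R - K) * θ + K + K) ?_
  · rw [← ENNReal.ofReal_mul (Real.exp_nonneg _)]
    exact ENNReal.ofReal_le_ofReal (hw.le_mul a ha x hx y hy)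
  · nlinarith [h.theta_nonneg, h.K_pos]

theorem le_smul_of_isLogHolder [IsProbabilityMeasure m] [IsProbabilityMeasure μ]
    (h : IsGibbsMarkov m F α j η θ K t₀) (hμ : IsLogHolder m η (R - K) μ) :
    m ≤ ENNReal.ofReal (Real.exp (R * t₀)) • μ := by
  refine Measure.le_iff.2 fun E hE => ?_
  have := (hμ.mono (by linarith [h.K_pos] : R - K ≤ R)).mul_le h.dist_rpow_le h.t₀_nonneg hE
  simpa using this

theorem lintegral_map_withDensity (h : IsGibbsMarkov m F α j η θ K t₀) {w : Λ → ℝ≥0∞}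
    (hw : Measurable w) (k : ℕ) {g : Λ → ℝ≥0∞} (hg : Measurable g) :
    ∫⁻ x, g x ∂(((μ.withDensity w).map F).map F^[k])
      = ∫⁻ x, w x * g (F^[k + 1] x) ∂μ := by
  have hFk := h.measurable.iterate k
  have h1 : ∫⁻ x, g (F^[k] x) ∂((μ.withDensity w).map F)
      = ∫⁻ x, g (F^[k] (F x)) ∂(μ.withDensity w) := lintegral_map (hg.comp hFk) h.measurable
  rw [lintegral_map hg hFk, h1]
  exact lintegral_withDensity_eq_lintegral_mul _ hw ((hg.comp hFk).comp h.measurable)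

variable [BorelSpace Λ] [IsProbabilityMeasure m] [IsProbabilityMeasure μ]

theorem isLogHolder_invariant (h : IsGibbsMarkov m F α j η θ K t₀) (hμm : μ ≪ m)
    (hF : MeasurePreserving F μ μ) (hR : R = 3 * K / (1 - θ)) :
    IsLogHolder m η (R - K) μ := by
  have h1 : 0 < 1 - θ := by linarith [h.theta_lt_one]
  refine h.isLogHolder_of_invariant hμm hF ?_
  have hK := h.K_pos
  have h2 : K ≤ K / (1 - θ) := by
    rw [le_div_iff₀ h1]; nlinarith [h.theta_nonneg]
  have h3 : 0 < K / (1 - θ) := by positivity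
  have : R = 3 * (K / (1 - θ)) := by rw [hR]; ring
  linarith

/-- Quasi-independence of a regular weight and of the future. -/
theorem lintegral_mul_comp_le (h : IsGibbsMarkov m F α j η θ K t₀) (hμm : μ ≪ m)
    (hF : MeasurePreserving F μ μ) (hR : R = 3 * K / (1 - θ)) {w : Λ → ℝ}
    (hw : IsRegularWeight F α η K w) {g : Λ → ℝ≥0∞} (hg : Measurable g) :
    ∫⁻ x, ENNReal.ofReal (w x) * g (F x) ∂μ ≤ ENNReal.ofReal (Real.exp (2 * R * t₀))
      * (∫⁻ x, ENNReal.ofReal (w x) ∂μ) * ∫⁻ x, g x ∂μ := by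
  have hμ := h.isLogHolder_invariant hμm hF hR
  have hwm := hw.bdd.1.ennreal_ofReal
  have hν := h.isLogHolder_map_of_weight hμm hμ hR hw
  set W := ∫⁻ x, ENNReal.ofReal (w x) ∂μ with hW
  set ν := (μ.withDensity fun x => ENNReal.ofReal (w x)).map F with hνdef
  have hmass : ν univ = W := by
    rw [hνdef, Measure.map_apply h.measurable .univ, preimage_univ, withDensity_apply _ .univ,
      Measure.restrict_univ]
  -- One factor exp(Rt₀) bounds the density of ν by its mean, the other bounds the density of μ from
  -- below.
  have hle : ν ≤ (ENNReal.ofReal (Real.exp (2 * R * t₀)) * W) • μ := by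
    refine Measure.le_iff.2 fun E hE => ?_
    have h1 := (hν.mono (by linarith [h.K_pos] : R - K ≤ R)).le_mul h.dist_rpow_le
      h.t₀_nonneg hE
    have h2 := h.le_smul_of_isLogHolder hμ E
    rw [hmass] at h1
    rw [Measure.smul_apply, smul_eq_mul] at h2 ⊢
    calc ν E ≤ ENNReal.ofReal (Real.exp (R * t₀)) * (W * m E) := h1
      _ ≤ ENNReal.ofReal (Real.exp (R * t₀)) * (W * (ENNReal.ofReal (Real.exp (R * t₀)) * μ E)) := by
        gcongr
      _ = ENNReal.ofReal (Real.exp (R * t₀)) * ENNReal.ofReal (Real.exp (R * t₀)) * W * μ E := by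
        ring
      _ = _ := by
        rw [← ENNReal.ofReal_mul (Real.exp_nonneg _), ← Real.exp_add]; ring_nf
  calc ∫⁻ x, ENNReal.ofReal (w x) * g (F x) ∂μ = ∫⁻ x, g x ∂ν := by
        have := h.lintegral_map_withDensity (μ := μ) hwm 0 hg
        simpa using this.symm
    _ ≤ ∫⁻ x, g x ∂((ENNReal.ofReal (Real.exp (2 * R * t₀)) * W) • μ) := lintegral_mono' hle le_rfl
    _ = _ := by rw [lintegral_smul_measure]; rfl

/-- Exponential decay of correlations, for nonnegative functions. -/
theorem lintegral_mul_comp_iterate_le (h : IsGibbsMarkov m F α j η θ K t₀) (hμm : μ ≪ m)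
    (hF : MeasurePreserving F μ μ) (hR : R = 3 * K / (1 - θ))
    (hc : c = Real.exp (-(2 * R * t₀)) * (K / R)) {w : Λ → ℝ}
    (hw : IsRegularWeight F α η K w) {g : Λ → ℝ≥0∞} (hg : Measurable g) (k : ℕ) :
    (∫⁻ x, ENNReal.ofReal (w x) * g (F^[k + 1] x) ∂μ
      ≤ (∫⁻ x, ENNReal.ofReal (w x) ∂μ) * ∫⁻ x, g x ∂μ
        + ENNReal.ofReal ((1 - c) ^ k * Real.exp (2 * R * t₀)) *
          ((∫⁻ x, ENNReal.ofReal (w x) ∂μ) * ∫⁻ x, g x ∂μ)) ∧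
    ((∫⁻ x, ENNReal.ofReal (w x) ∂μ) * ∫⁻ x, g x ∂μ
      ≤ ∫⁻ x, ENNReal.ofReal (w x) * g (F^[k + 1] x) ∂μ
        + ENNReal.ofReal ((1 - c) ^ k * Real.exp (2 * R * t₀)) *
          ((∫⁻ x, ENNReal.ofReal (w x) ∂μ) * ∫⁻ x, g x ∂μ)) := by
  have h1θ : 0 < 1 - θ := by linarith [h.theta_lt_one]
  have hRθ : R * (1 - θ) = 3 * K := by rw [hR]; field_simp
  have hK := h.K_pos
  have hKR : K < R := by nlinarith [h.theta_nonneg]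
  have hRpos : 0 < R := hK.trans hKR
  have hRθ' : R * θ + K ≤ R - K := by nlinarith
  have hc1 : c ≤ 1 := by
    rw [hc]
    refine mul_le_one₀ ?_ (div_nonneg hK.le hRpos.le) ?_
    · rw [Real.exp_le_one_iff]
      have := mul_nonneg hRpos.le h.t₀_nonneg
      linarith
    · rw [div_le_one hRpos]; exact hKR.le
  have hμ := h.isLogHolder_invariant hμm hF hR
  have hwm := hw.bdd.1.ennreal_ofReal
  have hν := h.isLogHolder_map_of_weight hμm hμ hR hw
  set W := ∫⁻ x, ENNReal.ofReal (w x) ∂μ with hW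
  have hWfin : W ≠ ∞ := (hw.bdd.integrable (μ := μ)).lintegral_lt_top.ne
  set ν := (μ.withDensity fun x => ENNReal.ofReal (w x)).map F with hνdef
  have hmass : ν univ = W := by
    rw [hνdef, Measure.map_apply h.measurable .univ, preimage_univ, withDensity_apply _ .univ,
      Measure.restrict_univ]
  have hνfin : IsFiniteMeasure ν := ⟨by rw [hmass]; exact hWfin.lt_top⟩
  -- W • μ is invariant and has the mass of ν, so loss of memory between the two, used in both
  -- directions, is decay of correlations for w.
  have hμW := hμ.smul W
  have hμWfin : IsFiniteMeasure (W • μ) := μ.smul_finite hWfin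
  have hmass' : (W • μ) univ = W := by simp
  have hFk := hF.iterate k
  have hmapμ : (W • μ).map F^[k] = W • μ := by rw [Measure.map_smul, hFk.map_eq]
  have hm : ∫⁻ x, g x ∂m ≤ ENNReal.ofReal (Real.exp (R * t₀)) * ∫⁻ x, g x ∂μ := by
    have := lintegral_mono' (h.le_smul_of_isLogHolder hμ) (le_refl g)
    rwa [lintegral_smul_measure] at this
  have key : ENNReal.ofReal ((1 - c) ^ k * Real.exp (R * t₀)) * W * ∫⁻ x, g x ∂m
      ≤ ENNReal.ofReal ((1 - c) ^ k * Real.exp (2 * R * t₀)) * (W * ∫⁻ x, g x ∂μ) := by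
    calc ENNReal.ofReal ((1 - c) ^ k * Real.exp (R * t₀)) * W * ∫⁻ x, g x ∂m
        ≤ ENNReal.ofReal ((1 - c) ^ k * Real.exp (R * t₀)) * W *
          (ENNReal.ofReal (Real.exp (R * t₀)) * ∫⁻ x, g x ∂μ) := by gcongr
      _ = ENNReal.ofReal ((1 - c) ^ k * Real.exp (R * t₀)) * ENNReal.ofReal (Real.exp (R * t₀))
          * (W * ∫⁻ x, g x ∂μ) := by ring
      _ = _ := by
        have hp : 0 ≤ (1 - c) ^ k := pow_nonneg (by linarith) k
        rw [← ENNReal.ofReal_mul (by positivity), mul_assoc, ← Real.exp_add]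
        ring_nf
  rw [← h.lintegral_map_withDensity (μ := μ) hwm k hg]
  constructor
  · have h1 := h.map_iterate_le_add hKR hRθ' hc k ν (W • μ) hνfin hμWfin hν hμW
      (by rw [hmass, hmass'])
    rw [hmapμ, hmass] at h1
    have h2 := lintegral_mono' h1 (le_refl g)
    rw [lintegral_add_measure, lintegral_smul_measure, lintegral_smul_measure] at h2
    exact h2.trans (add_le_add_right key _)
  · have h1 := h.map_iterate_le_add hKR hRθ' hc k (W • μ) ν hμWfin hνfin hμW hν
      (by rw [hmass, hmass'])
    rw [hmapμ, hmass'] at h1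
    have h2 := lintegral_mono' h1 (le_refl g)
    rw [lintegral_add_measure, lintegral_smul_measure, lintegral_smul_measure] at h2
    exact h2.trans (add_le_add_right key _)

theorem integral_mul_comp_le (h : IsGibbsMarkov m F α j η θ K t₀) (hμm : μ ≪ m)
    (hF : MeasurePreserving F μ μ) (hR : R = 3 * K / (1 - θ)) {w : Λ → ℝ}
    (hw : IsRegularWeight F α η K w) {g : Λ → ℝ} (hg : IsBddMeasurable g) (hg0 : ∀ x, 0 ≤ g x) :
    ∫ x, w x * g (F x) ∂μ ≤ Real.exp (2 * R * t₀) * (∫ x, w x ∂μ) * ∫ x, g x ∂μ := by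
  have h1 := h.lintegral_mul_comp_le hμm hF hR hw hg.1.ennreal_ofReal
  have hW0 : 0 ≤ ∫ x, w x ∂μ := integral_nonneg hw.nonneg
  simp only [← ENNReal.ofReal_mul (hw.nonneg _)] at h1
  have hp : IsBddMeasurable (fun x => w x * g (F x)) := hw.bdd.mul (hg.comp h.measurable)
  rw [← ofReal_integral_eq_lintegral_ofReal hp.integrable
      (.of_forall fun x => mul_nonneg (hw.nonneg x) (hg0 _)),
    ← ofReal_integral_eq_lintegral_ofReal hw.bdd.integrable (.of_forall hw.nonneg),
    ← ofReal_integral_eq_lintegral_ofReal hg.integrable (.of_forall hg0),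
    ← ENNReal.ofReal_mul (Real.exp_nonneg _), ← ENNReal.ofReal_mul (by positivity)] at h1
  exact (ENNReal.ofReal_le_ofReal_iff
    (mul_nonneg (by positivity) (integral_nonneg hg0))).1 h1

/-- Exponential decay of correlations against nonnegative integrable functions. -/
theorem abs_integral_mul_comp_iterate_sub_le_of_nonneg (h : IsGibbsMarkov m F α j η θ K t₀)
    (hμm : μ ≪ m) (hF : MeasurePreserving F μ μ) (hR : R = 3 * K / (1 - θ))
    (hc : c = Real.exp (-(2 * R * t₀)) * (K / R)) {w : Λ → ℝ}
    (hw : IsRegularWeight F α η K w) {g : Λ → ℝ} (hgm : Measurable g) (hg : Integrable g μ)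
    (hg0 : ∀ x, 0 ≤ g x) (k : ℕ) (hc1 : c ≤ 1) :
    |∫ x, w x * g (F^[k + 1] x) ∂μ - (∫ x, w x ∂μ) * ∫ x, g x ∂μ|
      ≤ (1 - c) ^ k * Real.exp (2 * R * t₀) * ((∫ x, w x ∂μ) * ∫ x, g x ∂μ) := by
  have h1 := h.lintegral_mul_comp_iterate_le hμm hF hR hc hw hgm.ennreal_ofReal k
  have hW0 : 0 ≤ ∫ x, w x ∂μ := integral_nonneg hw.nonneg
  have hG0 : 0 ≤ ∫ x, g x ∂μ := integral_nonneg hg0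
  simp only [← ENNReal.ofReal_mul (hw.nonneg _)] at h1
  obtain ⟨C, hC⟩ := hw.bdd.2
  have hp : Integrable (fun x => w x * g (F^[k + 1] x)) μ :=
    ((hF.iterate (k + 1)).integrable_comp_of_integrable hg).bdd_mul
      hw.bdd.1.aestronglyMeasurable (.of_forall hC)
  have hp0 : ∀ x, 0 ≤ w x * g (F^[k + 1] x) := fun x => mul_nonneg (hw.nonneg x) (hg0 _)
  have hpi : 0 ≤ ∫ x, w x * g (F^[k + 1] x) ∂μ := integral_nonneg hp0
  have hγ : 0 ≤ (1 - c) ^ k := pow_nonneg (by linarith) k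
  rw [← ofReal_integral_eq_lintegral_ofReal hp (.of_forall hp0),
    ← ofReal_integral_eq_lintegral_ofReal hw.bdd.integrable (.of_forall hw.nonneg),
    ← ofReal_integral_eq_lintegral_ofReal hg (.of_forall hg0),
    ← ENNReal.ofReal_mul hW0, ← ENNReal.ofReal_mul (by positivity),
    ← ENNReal.ofReal_add (by positivity) (by positivity),
    ← ENNReal.ofReal_add (by positivity) (by positivity),
    ENNReal.ofReal_le_ofReal_iff (by positivity),
    ENNReal.ofReal_le_ofReal_iff (by positivity)] at h1
  rw [abs_le]
  constructor <;> linarith [h1.1, h1.2]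

/-- Splitting g into positive and negative parts keeps its L¹ norm on the right. That norm, rather
than an L² norm, is what makes the corrector bounded. -/
theorem abs_integral_mul_comp_iterate_sub_le (h : IsGibbsMarkov m F α j η θ K t₀)
    (hμm : μ ≪ m) (hF : MeasurePreserving F μ μ) (hR : R = 3 * K / (1 - θ))
    (hc : c = Real.exp (-(2 * R * t₀)) * (K / R)) (hc1 : c ≤ 1) {w : Λ → ℝ}
    (hw : IsRegularWeight F α η K w) {g : Λ → ℝ} (hgm : Measurable g) (hg : Integrable g μ)
    (k : ℕ) :
    |∫ x, w x * g (F^[k + 1] x) ∂μ - (∫ x, w x ∂μ) * ∫ x, g x ∂μ|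
      ≤ (1 - c) ^ k * Real.exp (2 * R * t₀) * ((∫ x, w x ∂μ) * ∫ x, |g x| ∂μ) := by
  set gp : Λ → ℝ := fun x => max (g x) 0 with hgp
  set gn : Λ → ℝ := fun x => max (-g x) 0 with hgn
  have hgpm : Measurable gp := hgm.max measurable_const
  have hgnm : Measurable gn := hgm.neg.max measurable_const
  have hgpi : Integrable gp μ := hg.pos_part
  have hgni : Integrable gn μ := hg.neg_part
  have h1 := h.abs_integral_mul_comp_iterate_sub_le_of_nonneg hμm hF hR hc hw hgpm hgpi
    (fun x => le_max_right _ _) k hc1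
  have h2 := h.abs_integral_mul_comp_iterate_sub_le_of_nonneg hμm hF hR hc hw hgnm hgni
    (fun x => le_max_right _ _) k hc1
  obtain ⟨C, hC⟩ := hw.bdd.2
  have hint : ∀ f : Λ → ℝ, Integrable f μ → Integrable (fun x => w x * f (F^[k + 1] x)) μ :=
    fun f hf => ((hF.iterate (k + 1)).integrable_comp_of_integrable hf).bdd_mul
      hw.bdd.1.aestronglyMeasurable (.of_forall hC)
  have e0 : ∀ x, g x = gp x - gn x := fun x => by
    simp only [hgp, hgn]
    rcases le_total (g x) 0 with hx | hx
    · rw [max_eq_right hx, max_eq_left (by linarith)]; ring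
    · rw [max_eq_left hx, max_eq_right (by linarith)]; ring
  have e0' : ∀ x, |g x| = gp x + gn x := fun x => by
    simp only [hgp, hgn]
    rcases le_total (g x) 0 with hx | hx
    · rw [max_eq_right hx, max_eq_left (by linarith), abs_of_nonpos hx]; ring
    · rw [max_eq_left hx, max_eq_right (by linarith), abs_of_nonneg hx]; ring
  have e1 : ∫ x, g x ∂μ = ∫ x, gp x ∂μ - ∫ x, gn x ∂μ := by
    rw [← integral_sub hgpi hgni]
    exact integral_congr_ae (.of_forall e0)
  have e2 : ∫ x, |g x| ∂μ = ∫ x, gp x ∂μ + ∫ x, gn x ∂μ := by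
    rw [← integral_add hgpi hgni]
    exact integral_congr_ae (.of_forall e0')
  have e3 : ∫ x, w x * g (F^[k + 1] x) ∂μ
      = ∫ x, w x * gp (F^[k + 1] x) ∂μ - ∫ x, w x * gn (F^[k + 1] x) ∂μ := by
    rw [← integral_sub (hint gp hgpi) (hint gn hgni)]
    refine integral_congr_ae (.of_forall fun x => ?_)
    beta_reduce
    rw [e0]; ring
  rw [e1, e2, e3]
  have h3 := abs_sub (∫ x, w x * gp (F^[k + 1] x) ∂μ - (∫ x, w x ∂μ) * ∫ x, gp x ∂μ)
    (∫ x, w x * gn (F^[k + 1] x) ∂μ - (∫ x, w x ∂μ) * ∫ x, gn x ∂μ)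
  refine le_trans (le_of_eq ?_) (h3.trans ((add_le_add h1 h2).trans (le_of_eq ?_)))
  · congr 1; ring
  · ring

end IsGibbsMarkov

/-! ### Martingale–coboundary decomposition -/

/-- Let U be composition with F on L² and P its adjoint. The series χ = ∑_{k ≥ 1} P^k f satisfies Pf
+ Pχ = χ, and PU is the identity, so P annihilates f + χ - Uχ, which is the orthogonality claimed.
As the decay is measured against L¹, duality bounds χ uniformly. -/
theorem exists_corrector {Ω : Type*} [MeasurableSpace Ω] {μ : Measure Ω} [IsProbabilityMeasure μ]
    {F : Ω → Ω} (hF : MeasurePreserving F μ μ) {f : Ω → ℝ} (hf : IsBddMeasurable f)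
    {A γ : ℝ} (hA : 0 ≤ A) (hγ0 : 0 ≤ γ) (hγ1 : γ < 1)
    (hdec : ∀ k : ℕ, ∀ g : Ω → ℝ, Measurable g → Integrable g μ →
      |∫ x, f x * g (F^[k + 1] x) ∂μ| ≤ A * γ ^ k * ∫ x, |g x| ∂μ) :
    ∃ χ : Ω → ℝ, IsBddMeasurable χ ∧ (∀ x, |χ x| ≤ A / (1 - γ)) ∧
      ∀ g : Ω → ℝ, IsBddMeasurable g → ∫ x, (f x + χ x - χ (F x)) * g (F x) ∂μ = 0 := by
  let U := Lp.compMeasurePreservingₗᵢ ℝ (E := ℝ) (p := 2) F hF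
  let P := ContinuousLinearMap.adjoint U.toContinuousLinearMap
  have hf2 : MemLp f 2 μ := hf.memLp 2
  let f' : Lp ℝ 2 μ := hf2.toLp f
  have hU : ∀ (k : ℕ) (G : Lp ℝ 2 μ),
      ((U.toContinuousLinearMap ^ k) G : Lp ℝ 2 μ) =ᵐ[μ] fun x => G (F^[k] x) := by
    intro k
    induction k with
    | zero => intro G; exact .rfl
    | succ k ih =>
      intro G
      rw [pow_succ]
      have h1 := ih (U G)
      have h2 : (U G : Lp ℝ 2 μ) =ᵐ[μ] G ∘ F := Lp.coeFn_compMeasurePreserving G hF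
      have h3 := (hF.iterate k).quasiMeasurePreserving.ae_eq_comp h2
      refine h1.trans (h3.trans (.of_forall fun x => ?_))
      simp only [Function.comp_apply, ← Function.iterate_succ_apply' F]
  have hinner : ∀ a b : Lp ℝ 2 μ, inner ℝ a b = ∫ x, a x * b x ∂μ := fun a b => by
    rw [L2.inner_def]
    refine integral_congr_ae (.of_forall fun x => ?_)
    simp [mul_comm]
  let X : ℕ → Lp ℝ 2 μ := fun k => (P ^ (k + 1)) f'
  have hPadj : ∀ (k : ℕ) (a b : Lp ℝ 2 μ),
      inner ℝ ((P ^ k) a) b = inner ℝ a ((U.toContinuousLinearMap ^ k) b) := by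
    intro k
    induction k with
    | zero => intro a b; rfl
    | succ k ih =>
      intro a b
      rw [pow_succ, pow_succ']
      change inner ℝ ((P ^ k) (P a)) b = inner ℝ a (U.toContinuousLinearMap
        ((U.toContinuousLinearMap ^ k) b))
      rw [ih, ContinuousLinearMap.adjoint_inner_left]
  have hX : ∀ k G, |inner ℝ (X k) G| ≤ A * γ ^ k * ∫ x, |G x| ∂μ := by
    intro k G
    have h1 : inner ℝ (X k) G = ∫ x, f x * G (F^[k + 1] x) ∂μ := by
      rw [hPadj, hinner]
      refine integral_congr_ae ?_
      filter_upwards [hU (k + 1) G, hf2.coeFn_toLp] with x hx hx'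
      rw [hx, hx']
    rw [h1]
    exact hdec k G (Lp.stronglyMeasurable G).measurable
      ((Lp.memLp G).integrable (by norm_num))
  have hL1 : ∀ G : Lp ℝ 2 μ, ∫ x, |G x| ∂μ ≤ ‖G‖ := by
    intro G
    have h1 : ∫ x, |G x| ∂μ = (eLpNorm G 1 μ).toReal := by
      rw [eLpNorm_one_eq_lintegral_enorm, integral_eq_lintegral_of_nonneg_ae
        (.of_forall fun x => abs_nonneg _) (Lp.stronglyMeasurable G).measurable.norm.aestronglyMeasurable]
      congr 1
      refine lintegral_congr fun x => ?_
      rw [← Real.norm_eq_abs, ofReal_norm]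
    rw [h1, Lp.norm_def]
    exact ENNReal.toReal_mono (Lp.eLpNorm_ne_top G)
      (eLpNorm_le_eLpNorm_of_exponent_le (by norm_num) (Lp.aestronglyMeasurable G))
  -- Pair X k with itself and use that the L¹ norm is at most the L² norm.
  have hXn : ∀ k, ‖X k‖ ≤ A * γ ^ k := by
    intro k
    by_contra hlt
    push Not at hlt
    have h1 := (le_abs_self _).trans (hX k (X k))
    rw [real_inner_self_eq_norm_sq] at h1
    have h2 := hL1 (X k)
    have h3 : 0 ≤ A * γ ^ k := by positivity
    nlinarith
  have hgeo : Summable fun k => A * γ ^ k :=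
    (summable_geometric_of_lt_one hγ0 hγ1).mul_left A
  have hsum : Summable X := .of_norm_bounded hgeo hXn
  let χ' : Lp ℝ 2 μ := ∑' k, X k
  set B := A / (1 - γ) with hB
  have hB0 : 0 ≤ B := div_nonneg hA (by linarith)
  have hχ' : ∀ G, |inner ℝ χ' G| ≤ B * ∫ x, |G x| ∂μ := by
    intro G
    have hi : 0 ≤ ∫ x, |G x| ∂μ := integral_nonneg fun _ => abs_nonneg _
    have h1 : HasSum (fun k => inner ℝ (X k) G) (inner ℝ χ' G) :=
      hsum.hasSum.mapL ((innerSL ℝ).flip G)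
    have h2 : HasSum (fun k => A * γ ^ k * ∫ x, |G x| ∂μ) (B * ∫ x, |G x| ∂μ) := by
      have := ((hasSum_geometric_of_lt_one hγ0 hγ1).mul_left A).mul_right (∫ x, |G x| ∂μ)
      rwa [← div_eq_mul_inv] at this
    rw [abs_le]
    constructor
    · have h3 := hasSum_le (fun k => (abs_le.1 (hX k G)).1) h2.neg h1
      exact h3
    · exact hasSum_le (fun k => (abs_le.1 (hX k G)).2) h1 h2
  have hχi : Integrable χ' μ := (Lp.memLp χ').integrable (by norm_num)
  -- Testing against indicators bounds the mean of χ' over every set, hence χ' almost everywhere.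
  have hset : ∀ s, MeasurableSet s → |∫ x in s, χ' x ∂μ| ≤ B * μ.real s := by
    intro s hs
    have hm : MemLp (s.indicator fun _ => (1 : ℝ)) 2 μ :=
      (memLp_const 1).indicator hs
    have h1 := hχ' (hm.toLp _)
    have h2 : inner ℝ χ' (hm.toLp _) = ∫ x in s, χ' x ∂μ := by
      rw [hinner, ← integral_indicator hs]
      refine integral_congr_ae ?_
      filter_upwards [hm.coeFn_toLp] with x hx
      rw [hx]
      by_cases hxs : x ∈ s <;> simp [hxs]
    have h3 : ∫ x, |(hm.toLp _ : Lp ℝ 2 μ) x| ∂μ = μ.real s := by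
      rw [← integral_indicator_one hs]
      refine integral_congr_ae ?_
      filter_upwards [hm.coeFn_toLp] with x hx
      rw [hx]
      by_cases hxs : x ∈ s <;> simp [hxs]
    rwa [h2, h3] at h1
  have hub : (χ' : Ω → ℝ) ≤ᵐ[μ] fun _ => B := by
    refine ae_le_of_forall_setIntegral_le hχi (integrable_const B) fun s hs _ => ?_
    rw [setIntegral_const, smul_eq_mul, mul_comm]
    exact (le_abs_self _).trans (hset s hs)
  have hlb : (fun _ => -B) ≤ᵐ[μ] (χ' : Ω → ℝ) := by
    refine ae_le_of_forall_setIntegral_le (integrable_const (-B)) hχi fun s hs _ => ?_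
    rw [setIntegral_const, smul_eq_mul, mul_comm]
    linarith [neg_abs_le (∫ x in s, χ' x ∂μ), hset s hs]
  -- Clipping changes χ' on a null set only and makes the bound hold at every point, as the pathwise
  -- estimates require.
  let χ : Ω → ℝ := fun x => max (-B) (min (χ' x) B)
  have hχm : Measurable χ :=
    measurable_const.max ((Lp.stronglyMeasurable χ').measurable.min measurable_const)
  have hχB : ∀ x, |χ x| ≤ B := fun x => by
    rw [abs_le]
    exact ⟨le_max_left _ _, max_le (by linarith) (min_le_right _ _)⟩
  have hχχ' : χ =ᵐ[μ] χ' := by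
    filter_upwards [hub, hlb] with x h1 h2
    simp only [χ]
    rw [min_eq_left h1, max_eq_right h2]
  refine ⟨χ, ⟨hχm, B, hχB⟩, hχB, fun g hg => ?_⟩
  have hg2 : MemLp g 2 μ := hg.memLp 2
  let G : Lp ℝ 2 μ := hg2.toLp g
  have hPχ : P f' + P χ' = χ' := by
    have h1 : P χ' = ∑' k, X (k + 1) := by
      rw [P.map_tsum hsum]
      refine tsum_congr fun k => ?_
      simp only [X]
      rw [pow_succ' P (k + 1)]
      rfl
    have h2 : P f' = X 0 := by simp [X]
    rw [h1, h2]
    exact (hsum.tsum_eq_zero_add).symm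
  have hzero : inner ℝ (f' + χ' - U χ') (U G) = 0 := by
    have e1 : ∀ a : Lp ℝ 2 μ, inner ℝ a (U G) = inner ℝ (P a) G := fun a =>
      (ContinuousLinearMap.adjoint_inner_left U.toContinuousLinearMap G a).symm
    rw [inner_sub_left, LinearIsometry.inner_map_map, e1, map_add, hPχ, sub_self]
  rw [hinner] at hzero
  rw [← hzero]
  refine integral_congr_ae ?_
  have c1 : (U χ' : Lp ℝ 2 μ) =ᵐ[μ] χ' ∘ F := Lp.coeFn_compMeasurePreserving χ' hF
  have c2 : (U G : Lp ℝ 2 μ) =ᵐ[μ] G ∘ F := Lp.coeFn_compMeasurePreserving G hF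
  have c3 := hF.quasiMeasurePreserving.ae_eq_comp hχχ'
  have c4 := hF.quasiMeasurePreserving.ae_eq_comp hg2.coeFn_toLp
  filter_upwards [c1, c2, c3, c4, hχχ', hf2.coeFn_toLp, Lp.coeFn_sub (f' + χ') (U χ'),
    Lp.coeFn_add f' χ'] with x d1 d2 d3 d4 d5 d6 d7 d8
  simp only [Function.comp_apply] at d1 d2 d3 d4
  rw [d7, Pi.sub_apply, d8, Pi.add_apply, d1, d2, ← d3, d4, ← d5, d6]

/-! ### Iterated Birkhoff sums -/

/-- `iteratedBirkhoffSum f u w k x = ∑_{i < j < k} u (f^i x) * w (f^j x)`. -/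
def iteratedBirkhoffSum {Ω : Type*} (f : Ω → Ω) (u w : Ω → ℝ) (k : ℕ) (x : Ω) : ℝ :=
  ∑ j ∈ Finset.range k, ∑ i ∈ Finset.range j, u (f^[i] x) * w (f^[j] x)

section iterated

variable {Ω : Type*} (f : Ω → Ω) (u w : Ω → ℝ)

theorem iteratedBirkhoffSum_succ (k : ℕ) (x : Ω) :
    iteratedBirkhoffSum f u w (k + 1) x
      = iteratedBirkhoffSum f u w k x + birkhoffSum f u k x * w (f^[k] x) := by
  rw [iteratedBirkhoffSum, Finset.sum_range_succ, birkhoffSum, Finset.sum_mul]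
  rfl

/-- Chen's relation: a pair i < j lies in the first block, lies in the second, or straddles them. -/
theorem iteratedBirkhoffSum_add (k l : ℕ) (x : Ω) :
    iteratedBirkhoffSum f u w (k + l) x = iteratedBirkhoffSum f u w k x
      + iteratedBirkhoffSum f u w l (f^[k] x)
      + birkhoffSum f u k x * birkhoffSum f w l (f^[k] x) := by
  induction l with
  | zero => simp [iteratedBirkhoffSum]
  | succ l ih =>
    rw [← add_assoc, iteratedBirkhoffSum_succ, ih, iteratedBirkhoffSum_succ, birkhoffSum_add,
      birkhoffSum_succ, ← Function.iterate_add_apply, add_comm l k]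
    ring

theorem iteratedBirkhoffSum_succ' (k : ℕ) (x : Ω) :
    iteratedBirkhoffSum f u w (k + 1) x
      = u x * birkhoffSum f w k (f x) + iteratedBirkhoffSum f u w k (f x) := by
  rw [add_comm k 1, iteratedBirkhoffSum_add]
  simp [iteratedBirkhoffSum, add_comm]

variable {f u w}

theorem reverseTransform_succ (m : Ω → ℝ) (e : ℕ → Ω → ℝ) (k : ℕ) (x : Ω) :
    reverseTransform f m e (k + 1) x = m x * e k (f x) + reverseTransform f m e k (f x) :=
  rfl

theorem birkhoffSum_eq_reverseTransform {χ m : Ω → ℝ} {c : ℝ}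
    (h : ∀ x, m x = u x - c + χ x - χ (f x)) (k : ℕ) (x : Ω) :
    birkhoffSum f u k x = reverseTransform f m (fun _ _ => 1) k x + χ (f^[k] x) - χ x + k * c := by
  induction k generalizing x with
  | zero => simp [reverseTransform]
  | succ k ih =>
    rw [birkhoffSum_succ', ih (f x), reverseTransform_succ, h x, ← Function.iterate_succ_apply]
    push_cast; ring

/-- Summation by parts: in the earlier factor put u = m + c - χ + χ∘F. The coboundary telescopes
against the sums over the later index, whose increments are values of w. -/
theorem iteratedBirkhoffSum_eq_reverseTransform {χ m : Ω → ℝ} {c : ℝ}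
    (h : ∀ x, m x = u x - c + χ x - χ (f x)) (k : ℕ) (x : Ω) :
    iteratedBirkhoffSum f u w k x = reverseTransform f m (birkhoffSum f w) k x
      - χ x * birkhoffSum f w k x + birkhoffSum f (fun x => χ x * w x) k x
      + c * reverseTransform f (fun _ => 1) (birkhoffSum f w) k x := by
  induction k generalizing x with
  | zero => simp [reverseTransform, iteratedBirkhoffSum]
  | succ k ih =>
    rw [iteratedBirkhoffSum_succ', ih (f x), reverseTransform_succ, reverseTransform_succ,
      birkhoffSum_succ', birkhoffSum_succ', h x]
    ring

theorem abs_reverseTransform_one_le {e : ℕ → Ω → ℝ} {n : ℕ} {x : Ω} (k l : ℕ) (hkl : k + l = n) :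
    |reverseTransform f (fun _ => 1) e k (f^[l] x)| ≤ k * suffixMax f e n x := by
  induction k generalizing l with
  | zero => simp [reverseTransform]
  | succ k ih =>
    have h1 := ih (l + 1) (by omega)
    have h2 := abs_le_suffixMax (F := f) (g := e) k (l + 1) x
    rw [show k + (l + 1) = n by omega] at h2
    rw [Function.iterate_succ_apply'] at h1 h2
    rw [reverseTransform_succ, one_mul]
    push_cast
    linarith [abs_add_le (e k (f (f^[l] x))) (reverseTransform f (fun _ => 1) e k (f (f^[l] x)))]

theorem abs_birkhoffSum_le_birkhoffSum {Z : Ω → ℝ} (h : ∀ x, |u x| ≤ Z x) (k : ℕ) (x : Ω) :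
    |birkhoffSum f u k x| ≤ birkhoffSum f Z k x :=
  (Finset.abs_sum_le_sum_abs _ _).trans (Finset.sum_le_sum fun _ _ => h _)

theorem birkhoffSum_iterate_le {Z : Ω → ℝ} (h0 : ∀ x, 0 ≤ Z x) (k l : ℕ) (x : Ω) :
    birkhoffSum f Z k (f^[l] x) ≤ birkhoffSum f Z (l + k) x := by
  rw [birkhoffSum_add]
  exact le_add_of_nonneg_left (Finset.sum_nonneg fun _ _ => h0 _)

theorem birkhoffSum_mono_of_nonneg {Z : Ω → ℝ} (h0 : ∀ x, 0 ≤ Z x) {k l : ℕ} (hkl : k ≤ l)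
    (x : Ω) : birkhoffSum f Z k x ≤ birkhoffSum f Z l x := by
  obtain ⟨j, rfl⟩ := Nat.exists_eq_add_of_le hkl
  rw [birkhoffSum_add]
  exact le_add_of_nonneg_right (Finset.sum_nonneg fun _ _ => h0 _)

/-- Doob's inequality controls sums over final segments of the orbit; initial segments are recovered
as S_k = S_n - S_{n-k}∘F^k, at the price of a factor 2. -/
theorem abs_birkhoffSum_le_suffixMax {n k : ℕ} (hk : k ≤ n) (x : Ω) :
    |birkhoffSum f u k x| ≤ 2 * suffixMax f (birkhoffSum f u) n x := by
  have h1 := birkhoffSum_add f u k (n - k) x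
  rw [Nat.add_sub_cancel' hk] at h1
  have h2 := abs_le_suffixMax (F := f) (g := birkhoffSum f u) (n - k) k x
  rw [Nat.sub_add_cancel hk] at h2
  have h3 := abs_le_suffixMax_self (F := f) (g := birkhoffSum f u) n x
  have h4 : birkhoffSum f u k x = birkhoffSum f u n x - birkhoffSum f u (n - k) (f^[k] x) := by
    linarith
  rw [h4]
  linarith [abs_sub (birkhoffSum f u n x) (birkhoffSum f u (n - k) (f^[k] x))]

/-- Initial segments again from final ones, with the cross term of Chen's relation. -/
theorem abs_iteratedBirkhoffSum_le_suffixMax {n k : ℕ} (hk : k ≤ n) (x : Ω) :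
    |iteratedBirkhoffSum f u w k x| ≤ 2 * suffixMax f (iteratedBirkhoffSum f u w) n x
      + 2 * suffixMax f (birkhoffSum f u) n x * suffixMax f (birkhoffSum f w) n x := by
  have h1 := iteratedBirkhoffSum_add f u w k (n - k) x
  rw [Nat.add_sub_cancel' hk] at h1
  have h2 := abs_le_suffixMax (F := f) (g := iteratedBirkhoffSum f u w) (n - k) k x
  rw [Nat.sub_add_cancel hk] at h2
  have h3 := abs_le_suffixMax_self (F := f) (g := iteratedBirkhoffSum f u w) n x
  have h4 := abs_birkhoffSum_le_suffixMax (f := f) (u := u) hk x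
  have h5 := abs_le_suffixMax (F := f) (g := birkhoffSum f w) (n - k) k x
  rw [Nat.sub_add_cancel hk] at h5
  have h6 : iteratedBirkhoffSum f u w k x = iteratedBirkhoffSum f u w n x
      - iteratedBirkhoffSum f u w (n - k) (f^[k] x)
      - birkhoffSum f u k x * birkhoffSum f w (n - k) (f^[k] x) := by linarith
  have h7 : |birkhoffSum f u k x * birkhoffSum f w (n - k) (f^[k] x)|
      ≤ 2 * suffixMax f (birkhoffSum f u) n x * suffixMax f (birkhoffSum f w) n x := by
    rw [abs_mul]
    exact mul_le_mul h4 h5 (abs_nonneg _) (mul_nonneg zero_le_two (suffixMax_nonneg n x))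
  rw [h6]
  have h8 := abs_sub (iteratedBirkhoffSum f u w n x
      - iteratedBirkhoffSum f u w (n - k) (f^[k] x))
      (birkhoffSum f u k x * birkhoffSum f w (n - k) (f^[k] x))
  have h9 := abs_sub (iteratedBirkhoffSum f u w n x)
      (iteratedBirkhoffSum f u w (n - k) (f^[k] x))
  linarith

end iterated

/-! ### Moment bounds for truncated excursion sums -/

/-- Properties of the excursion length `Z` truncated at `n`. -/
structure IsExcursionLength {Ω : Type*} [MeasurableSpace Ω] (μ : Measure Ω) (F : Ω → Ω)
    (Z : Ω → ℝ) (n : ℕ) (p D B : ℝ) : Prop where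
  bdd : IsBddMeasurable Z
  nonneg : ∀ x, 0 ≤ Z x
  le_sq : ∀ x, Z x ≤ Z x ^ 2
  integral_mul_comp_le : ∀ s : ℝ, 0 ≤ s → ∀ h : Ω → ℝ, IsBddMeasurable h → (∀ x, 0 ≤ h x) →
    ∫ x, Z x ^ s * h (F x) ∂μ ≤ D * (∫ x, Z x ^ s ∂μ) * ∫ x, h x ∂μ
  integral_rpow_le : ∀ s : ℝ, 2 ≤ s → s ≤ p → ∫ x, Z x ^ s ∂μ ≤ B
  integral_rpow_le_mul : ∀ q : ℝ, 2 ≤ q → q ≤ 2 * (p - 1) →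
    ∫ x, Z x ^ q ∂μ ≤ B * (n : ℝ) ^ (q / 2 - 1)

/-- A martingale–coboundary decomposition `u = m - χ + χ ∘ F + c` with bounds of size `H`. -/
structure IsMartingaleDecomposition {Ω : Type*} [MeasurableSpace Ω] (μ : Measure Ω) (F : Ω → Ω)
    (Z : Ω → ℝ) (n : ℕ) (H : ℝ) (u χ m : Ω → ℝ) (c : ℝ) : Prop where
  bdd : IsBddMeasurable u
  bdd_martingale : IsBddMeasurable m
  bdd_corrector : IsBddMeasurable χ
  eq : ∀ x, m x = u x - c + χ x - χ (F x)
  abs_le_length : ∀ x, |u x| ≤ Z x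
  corrector_le : ∀ x, |χ x| ≤ H
  mean_le : |c| * n ≤ H
  martingale_le : ∀ᵐ x ∂μ, |m x| ≤ H * Z x
  orthogonal : ∀ h : Ω → ℝ, IsBddMeasurable h → ∫ x, m x * h (F x) ∂μ = 0

section moments

variable {Ω : Type*} [MeasurableSpace Ω] {μ : Measure Ω} {F : Ω → Ω}
  {Z : Ω → ℝ} {n : ℕ} {p D B H c P : ℝ} {u χ m : Ω → ℝ}

theorem IsMartingaleDecomposition.abs_birkhoffSum_le
    (hm : IsMartingaleDecomposition μ F Z n H u χ m c) {k : ℕ} (hk : k ≤ n) (x : Ω) :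
    |birkhoffSum F u k x| ≤ |reverseTransform F m (fun _ _ => 1) k x| + 3 * H := by
  rw [birkhoffSum_eq_reverseTransform hm.eq]
  have h1 := hm.corrector_le (F^[k] x)
  have h2 := hm.corrector_le x
  have h3 : |(k : ℝ) * c| ≤ H := by
    rw [abs_mul, Nat.abs_cast, mul_comm]
    refine le_trans ?_ hm.mean_le
    gcongr
  have a1 := abs_le.1 h1
  have a2 := abs_le.1 h2
  have a3 := abs_le.1 h3
  have a4 := neg_abs_le (reverseTransform F m (fun _ _ => 1) k x)
  have a5 := le_abs_self (reverseTransform F m (fun _ _ => 1) k x)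
  rw [abs_le]
  constructor <;> linarith

theorem IsMartingaleDecomposition.suffixMax_birkhoffSum_le
    (hm : IsMartingaleDecomposition μ F Z n H u χ m c) (x : Ω) :
    suffixMax F (birkhoffSum F u) n x
      ≤ suffixMax F (reverseTransform F m (fun _ _ => 1)) n x + 3 * H := by
  refine suffixMax_le fun k l hkl => ?_
  refine (hm.abs_birkhoffSum_le (by omega) _).trans ?_
  have := abs_le_suffixMax (F := F) (g := reverseTransform F m (fun _ _ => 1)) k l x
  rw [hkl] at this
  linarith

theorem IsMartingaleDecomposition.suffixMax_iteratedBirkhoffSum_le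
    (hZ : IsExcursionLength μ F Z n p D B)
    (hm : IsMartingaleDecomposition μ F Z n H u χ m c) (hH : 1 ≤ H) {w : Ω → ℝ}
    (hw : ∀ x, |w x| ≤ Z x) (x : Ω) :
    suffixMax F (iteratedBirkhoffSum F u w) n x
      ≤ suffixMax F (reverseTransform F m (birkhoffSum F w)) n x
        + 2 * H * suffixMax F (birkhoffSum F w) n x
        + H * birkhoffSum F (fun x => Z x ^ 2) (n + 1) x := by
  refine suffixMax_le fun k l hkl => ?_
  rw [iteratedBirkhoffSum_eq_reverseTransform hm.eq]
  have h1 := abs_le_suffixMax (F := F) (g := reverseTransform F m (birkhoffSum F w)) k l x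
  have h2 := abs_le_suffixMax (F := F) (g := birkhoffSum F w) k l x
  rw [hkl] at h1 h2
  have hS := suffixMax_nonneg (F := F) (g := birkhoffSum F w) n x
  have h3 := hm.corrector_le (F^[l] x)
  have h4 : |χ (F^[l] x) * birkhoffSum F w k (F^[l] x)|
      ≤ H * suffixMax F (birkhoffSum F w) n x := by
    rw [abs_mul]
    exact mul_le_mul h3 h2 (abs_nonneg _) (by linarith)
  have h5 : |c * reverseTransform F (fun _ => 1) (birkhoffSum F w) k (F^[l] x)|
      ≤ H * suffixMax F (birkhoffSum F w) n x := by
    have h6 := abs_reverseTransform_one_le (f := F) (e := birkhoffSum F w) (x := x) k l hkl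
    have hkn : (k : ℝ) ≤ n := by exact_mod_cast (by omega : k ≤ n)
    rw [abs_mul]
    calc |c| * |reverseTransform F (fun _ => 1) (birkhoffSum F w) k (F^[l] x)|
        ≤ |c| * (k * suffixMax F (birkhoffSum F w) n x) := by gcongr
      _ ≤ |c| * (n * suffixMax F (birkhoffSum F w) n x) := by gcongr
      _ = |c| * n * suffixMax F (birkhoffSum F w) n x := by ring
      _ ≤ _ := by gcongr; exact hm.mean_le
  have h6 : |birkhoffSum F (fun x => χ x * w x) k (F^[l] x)|
      ≤ H * birkhoffSum F (fun x => Z x ^ 2) (n + 1) x := by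
    have e1 : ∀ y, |χ y * w y| ≤ H * Z y ^ 2 := fun y => by
      rw [abs_mul]
      exact mul_le_mul (hm.corrector_le y) ((hw y).trans (hZ.le_sq y)) (abs_nonneg _)
        (by linarith)
    have e2 := abs_birkhoffSum_le_birkhoffSum (f := F) (u := fun x => χ x * w x)
      (Z := fun x => H * Z x ^ 2) e1 k (F^[l] x)
    have e3 : birkhoffSum F (fun x => H * Z x ^ 2) k (F^[l] x)
        = H * birkhoffSum F (fun x => Z x ^ 2) k (F^[l] x) := by
      simp only [birkhoffSum, Finset.mul_sum]
    rw [e3] at e2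
    refine e2.trans ?_
    gcongr
    refine (birkhoffSum_iterate_le (fun x => sq_nonneg (Z x)) k l x).trans ?_
    exact birkhoffSum_mono_of_nonneg (fun x => sq_nonneg (Z x)) (by omega) x
  have h7 := abs_add_le (reverseTransform F m (birkhoffSum F w) k (F^[l] x)
      - χ (F^[l] x) * birkhoffSum F w k (F^[l] x)
      + birkhoffSum F (fun x => χ x * w x) k (F^[l] x))
    (c * reverseTransform F (fun _ => 1) (birkhoffSum F w) k (F^[l] x))
  have h8 := abs_add_le (reverseTransform F m (birkhoffSum F w) k (F^[l] x)
      - χ (F^[l] x) * birkhoffSum F w k (F^[l] x))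
      (birkhoffSum F (fun x => χ x * w x) k (F^[l] x))
  have h9 := abs_sub (reverseTransform F m (birkhoffSum F w) k (F^[l] x))
      (χ (F^[l] x) * birkhoffSum F w k (F^[l] x))
  linarith

variable [IsProbabilityMeasure μ]

theorem IsMartingaleDecomposition.integral_rpow_mul_le (hZ : IsExcursionLength μ F Z n p D B)
    (hm : IsMartingaleDecomposition μ F Z n H u χ m c) (hF : MeasurePreserving F μ μ)
    (hH : 1 ≤ H) {q : ℝ} (hq : 2 ≤ q) {h : Ω → ℝ} (hh : IsBddMeasurable h)
    (h0 : ∀ x, 0 ≤ h x) :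
    ∫ x, |m x| ^ q * h (F x) ∂μ ≤ H ^ q * (D * ∫ x, Z x ^ q ∂μ) * ∫ x, h x ∂μ := by
  have hq0 : 0 ≤ q := by linarith
  have hZq : IsBddMeasurable (fun x => Z x ^ q) := hZ.bdd.rpow hZ.nonneg hq0
  have hhF := hh.comp hF.measurable
  calc ∫ x, |m x| ^ q * h (F x) ∂μ ≤ ∫ x, H ^ q * (Z x ^ q * h (F x)) ∂μ := by
        refine integral_mono_ae (((hm.bdd_martingale.abs.rpow (fun _ => abs_nonneg _) hq0).mul
          hhF).integrable) ((IsBddMeasurable.const _).mul (hZq.mul hhF)).integrable ?_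
        filter_upwards [hm.martingale_le] with x hx
        rw [← mul_assoc, ← Real.mul_rpow (by linarith) (hZ.nonneg x)]
        exact mul_le_mul_of_nonneg_right (Real.rpow_le_rpow (abs_nonneg _) hx hq0) (h0 _)
    _ = H ^ q * ∫ x, Z x ^ q * h (F x) ∂μ := integral_const_mul _ _
    _ ≤ H ^ q * (D * (∫ x, Z x ^ q ∂μ) * ∫ x, h x ∂μ) := by
        gcongr
        exact hZ.integral_mul_comp_le q hq0 h hh h0
    _ = _ := by ring

theorem IsMartingaleDecomposition.integral_sq_mul_le (hZ : IsExcursionLength μ F Z n p D B)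
    (hm : IsMartingaleDecomposition μ F Z n H u χ m c) (hF : MeasurePreserving F μ μ)
    (hH : 1 ≤ H) (hD : 1 ≤ D) (hp : 2 ≤ p) {h : Ω → ℝ} (hh : IsBddMeasurable h)
    (h0 : ∀ x, 0 ≤ h x) :
    ∫ x, m x ^ 2 * h (F x) ∂μ ≤ H ^ 2 * D * B * ∫ x, h x ∂μ := by
  have h1 := hm.integral_rpow_mul_le hZ hF hH le_rfl hh h0
  have h2 := hZ.integral_rpow_le 2 le_rfl hp
  have h3 : 0 ≤ ∫ x, h x ∂μ := integral_nonneg h0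
  simp only [Real.rpow_two, sq_abs] at h1 h2
  calc ∫ x, m x ^ 2 * h (F x) ∂μ ≤ H ^ 2 * (D * ∫ x, Z x ^ 2 ∂μ) * ∫ x, h x ∂μ := h1
    _ ≤ H ^ 2 * (D * B) * ∫ x, h x ∂μ := by gcongr
    _ = _ := by ring

/-- Rosenthal's inequality with unit coefficients. The q-th moment of Z may grow like n^{q/2-1};
multiplied by n it matches the variance term n^{q/2}. This balance fixes the range q ≤ 2(p-1). -/
theorem IsMartingaleDecomposition.integral_sum_rpow_le (hZ : IsExcursionLength μ F Z n p D B)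
    (hm : IsMartingaleDecomposition μ F Z n H u χ m c) (hF : MeasurePreserving F μ μ)
    (hn : 1 ≤ n) (hH : 1 ≤ H) (hD : 1 ≤ D) (hB : 1 ≤ B) (hp : 2 ≤ p) {q C : ℝ}
    (hq : 2 ≤ q) (hqp : q ≤ 2 * (p - 1)) (hqP : q ≤ P)
    (hC : C = (2 * ((2 * P * (4 * P + 1) ^ P + 3 * P ^ 2) * (H ^ 2 * D * B))) ^ P
      + 2 * ((2 * P * (4 * P + 1) ^ P + 3 * P ^ 2) * (H ^ P * D * B))) :
    ∀ k ≤ n, ∫ x, |reverseTransform F m (fun _ _ => 1) k x| ^ q ∂μ ≤ C * (n : ℝ) ^ (q / 2) := by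
  set cP := 2 * P * (4 * P + 1) ^ P + 3 * P ^ 2 with hcP
  have hP2 : 2 ≤ P := hq.trans hqP
  have hcP1 : 1 ≤ cP := by
    have : 0 ≤ 2 * P * (4 * P + 1) ^ P := by positivity
    nlinarith
  have hn' : (1 : ℝ) ≤ n := by exact_mod_cast hn
  have hHq : H ^ q ≤ H ^ P := Real.rpow_le_rpow_of_exponent_le hH hqP
  intro k hk
  have h1 := integral_reverseTransform_rpow_le hF hm.bdd_martingale
    (e := fun _ _ => 1) (fun _ => .const 1) hm.orthogonal hq hqP (ε := 1)
    (σ := H ^ 2 * D * B) (κ := H ^ P * D * B * (n : ℝ) ^ (q / 2 - 1))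
    (by positivity) (by positivity) zero_le_one
    (fun h hh h0 => hm.integral_sq_mul_le hZ hF hH hD hp hh h0)
    (fun h hh h0 => by
      refine (hm.integral_rpow_mul_le hZ hF hH hq hh h0).trans ?_
      have h3 : 0 ≤ ∫ x, h x ∂μ := integral_nonneg h0
      have h4 := hZ.integral_rpow_le_mul q hq hqp
      have h5 : 0 ≤ ∫ x, Z x ^ q ∂μ := integral_nonneg fun x => Real.rpow_nonneg (hZ.nonneg x) q
      calc H ^ q * (D * ∫ x, Z x ^ q ∂μ) * ∫ x, h x ∂μ
          ≤ H ^ P * (D * (B * (n : ℝ) ^ (q / 2 - 1))) * ∫ x, h x ∂μ := by gcongr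
        _ = _ := by ring)
    (n := n) (fun k _ => by simp) hcP k hk
  refine h1.trans ?_
  simp only [one_pow, Real.one_rpow, mul_one]
  have h6 : (2 * n * (cP * (H ^ 2 * D * B))) ^ (q / 2)
      ≤ (2 * (cP * (H ^ 2 * D * B))) ^ P * (n : ℝ) ^ (q / 2) := by
    rw [show 2 * (n : ℝ) * (cP * (H ^ 2 * D * B)) = 2 * (cP * (H ^ 2 * D * B)) * n by ring,
      Real.mul_rpow (by positivity) (by positivity)]
    gcongr ?_ * _
    refine Real.rpow_le_rpow_of_exponent_le ?_ (by linarith)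
    have : 1 ≤ cP * (H ^ 2 * D * B) :=
      one_le_mul_of_one_le_of_one_le hcP1 (one_le_mul_of_one_le_of_one_le
        (one_le_mul_of_one_le_of_one_le (one_le_pow₀ hH) hD) hB)
    linarith
  have h7 : 2 * n * (cP * (H ^ P * D * B * (n : ℝ) ^ (q / 2 - 1)))
      = 2 * (cP * (H ^ P * D * B)) * (n : ℝ) ^ (q / 2) := by
    have : (n : ℝ) ^ (q / 2) = (n : ℝ) ^ (q / 2 - 1) * n := by
      rw [← Real.rpow_add_one (by positivity)]; simp
    rw [this]; ring
  rw [h7, hC, add_mul ((2 * (cP * (H ^ 2 * D * B))) ^ P)]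
  exact add_le_add h6 le_rfl

end moments

/-! ### A single dominating function for all sums up to time n. -/

section domination

variable {Ω : Type*} [MeasurableSpace Ω] {μ : Measure Ω} [IsProbabilityMeasure μ] {F : Ω → Ω}
  {Z : Ω → ℝ} {n : ℕ} {p D B H c c' P : ℝ} {u χ m u' χ' m' : Ω → ℝ}

/-- The constant in the moment bound for the martingale part. -/
noncomputable def martingaleConst (H D B P : ℝ) : ℝ :=
  (2 * ((2 * P * (4 * P + 1) ^ P + 3 * P ^ 2) * (H ^ 2 * D * B))) ^ P
    + 2 * ((2 * P * (4 * P + 1) ^ P + 3 * P ^ 2) * (H ^ P * D * B))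

theorem one_le_burkholderConst (hP : 2 ≤ P) : 1 ≤ 2 * P * (4 * P + 1) ^ P + 3 * P ^ 2 := by
  have : 0 ≤ 2 * P * (4 * P + 1) ^ P := by positivity
  nlinarith

theorem martingaleConst_nonneg (hP : 2 ≤ P) (hH : 1 ≤ H) (hD : 1 ≤ D) (hB : 1 ≤ B) :
    0 ≤ martingaleConst H D B P := by
  have := one_le_burkholderConst hP
  unfold martingaleConst
  positivity

theorem IsMartingaleDecomposition.integral_birkhoffSum_rpow_le
    (hZ : IsExcursionLength μ F Z n p D B)
    (hm : IsMartingaleDecomposition μ F Z n H u χ m c) (hF : MeasurePreserving F μ μ)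
    (hn : 1 ≤ n) (hH : 1 ≤ H) (hD : 1 ≤ D) (hB : 1 ≤ B) (hp : 2 ≤ p) {q : ℝ}
    (hq : 2 ≤ q) (hqp : q ≤ 2 * (p - 1)) (hqP : q ≤ P) {k : ℕ} (hk : k ≤ n) :
    ∫ x, |birkhoffSum F u k x| ^ q ∂μ
      ≤ 2 ^ P * (martingaleConst H D B P + (3 * H) ^ P) * (n : ℝ) ^ (q / 2) := by
  have hq0 : 0 ≤ q := by linarith
  have hP : 2 ≤ P := hq.trans hqP
  have hn' : (1 : ℝ) ≤ n := by exact_mod_cast hn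
  have h1 := hm.integral_sum_rpow_le hZ hF hn hH hD hB hp hq hqp hqP rfl k hk
  have hMb : IsBddMeasurable (fun x => |reverseTransform F m (fun _ _ => 1) k x| ^ q) :=
    (IsBddMeasurable.reverseTransform hF.measurable hm.bdd_martingale (fun _ => .const 1) k).abs.rpow
      (fun _ => abs_nonneg _) hq0
  have hb : IsBddMeasurable (fun x => |birkhoffSum F u k x| ^ q) :=
    (hm.bdd.birkhoffSum hF.measurable k).abs.rpow (fun _ => abs_nonneg _) hq0
  have h2 : ∫ x, |birkhoffSum F u k x| ^ q ∂μ ≤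
      ∫ x, 2 ^ P * (|reverseTransform F m (fun _ _ => 1) k x| ^ q + (3 * H) ^ P) ∂μ := by
    refine integral_mono hb.integrable
      ((IsBddMeasurable.const _).mul (hMb.add (.const _))).integrable fun x => ?_
    beta_reduce
    calc |birkhoffSum F u k x| ^ q
        ≤ (|reverseTransform F m (fun _ _ => 1) k x| + 3 * H) ^ q :=
          Real.rpow_le_rpow (abs_nonneg _) (hm.abs_birkhoffSum_le hk x) hq0
      _ ≤ 2 ^ P * (|reverseTransform F m (fun _ _ => 1) k x| ^ q + (3 * H) ^ q) :=
          rpow_add_le_two_rpow_mul hq0 hqP (abs_nonneg _) (by linarith)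
      _ ≤ _ := by
          gcongr
          linarith
  rw [integral_const_mul, integral_add hMb.integrable (integrable_const _)] at h2
  simp only [integral_const, probReal_univ, smul_eq_mul, one_mul] at h2
  refine h2.trans ?_
  rw [mul_assoc]
  gcongr
  rw [add_mul]
  refine add_le_add h1 (le_mul_of_one_le_right (by positivity) ?_)
  exact Real.one_le_rpow hn' (by linarith)

/-- The constant in the moment bound for the martingale part of the iterated sums. -/
noncomputable def iteratedConst (H D B P : ℝ) : ℝ :=
  (2 * ((2 * P * (4 * P + 1) ^ P + 3 * P ^ 2) * (H ^ 2 * D * B *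
      (2 ^ P * (martingaleConst H D B P + (3 * H) ^ P)) ^ 2))) ^ P
    + 2 * ((2 * P * (4 * P + 1) ^ P + 3 * P ^ 2) * (H ^ P * D * B *
      (2 ^ P * (martingaleConst H D B P + (3 * H) ^ P)) ^ P))

/-- The coefficients now have L^q size n^{1/2}, so the variance term becomes (n · n)^{q/2} = n^q.
For q ≤ p the moment of Z is bounded independently of n, and the other term is n^{1+q/2} ≤ n^q
because q ≥ 2. -/
theorem IsMartingaleDecomposition.integral_iterated_rpow_le
    (hZ : IsExcursionLength μ F Z n p D B)
    (hm : IsMartingaleDecomposition μ F Z n H u χ m c)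
    (hm' : IsMartingaleDecomposition μ F Z n H u' χ' m' c') (hF : MeasurePreserving F μ μ)
    (hn : 1 ≤ n) (hH : 1 ≤ H) (hD : 1 ≤ D) (hB : 1 ≤ B) (hp : 2 ≤ p) {q : ℝ}
    (hq : 2 ≤ q) (hqp : q ≤ 2 * (p - 1)) (hqp' : q ≤ p) (hqP : q ≤ P) :
    ∫ x, |reverseTransform F m (birkhoffSum F u') n x| ^ q ∂μ
      ≤ iteratedConst H D B P * (n : ℝ) ^ q := by
  have hq0 : 0 ≤ q := by linarith
  have hP : 2 ≤ P := hq.trans hqP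
  have hn' : (1 : ℝ) ≤ n := by exact_mod_cast hn
  have hn0 : (0 : ℝ) < n := by linarith
  have hcP := one_le_burkholderConst hP
  set C' := 2 ^ P * (martingaleConst H D B P + (3 * H) ^ P) with hC'
  have hC'1 : 1 ≤ C' := by
    refine one_le_mul_of_one_le_of_one_le (Real.one_le_rpow (by norm_num) (by linarith)) ?_
    have h1 := martingaleConst_nonneg hP hH hD hB
    have h2 : 1 ≤ (3 * H) ^ P := Real.one_le_rpow (by linarith) (by linarith)
    linarith
  set cP := 2 * P * (4 * P + 1) ^ P + 3 * P ^ 2 with hcPdef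
  have hHq : H ^ q ≤ H ^ P := Real.rpow_le_rpow_of_exponent_le hH hqP
  have hC'q : C' ^ q ≤ C' ^ P := Real.rpow_le_rpow_of_exponent_le hC'1 hqP
  have hhalf : ((n : ℝ) ^ (1 / 2 : ℝ)) ^ q = (n : ℝ) ^ (q / 2) := by
    rw [← Real.rpow_mul hn0.le]; ring_nf
  have h1 := integral_reverseTransform_rpow_le hF hm.bdd_martingale
    (e := birkhoffSum F u') (fun k => hm'.bdd.birkhoffSum hF.measurable k) hm.orthogonal hq hqP
    (ε := C' * (n : ℝ) ^ (1 / 2 : ℝ)) (σ := H ^ 2 * D * B) (κ := H ^ P * D * B)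
    (by positivity) (by positivity) (by positivity)
    (fun h hh h0 => hm.integral_sq_mul_le hZ hF hH hD hp hh h0)
    (fun h hh h0 => by
      refine (hm.integral_rpow_mul_le hZ hF hH hq hh h0).trans ?_
      have h3 : 0 ≤ ∫ x, h x ∂μ := integral_nonneg h0
      have h4 := hZ.integral_rpow_le q hq hqp'
      have h5 : 0 ≤ ∫ x, Z x ^ q ∂μ := integral_nonneg fun x => Real.rpow_nonneg (hZ.nonneg x) q
      calc H ^ q * (D * ∫ x, Z x ^ q ∂μ) * ∫ x, h x ∂μ
          ≤ H ^ P * (D * B) * ∫ x, h x ∂μ := by gcongr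
        _ = _ := by ring)
    (n := n) (fun k hk => by
      refine (hm'.integral_birkhoffSum_rpow_le hZ hF hn hH hD hB hp hq hqp hqP hk.le).trans ?_
      rw [Real.mul_rpow (x := C') (by positivity) (by positivity), hhalf]
      gcongr
      calc C' = C' ^ (1 : ℝ) := (Real.rpow_one _).symm
        _ ≤ C' ^ q := Real.rpow_le_rpow_of_exponent_le hC'1 (by linarith)) hcPdef n le_rfl
  refine h1.trans ?_
  have hsq : (C' * (n : ℝ) ^ (1 / 2 : ℝ)) ^ 2 = C' ^ 2 * n := by
    rw [mul_pow, ← Real.rpow_natCast ((n : ℝ) ^ (1 / 2 : ℝ)), ← Real.rpow_mul hn0.le]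
    norm_num
  have hq' : (C' * (n : ℝ) ^ (1 / 2 : ℝ)) ^ q = C' ^ q * (n : ℝ) ^ (q / 2) := by
    rw [Real.mul_rpow (by positivity) (by positivity), hhalf]
  rw [hsq, hq']
  have h2 : (2 * n * (cP * (H ^ 2 * D * B * (C' ^ 2 * n)))) ^ (q / 2)
      ≤ (2 * (cP * (H ^ 2 * D * B * C' ^ 2))) ^ P * (n : ℝ) ^ q := by
    rw [show 2 * (n : ℝ) * (cP * (H ^ 2 * D * B * (C' ^ 2 * n)))
      = 2 * (cP * (H ^ 2 * D * B * C' ^ 2)) * (n : ℝ) ^ 2 by ring,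
      Real.mul_rpow (by positivity) (by positivity), ← Real.rpow_natCast (n : ℝ) 2,
      ← Real.rpow_mul hn0.le, show ((2 : ℕ) : ℝ) * (q / 2) = q by push_cast; ring]
    gcongr ?_ * _
    refine Real.rpow_le_rpow_of_exponent_le ?_ (by linarith)
    have : 1 ≤ cP * (H ^ 2 * D * B * C' ^ 2) :=
      one_le_mul_of_one_le_of_one_le hcP (one_le_mul_of_one_le_of_one_le
        (one_le_mul_of_one_le_of_one_le
        (one_le_mul_of_one_le_of_one_le (one_le_pow₀ hH) hD) hB) (one_le_pow₀ hC'1))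
    linarith
  have h3 : 2 * n * (cP * (H ^ P * D * B * (C' ^ q * (n : ℝ) ^ (q / 2))))
      ≤ 2 * (cP * (H ^ P * D * B * C' ^ P)) * (n : ℝ) ^ q := by
    have h4 : (n : ℝ) * (n : ℝ) ^ (q / 2) ≤ (n : ℝ) ^ q := by
      calc (n : ℝ) * (n : ℝ) ^ (q / 2) = (n : ℝ) ^ (q / 2 + 1) := by
            rw [Real.rpow_add_one hn0.ne', mul_comm]
        _ ≤ (n : ℝ) ^ q := Real.rpow_le_rpow_of_exponent_le hn' (by linarith)
    calc 2 * n * (cP * (H ^ P * D * B * (C' ^ q * (n : ℝ) ^ (q / 2))))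
        = 2 * (cP * (H ^ P * D * B * C' ^ q)) * (n * (n : ℝ) ^ (q / 2)) := by ring
      _ ≤ 2 * (cP * (H ^ P * D * B * C' ^ P)) * (n : ℝ) ^ q := by gcongr
  rw [iteratedConst, ← hC', ← hcPdef, add_mul ((2 * (cP * (H ^ 2 * D * B * C' ^ 2))) ^ P)]
  exact add_le_add h2 h3

/-- The constant in the moment bound for sums of squared excursion lengths. -/
noncomputable def lengthConst (D B P : ℝ) : ℝ :=
  (4 * (P * 2 ^ P * (D * B))) ^ P + 4 * (P * 2 ^ P * B)

theorem IsExcursionLength.integral_birkhoffSum_sq_rpow_le (hZ : IsExcursionLength μ F Z n p D B)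
    (hF : MeasurePreserving F μ μ) (hn : 1 ≤ n) (hD : 1 ≤ D) (hB : 1 ≤ B) (hp : 2 ≤ p)
    (hP : 2 * (p - 1) ≤ P) :
    ∫ x, birkhoffSum F (fun x => Z x ^ 2) (n + 1) x ^ (p - 1) ∂μ
      ≤ lengthConst D B P * (n : ℝ) ^ (p - 1) := by
  have hn' : (1 : ℝ) ≤ n := by exact_mod_cast hn
  have hn0 : (0 : ℝ) < n := by linarith
  have hr : 1 ≤ p - 1 := by linarith
  have hP1 : 1 ≤ P := by linarith
  have h2P : (1 : ℝ) ≤ 2 ^ P := Real.one_le_rpow (by norm_num) (by linarith)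
  have h1 := integral_birkhoffSum_rpow_le hF (Z := fun x => Z x ^ 2) hZ.bdd.sq
    (fun x => sq_nonneg _) (r := p - 1) (Q := P) (ζ := D * B) hr (by linarith) (by positivity)
    (fun h hh h0 => by
      have e1 := hZ.integral_mul_comp_le 2 (by norm_num) h hh h0
      have e2 := hZ.integral_rpow_le 2 le_rfl hp
      have h3 : 0 ≤ ∫ x, h x ∂μ := integral_nonneg h0
      simp only [Real.rpow_two] at e1 e2
      refine e1.trans ?_
      gcongr) (n + 1)
  -- The endpoint q = 2(p-1) of the truncated moment bound.
  have h2 : ∫ x, (Z x ^ 2) ^ (p - 1) ∂μ ≤ B * (n : ℝ) ^ (p - 1 - 1) := by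
    have e := hZ.integral_rpow_le_mul (2 * (p - 1)) (by linarith) le_rfl
    rw [mul_div_cancel_left₀ _ two_ne_zero] at e
    refine le_trans (le_of_eq ?_) e
    congr 1; funext x
    rw [Real.rpow_mul (hZ.nonneg x), Real.rpow_two]
  have h3 : ((n + 1 : ℕ) : ℝ) ≤ 2 * n := by push_cast; linarith
  refine h1.trans ?_
  calc (2 * ((n + 1 : ℕ) : ℝ) * (P * 2 ^ P * (D * B))) ^ (p - 1)
        + 2 * ((n + 1 : ℕ) : ℝ) * (P * 2 ^ P * ∫ x, (Z x ^ 2) ^ (p - 1) ∂μ)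
      ≤ (2 * (2 * n) * (P * 2 ^ P * (D * B))) ^ (p - 1)
        + 2 * (2 * n) * (P * 2 ^ P * (B * (n : ℝ) ^ (p - 1 - 1))) := by
        have : 0 ≤ ∫ x, (Z x ^ 2) ^ (p - 1) ∂μ := integral_nonneg fun x => by positivity
        gcongr
    _ = (4 * (P * 2 ^ P * (D * B)) * n) ^ (p - 1)
        + 4 * (P * 2 ^ P * B) * ((n : ℝ) ^ (p - 1 - 1) * n) := by ring_nf
    _ = (4 * (P * 2 ^ P * (D * B))) ^ (p - 1) * (n : ℝ) ^ (p - 1)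
        + 4 * (P * 2 ^ P * B) * (n : ℝ) ^ (p - 1) := by
        rw [Real.mul_rpow (by positivity) hn0.le, ← Real.rpow_add_one hn0.ne', sub_add_cancel]
    _ ≤ (4 * (P * 2 ^ P * (D * B))) ^ P * (n : ℝ) ^ (p - 1)
        + 4 * (P * 2 ^ P * B) * (n : ℝ) ^ (p - 1) := by
        gcongr ?_ * _ + _
        refine Real.rpow_le_rpow_of_exponent_le ?_ (by linarith)
        have : 1 ≤ P * 2 ^ P * (D * B) :=
          one_le_mul_of_one_le_of_one_le (one_le_mul_of_one_le_of_one_le hP1 h2P)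
            (one_le_mul_of_one_le_of_one_le hD hB)
        linarith
    _ = _ := by rw [lengthConst]; ring

/-- Here W, W', V stand for suffix maxima of martingale parts, S, S', d' for those of the single and
iterated sums, and b, b', d for sums over initial segments. Products are split by the
arithmetic–geometric mean inequality. -/
theorem domination_aux {Q V W W' S S' b b' d d' : ℝ} (hH : 1 ≤ H) (hQ : 0 ≤ Q) (hV : 0 ≤ V)
    (hS : 0 ≤ S) (hS' : 0 ≤ S') (sW : S ≤ W + 3 * H)
    (sW' : S' ≤ W' + 3 * H) (hb : |b| ≤ 2 * S) (hb' : |b'| ≤ 2 * S')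
    (hd' : d' ≤ V + 2 * H * S' + H * Q) (hd : |d| ≤ 2 * d' + 2 * S * S') :
    b ^ 2 ≤ 100 * H ^ 2 * (1 + Q + W ^ 2 + W' ^ 2 + V) ∧
    b' ^ 2 ≤ 100 * H ^ 2 * (1 + Q + W ^ 2 + W' ^ 2 + V) ∧
    |d| ≤ 100 * H ^ 2 * (1 + Q + W ^ 2 + W' ^ 2 + V) := by
  have hHH : 1 ≤ H ^ 2 := one_le_pow₀ hH
  have hH2 : H ≤ H ^ 2 := by nlinarith
  have hS2 : S ^ 2 ≤ 2 * W ^ 2 + 18 * H ^ 2 := by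
    have := pow_le_pow_left₀ hS sW 2
    linarith [sq_nonneg (W - 3 * H)]
  have hS2' : S' ^ 2 ≤ 2 * W' ^ 2 + 18 * H ^ 2 := by
    have := pow_le_pow_left₀ hS' sW' 2
    linarith [sq_nonneg (W' - 3 * H)]
  have w0 := sq_nonneg W
  have w0' := sq_nonneg W'
  have m1 : Q ≤ H ^ 2 * Q := le_mul_of_one_le_left hQ hHH
  have m2 : V ≤ H ^ 2 * V := le_mul_of_one_le_left hV hHH
  have m3 : W ^ 2 ≤ H ^ 2 * W ^ 2 := le_mul_of_one_le_left w0 hHH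
  have m4 : W' ^ 2 ≤ H ^ 2 * W' ^ 2 := le_mul_of_one_le_left w0' hHH
  have m5 : H * Q ≤ H ^ 2 * Q := mul_le_mul_of_nonneg_right hH2 hQ
  have h5 : 100 * H ^ 2 * (1 + Q + W ^ 2 + W' ^ 2 + V)
      = 100 * H ^ 2 + 100 * (H ^ 2 * Q) + 100 * (H ^ 2 * W ^ 2) + 100 * (H ^ 2 * W' ^ 2)
        + 100 * (H ^ 2 * V) := by ring
  have hb2 : b ^ 2 ≤ 4 * S ^ 2 := by
    have := pow_le_pow_left₀ (abs_nonneg b) hb 2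
    rw [sq_abs] at this
    linarith
  have hb2' : b' ^ 2 ≤ 4 * S' ^ 2 := by
    have := pow_le_pow_left₀ (abs_nonneg b') hb' 2
    rw [sq_abs] at this
    linarith
  rw [h5]
  refine ⟨by linarith, by linarith, ?_⟩
  have h1 : 2 * S * S' ≤ S ^ 2 + S' ^ 2 := by linarith [sq_nonneg (S - S')]
  have h2 : 2 * H * S' ≤ H ^ 2 + S' ^ 2 := by linarith [sq_nonneg (H - S')]
  linarith

/-- The constant in `exists_dominating_function`. -/
noncomputable def dominationConst (H D B P : ℝ) : ℝ :=
  (100 * H ^ 2) ^ P * (2 ^ P * (2 ^ P * (2 ^ P * (2 ^ P * (1 + lengthConst D B P)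
    + 2 ^ P * martingaleConst H D B P) + 2 ^ P * martingaleConst H D B P)
    + (1 + 2 ^ P * iteratedConst H D B P)))

theorem exists_dominating_function
    (hZ : IsExcursionLength μ F Z n p D B)
    (hm : IsMartingaleDecomposition μ F Z n H u χ m c)
    (hm' : IsMartingaleDecomposition μ F Z n H u' χ' m' c') (hF : MeasurePreserving F μ μ)
    (hn : 1 ≤ n) (hH : 1 ≤ H) (hD : 1 ≤ D) (hB : 1 ≤ B) (hp : 2 ≤ p) (hP : 2 * (p - 1) ≤ P) :
    ∃ Φ : Ω → ℝ, IsBddMeasurable Φ ∧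
      ∫ x, Φ x ^ (p - 1) ∂μ ≤ dominationConst H D B P * (n : ℝ) ^ (p - 1) ∧
      (∀ x, birkhoffSum F (fun x => Z x ^ 2) (n + 1) x ≤ Φ x) ∧
      ∀ x, ∀ k ≤ n, birkhoffSum F u k x ^ 2 ≤ Φ x ∧ birkhoffSum F u' k x ^ 2 ≤ Φ x ∧
        |iteratedBirkhoffSum F u u' k x| ≤ Φ x := by
  have hn' : (1 : ℝ) ≤ n := by exact_mod_cast hn
  have hn0 : (0 : ℝ) < n := by linarith
  set r := p - 1 with hr
  have hr1 : 1 ≤ r := by linarith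
  have hr0 : 0 ≤ r := by linarith
  have hrP : r ≤ P := by linarith
  have hP2 : 2 ≤ P := by linarith
  have hFm := hF.measurable
  have hnr : 1 ≤ (n : ℝ) ^ r := Real.one_le_rpow hn' hr0
  set Q := birkhoffSum F (fun x => Z x ^ 2) (n + 1) with hQ
  set W := suffixMax F (reverseTransform F m (fun _ _ => 1)) n with hW
  set W' := suffixMax F (reverseTransform F m' (fun _ _ => 1)) n with hW'
  set V := suffixMax F (reverseTransform F m (birkhoffSum F u')) n with hV
  have hQb : IsBddMeasurable Q := hZ.bdd.sq.birkhoffSum hFm _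
  have hWb : IsBddMeasurable W := .suffixMax hFm
    (fun k => .reverseTransform hFm hm.bdd_martingale (fun _ => .const 1) k) n
  have hWb' : IsBddMeasurable W' := .suffixMax hFm
    (fun k => .reverseTransform hFm hm'.bdd_martingale (fun _ => .const 1) k) n
  have hVb : IsBddMeasurable V := .suffixMax hFm
    (fun k => .reverseTransform hFm hm.bdd_martingale
      (fun k => hm'.bdd.birkhoffSum hFm k) k) n
  have hQ0 : ∀ x, 0 ≤ Q x := fun x => Finset.sum_nonneg fun _ _ => sq_nonneg _
  have hW0 : ∀ x, 0 ≤ W x := suffixMax_nonneg n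
  have hW0' : ∀ x, 0 ≤ W' x := suffixMax_nonneg n
  have hV0 : ∀ x, 0 ≤ V x := suffixMax_nonneg n
  have iQ : ∫ x, Q x ^ r ∂μ ≤ lengthConst D B P * (n : ℝ) ^ r :=
    hZ.integral_birkhoffSum_sq_rpow_le hF hn hD hB hp hP
  have key : ∀ {v ξ l : Ω → ℝ} {b : ℝ}, IsMartingaleDecomposition μ F Z n H v ξ l b →
      ∫ x, (suffixMax F (reverseTransform F l (fun _ _ => 1)) n x ^ 2) ^ r ∂μ
        ≤ 2 ^ P * martingaleConst H D B P * (n : ℝ) ^ r := by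
    intro v ξ l b hl
    have h1 := hl.integral_sum_rpow_le hZ hF hn hH hD hB hp (q := 2 * r) (by linarith) le_rfl
      hP rfl n le_rfl
    rw [mul_div_cancel_left₀ _ two_ne_zero] at h1
    have h2 := integral_suffixMax_reverseTransform_le hF hl.bdd_martingale
      (e := fun _ _ => 1) (fun _ => .const 1) hl.orthogonal (q := 2 * r) (by linarith) n
    have h3 : ∀ x, (suffixMax F (reverseTransform F l (fun _ _ => 1)) n x ^ 2) ^ r
        = suffixMax F (reverseTransform F l (fun _ _ => 1)) n x ^ (2 * r) := fun x => by
      rw [Real.rpow_mul (suffixMax_nonneg n x), Real.rpow_two]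
    simp only [h3]
    have h4 : (2 : ℝ) ^ (2 * r) ≤ 2 ^ P := Real.rpow_le_rpow_of_exponent_le (by norm_num) hP
    calc _ ≤ (2 : ℝ) ^ (2 * r) *
          ∫ x, |reverseTransform F l (fun _ _ => 1) n x| ^ (2 * r) ∂μ := h2
      _ ≤ 2 ^ P * (martingaleConst H D B P * (n : ℝ) ^ r) := by
          have : 0 ≤ ∫ x, |reverseTransform F l (fun _ _ => 1) n x| ^ (2 * r) ∂μ :=
            integral_nonneg fun _ => by positivity
          gcongr
          exact h1
      _ = _ := by ring
  have iW : ∫ x, (W x ^ 2) ^ r ∂μ ≤ 2 ^ P * martingaleConst H D B P * (n : ℝ) ^ r := key hm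
  have iW' : ∫ x, (W' x ^ 2) ^ r ∂μ ≤ 2 ^ P * martingaleConst H D B P * (n : ℝ) ^ r := key hm'
  have hI0 : 0 ≤ iteratedConst H D B P := by
    have h1 := martingaleConst_nonneg hP2 hH hD hB
    have h2 := one_le_burkholderConst hP2
    unfold iteratedConst
    positivity
  have iV : ∫ x, V x ^ r ∂μ ≤ (1 + 2 ^ P * iteratedConst H D B P) * (n : ℝ) ^ r := by
    -- The martingale inequalities need an exponent at least 2, but r = p - 1 may be as small as 1.
    -- The exponent s is still at most p and at most 2r, and Jensen's inequality returns to r.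
    set s := max r 2 with hs
    have hs2 : 2 ≤ s := le_max_right _ _
    have hsr : r ≤ s := le_max_left _ _
    have hs0 : 0 < s := by linarith
    have hsp : s ≤ p := max_le (by linarith) hp
    have hs2r : s ≤ 2 * r := max_le (by linarith) (by linarith)
    have h1 := hm.integral_iterated_rpow_le hZ hm' hF hn hH hD hB hp hs2 hs2r hsp
      (hs2r.trans hP)
    have h2 := integral_suffixMax_reverseTransform_le hF hm.bdd_martingale
      (e := birkhoffSum F u') (fun k => hm'.bdd.birkhoffSum hFm k) hm.orthogonal hs2 n
    have h4 : (2 : ℝ) ^ s ≤ 2 ^ P :=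
      Real.rpow_le_rpow_of_exponent_le (by norm_num) (hs2r.trans hP)
    have h5 : ∫ x, V x ^ s ∂μ ≤ (1 + 2 ^ P * iteratedConst H D B P) * (n : ℝ) ^ s := by
      have h0 : 0 ≤ ∫ x, |reverseTransform F m (birkhoffSum F u') n x| ^ s ∂μ :=
        integral_nonneg fun _ => by positivity
      calc ∫ x, V x ^ s ∂μ
          ≤ 2 ^ s * ∫ x, |reverseTransform F m (birkhoffSum F u') n x| ^ s ∂μ := h2
        _ ≤ 2 ^ P * (iteratedConst H D B P * (n : ℝ) ^ s) := by gcongr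
        _ ≤ _ := by
          have : 0 ≤ (n : ℝ) ^ s := by positivity
          linarith
    have h6 : ∀ x, V x ^ r = (V x ^ s) ^ (r / s) := fun x => by
      rw [← Real.rpow_mul (hV0 x), mul_div_cancel₀ _ hs0.ne']
    simp only [h6]
    have h7 : r / s ≤ 1 := (div_le_one hs0).2 hsr
    have h8 : 0 ≤ r / s := by positivity
    have hC1 : 1 ≤ 1 + 2 ^ P * iteratedConst H D B P := by
      have : 0 ≤ 2 ^ P * iteratedConst H D B P := by positivity
      linarith
    calc ∫ x, (V x ^ s) ^ (r / s) ∂μ ≤ (∫ x, V x ^ s ∂μ) ^ (r / s) :=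
          integral_rpow_le_rpow_integral (hVb.rpow hV0 hs0.le)
            (fun x => Real.rpow_nonneg (hV0 x) s) h8 h7
      _ ≤ ((1 + 2 ^ P * iteratedConst H D B P) * (n : ℝ) ^ s) ^ (r / s) :=
          Real.rpow_le_rpow (integral_nonneg fun x => Real.rpow_nonneg (hV0 x) s) h5 h8
      _ = (1 + 2 ^ P * iteratedConst H D B P) ^ (r / s) * (n : ℝ) ^ r := by
          rw [Real.mul_rpow (by linarith) (by positivity), ← Real.rpow_mul hn0.le,
            mul_div_cancel₀ _ hs0.ne']
      _ ≤ (1 + 2 ^ P * iteratedConst H D B P) ^ (1 : ℝ) * (n : ℝ) ^ r := by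
          gcongr
      _ = _ := by rw [Real.rpow_one]
  have hsum : ∀ {f g : Ω → ℝ} {a b : ℝ}, IsBddMeasurable f → IsBddMeasurable g →
      (∀ x, 0 ≤ f x) → (∀ x, 0 ≤ g x) → ∫ x, f x ^ r ∂μ ≤ a * (n : ℝ) ^ r →
      ∫ x, g x ^ r ∂μ ≤ b * (n : ℝ) ^ r →
      ∫ x, (f x + g x) ^ r ∂μ ≤ 2 ^ P * (a + b) * (n : ℝ) ^ r := by
    intro f g a b hf hg hf0 hg0 hfa hgb
    have h1 := hf.rpow hf0 hr0
    have h2 := hg.rpow hg0 hr0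
    calc ∫ x, (f x + g x) ^ r ∂μ ≤ ∫ x, 2 ^ P * (f x ^ r + g x ^ r) ∂μ :=
          integral_mono ((hf.add hg).rpow (fun x => add_nonneg (hf0 x) (hg0 x)) hr0).integrable
            ((IsBddMeasurable.const _).mul (h1.add h2)).integrable
            fun x => rpow_add_le_two_rpow_mul hr0 hrP (hf0 x) (hg0 x)
      _ = 2 ^ P * (∫ x, f x ^ r ∂μ + ∫ x, g x ^ r ∂μ) := by
          rw [integral_const_mul, integral_add h1.integrable h2.integrable]
      _ ≤ 2 ^ P * (a * (n : ℝ) ^ r + b * (n : ℝ) ^ r) := by gcongr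
      _ = _ := by ring
  have i1 : ∫ _x, (1 : ℝ) ^ r ∂μ ≤ 1 * (n : ℝ) ^ r := by simpa using hnr
  have b1 : IsBddMeasurable (fun x => 1 + Q x) := (IsBddMeasurable.const 1).add hQb
  have b2 : IsBddMeasurable (fun x => 1 + Q x + W x ^ 2) := b1.add hWb.sq
  have b3 : IsBddMeasurable (fun x => 1 + Q x + W x ^ 2 + W' x ^ 2) := b2.add hWb'.sq
  have b4 : IsBddMeasurable (fun x => 1 + Q x + W x ^ 2 + W' x ^ 2 + V x) := b3.add hVb
  have p1 : ∀ x, 0 ≤ 1 + Q x := fun x => add_nonneg zero_le_one (hQ0 x)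
  have p2 : ∀ x, 0 ≤ 1 + Q x + W x ^ 2 := fun x => add_nonneg (p1 x) (sq_nonneg _)
  have p3 : ∀ x, 0 ≤ 1 + Q x + W x ^ 2 + W' x ^ 2 := fun x => add_nonneg (p2 x) (sq_nonneg _)
  have p4 : ∀ x, 0 ≤ 1 + Q x + W x ^ 2 + W' x ^ 2 + V x := fun x => add_nonneg (p3 x) (hV0 x)
  have iΨ : ∫ x, (1 + Q x + W x ^ 2 + W' x ^ 2 + V x) ^ r ∂μ
      ≤ 2 ^ P * (2 ^ P * (2 ^ P * (2 ^ P * (1 + lengthConst D B P)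
        + 2 ^ P * martingaleConst H D B P) + 2 ^ P * martingaleConst H D B P)
        + (1 + 2 ^ P * iteratedConst H D B P)) * (n : ℝ) ^ r :=
    hsum b3 hVb p3 hV0 (hsum b2 hWb'.sq p2 (fun _ => sq_nonneg _)
      (hsum b1 hWb.sq p1 (fun _ => sq_nonneg _)
        (hsum (.const 1) hQb (fun _ => zero_le_one) hQ0 i1 iQ) iW) iW') iV
  have hH2 : H ≤ H ^ 2 := by nlinarith
  have hHH : 1 ≤ H ^ 2 := by nlinarith
  refine ⟨fun x => 100 * H ^ 2 * (1 + Q x + W x ^ 2 + W' x ^ 2 + V x),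
    (IsBddMeasurable.const _).mul b4, ?_, fun x => ?_, fun x k hk => ?_⟩
  · have h1 : ∀ x, (100 * H ^ 2 * (1 + Q x + W x ^ 2 + W' x ^ 2 + V x)) ^ r
        = (100 * H ^ 2) ^ r * (1 + Q x + W x ^ 2 + W' x ^ 2 + V x) ^ r := fun x =>
      Real.mul_rpow (by positivity) (p4 x)
    simp only [h1]
    rw [integral_const_mul, dominationConst, mul_assoc ((100 * H ^ 2) ^ P)]
    have h2 : (100 * H ^ 2) ^ r ≤ (100 * H ^ 2) ^ P :=
      Real.rpow_le_rpow_of_exponent_le (by linarith) hrP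
    have h3 : 0 ≤ ∫ x, (1 + Q x + W x ^ 2 + W' x ^ 2 + V x) ^ r ∂μ :=
      integral_nonneg fun x => Real.rpow_nonneg (p4 x) r
    exact mul_le_mul h2 iΨ h3 (by positivity)
  · have h1 : 0 ≤ 1 + W x ^ 2 + W' x ^ 2 + V x := by
      have := hV0 x; positivity
    have h2 := hQ0 x
    nlinarith
  · have sW := hm.suffixMax_birkhoffSum_le x
    have sW' := hm'.suffixMax_birkhoffSum_le x
    have sD := hm.suffixMax_iteratedBirkhoffSum_le hZ hH hm'.abs_le_length x
    have aW := abs_birkhoffSum_le_suffixMax (f := F) (u := u) hk x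
    have aW' := abs_birkhoffSum_le_suffixMax (f := F) (u := u') hk x
    have aD := abs_iteratedBirkhoffSum_le_suffixMax (f := F) (u := u) (w := u') hk x
    have nS := suffixMax_nonneg (F := F) (g := birkhoffSum F u) n x
    have nS' := suffixMax_nonneg (F := F) (g := birkhoffSum F u') n x
    exact domination_aux hH (hQ0 x) (hV0 x) nS nS' sW sW' aW aW' sD aD

end domination

/-! ### Truncated observables of a Gibbs–Markov map -/

/-- `τ` is measurable, and on each element of `α` constant and positive. -/
structure IsReturnTime {Λ : Type*} [MeasurableSpace Λ] (α : Set (Set Λ)) (τ : Λ → ℕ) : Prop where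
  measurable : Measurable τ
  pos : ∀ a ∈ α, ∀ x ∈ a, 1 ≤ τ x
  const : ∀ a ∈ α, ∀ x ∈ a, ∀ y ∈ a, τ x = τ y

/-- The truncation of `f` to the set where `τ ≤ n`. -/
noncomputable def truncate {Λ : Type*} (τ : Λ → ℕ) (n : ℕ) (f : Λ → ℝ) (x : Λ) : ℝ :=
  if τ x ≤ n then f x else 0

theorem natCast_rpow_le_rpow {k : ℕ} {s p : ℝ} (hs : 0 < s) (hsp : s ≤ p) :
    (k : ℝ) ^ s ≤ (k : ℝ) ^ p := by
  rcases Nat.eq_zero_or_pos k with rfl | hk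
  · simp [Real.zero_rpow hs.ne', Real.zero_rpow (hs.trans_le hsp).ne']
  · exact Real.rpow_le_rpow_of_exponent_le (by exact_mod_cast hk) hsp

section truncate

variable {Λ : Type*} {τ : Λ → ℕ} {n : ℕ}

theorem abs_truncate_le {f : Λ → ℝ} (hf : ∀ x, |f x| ≤ τ x) (x : Λ) :
    |truncate τ n f x| ≤ truncate τ n (fun x => τ x) x := by
  unfold truncate
  split_ifs
  · exact hf x
  · simp

theorem truncate_le_min (x : Λ) : truncate τ n (fun x => (τ x : ℝ)) x ≤ min (τ x : ℝ) n := by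
  unfold truncate
  split_ifs with h
  · exact le_min le_rfl (Nat.cast_le.2 h)
  · positivity

variable [MeasurableSpace Λ]

theorem measurable_truncate (hτ : Measurable τ) {f : Λ → ℝ} (hf : Measurable f) :
    Measurable (truncate τ n f) :=
  Measurable.ite (hτ (measurableSet_Iic (a := n))) hf measurable_const

theorem isBddMeasurable_min (hτ : Measurable τ) (n : ℕ) :
    IsBddMeasurable (fun x => min (τ x : ℝ) n) :=
  ⟨(measurable_from_top.comp hτ).min measurable_const, n, fun x => by
    rw [abs_of_nonneg (by positivity)]; exact min_le_right _ _⟩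

theorem isBddMeasurable_truncate (hτ : Measurable τ) {f : Λ → ℝ} (hf : Measurable f)
    (hfτ : ∀ x, |f x| ≤ τ x) : IsBddMeasurable (truncate τ n f) :=
  ⟨measurable_truncate hτ hf, n, fun x => (abs_truncate_le hfτ x).trans
    ((truncate_le_min x).trans (min_le_right _ _))⟩

end truncate

section

variable {Λ : Type*} [MetricSpace Λ] [MeasurableSpace Λ] {m μ : Measure Λ}
  {F : Λ → Λ} {α : Set (Set Λ)} {j : Λ → ℝ≥0∞} {η θ K t₀ R c₀ p B : ℝ} {τ : Λ → ℕ} {n : ℕ}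
  [BorelSpace Λ] [IsProbabilityMeasure m] [IsProbabilityMeasure μ]

theorem isExcursionLength_min (h : IsGibbsMarkov m F α j η θ K t₀) (hμm : μ ≪ m)
    (hF : MeasurePreserving F μ μ) (hR : R = 3 * K / (1 - θ)) (hτ : IsReturnTime α τ)
    (hp : 2 ≤ p) (hint : Integrable (fun x => (τ x : ℝ) ^ p) μ)
    (hB : ∫ x, (τ x : ℝ) ^ p ∂μ ≤ B) (hn : 1 ≤ n) :
    IsExcursionLength μ F (fun x => min (τ x : ℝ) n) n p (Real.exp (2 * R * t₀)) B := by
  have hbdd := isBddMeasurable_min hτ.measurable n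
  have hn' : (1 : ℝ) ≤ n := by exact_mod_cast hn
  have h0 : ∀ x, 0 ≤ min (τ x : ℝ) n := fun x => by positivity
  have hpow : ∀ x (s : ℝ), 0 < s → s ≤ p → min (τ x : ℝ) n ^ s ≤ (τ x : ℝ) ^ p :=
    fun x s hs hsp => (Real.rpow_le_rpow (h0 x) (min_le_left _ _) hs.le).trans
      (natCast_rpow_le_rpow hs hsp)
  refine ⟨hbdd, h0, fun x => ?_, fun s hs g hg hg0 => ?_, fun s hs hsp => ?_, fun q hq hqp => ?_⟩
  · have : min (τ x : ℝ) n = ((min (τ x) n : ℕ) : ℝ) := by push_cast; rfl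
    rw [this]
    exact_mod_cast Nat.le_self_pow two_ne_zero _
  · refine h.integral_mul_comp_le hμm hF hR ⟨hbdd.rpow h0 hs, fun x => Real.rpow_nonneg (h0 x) s,
      fun a ha x hx y hy => ?_⟩ hg hg0
    rw [hτ.const a ha x hx y hy]
    refine le_mul_of_one_le_left (Real.rpow_nonneg (h0 y) s) (Real.one_le_exp ?_)
    have := h.K_pos
    positivity
  · exact (integral_mono (hbdd.rpow h0 (by linarith)).integrable hint
      fun x => hpow x s (by linarith) hsp).trans hB
  · have hB0 : 0 ≤ B := le_trans (integral_nonneg fun x => by positivity) hB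
    rcases le_total q p with hqp' | hqp'
    · refine ((integral_mono (hbdd.rpow h0 (by linarith)).integrable hint
        fun x => hpow x q (by linarith) hqp').trans hB).trans ?_
      exact le_mul_of_one_le_right hB0 (Real.one_le_rpow hn' (by linarith))
    · have h1 : ∀ x, min (τ x : ℝ) n ^ q ≤ (n : ℝ) ^ (q / 2 - 1) * (τ x : ℝ) ^ p := fun x => by
        rcases Nat.eq_zero_or_pos (τ x) with hx | hx
        · simp only [hx, Nat.cast_zero]
          rw [min_eq_left (by positivity), Real.zero_rpow (by linarith)]
          positivity
        have hx' : (1 : ℝ) ≤ τ x := by exact_mod_cast hx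
        have hpos : 0 < min (τ x : ℝ) n := lt_min (by linarith) (by linarith)
        calc min (τ x : ℝ) n ^ q = min (τ x : ℝ) n ^ (q - p) * min (τ x : ℝ) n ^ p := by
              rw [← Real.rpow_add hpos]; ring_nf
          _ ≤ (n : ℝ) ^ (q - p) * (τ x : ℝ) ^ p := by
              exact mul_le_mul (Real.rpow_le_rpow hpos.le (min_le_right _ _) (by linarith))
                (Real.rpow_le_rpow hpos.le (min_le_left _ _) (by linarith)) (by positivity)
                (by positivity)
          _ ≤ (n : ℝ) ^ (q / 2 - 1) * (τ x : ℝ) ^ p := by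
              gcongr ?_ * _
              exact Real.rpow_le_rpow_of_exponent_le hn' (by linarith)
      refine (integral_mono (hbdd.rpow h0 (by linarith)).integrable (hint.const_mul _) h1).trans ?_
      rw [integral_const_mul, mul_comm]
      gcongr

/-- Martingale–coboundary decomposition of a truncated observable. -/
theorem exists_isMartingaleDecomposition (h : IsGibbsMarkov m F α j η θ K t₀) (hμm : μ ≪ m)
    (hF : MeasurePreserving F μ μ) (hR : R = 3 * K / (1 - θ))
    (hc : c₀ = Real.exp (-(2 * R * t₀)) * (K / R)) (hτ : IsReturnTime α τ)
    (hp : 2 ≤ p) (hint : Integrable (fun x => (τ x : ℝ) ^ p) μ)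
    (hB : ∫ x, (τ x : ℝ) ^ p ∂μ ≤ B) (hn : 1 ≤ n) {φ : Λ → ℝ} (hφm : Measurable φ)
    (hφ : ∀ x, |φ x| ≤ τ x) (hφ0 : ∫ x, φ x ∂μ = 0)
    (hφreg : ∀ a ∈ α, ∀ x ∈ a, ∀ y ∈ a,
      φ x - φ y ≤ τ x * (K * dist (F x) (F y) ^ η)) :
    ∃ χ M c, IsMartingaleDecomposition μ F (fun x => min (τ x : ℝ) n) n
      (1 + B + 2 * (5 * B * Real.exp (2 * R * t₀) / c₀)) (truncate τ n φ) χ M c := by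
  have hK := h.K_pos
  have h1θ : 0 < 1 - θ := by linarith [h.theta_lt_one]
  have hRθ : R * (1 - θ) = 3 * K := by rw [hR]; field_simp
  have hKR : K < R := by nlinarith [h.theta_nonneg]
  have hRpos : 0 < R := hK.trans hKR
  have hc0 : 0 < c₀ := by rw [hc]; positivity
  have hc1 : c₀ ≤ 1 := by
    rw [hc]
    refine mul_le_one₀ ?_ (by positivity) ((div_le_one hRpos).2 hKR.le)
    rw [Real.exp_le_one_iff]
    have := mul_nonneg hRpos.le h.t₀_nonneg
    linarith
  have hn' : (1 : ℝ) ≤ n := by exact_mod_cast hn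
  have hB0 : 0 ≤ B := le_trans (integral_nonneg fun x => by positivity) hB
  set D := Real.exp (2 * R * t₀) with hD
  set t : Λ → ℝ := truncate τ n (fun x => τ x) with ht
  set u : Λ → ℝ := truncate τ n φ with hu
  have hτm : Measurable fun x => (τ x : ℝ) := measurable_from_top.comp hτ.measurable
  have htb : IsBddMeasurable t := isBddMeasurable_truncate hτ.measurable hτm
    fun x => by rw [Nat.abs_cast]
  have hub : IsBddMeasurable u := isBddMeasurable_truncate hτ.measurable hφm hφ
  have ht0 : ∀ x, 0 ≤ t x := fun x => by simp only [ht, truncate]; split_ifs <;> positivity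
  have hut : ∀ x, |u x| ≤ t x := abs_truncate_le hφ
  have htZ : ∀ x, t x ≤ min (τ x : ℝ) n := truncate_le_min
  have hτp : ∀ x, (τ x : ℝ) ≤ (τ x : ℝ) ^ p := fun x => by
    simpa using natCast_rpow_le_rpow (k := τ x) (s := 1) one_pos (by linarith : (1 : ℝ) ≤ p)
  have htB : ∫ x, t x ∂μ ≤ B := (integral_mono htb.integrable hint fun x =>
    ((htZ x).trans (min_le_left _ _)).trans (hτp x)).trans hB
  have w2 : IsRegularWeight F α η K (fun x => 2 * t x) := by
    refine ⟨(IsBddMeasurable.const 2).mul htb, fun x => by have := ht0 x; positivity,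
      fun a ha x hx y hy => ?_⟩
    have : t x = t y := by simp only [ht, truncate, hτ.const a ha x hx y hy]
    rw [this]
    refine le_mul_of_one_le_left (by have := ht0 y; positivity) (Real.one_le_exp ?_)
    positivity
  -- The truncated observable has no sign and may vanish, so it is not log-Hölder itself. Adding 2t
  -- keeps the weight above t, and the oscillation of φ on a partition element, at most τ times K
  -- dist^η, becomes a relative one. The observable is then the difference of two regular weights.
  have w1 : IsRegularWeight F α η K (fun x => u x + 2 * t x) := by
    refine ⟨hub.add ((IsBddMeasurable.const 2).mul htb), fun x => ?_, fun a ha x hx y hy => ?_⟩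
    · linarith [(abs_le.1 (hut x)).1, ht0 x]
    · have hxy := hτ.const a ha x hx y hy
      by_cases hx' : τ x ≤ n
      · have hy' : τ y ≤ n := hxy ▸ hx'
        simp only [hu, ht, truncate, if_pos hx', if_pos hy']
        have h1 := hφreg a ha x hx y hy
        have h2 := (abs_le.1 (hφ y)).1
        have h3 := Real.add_one_le_exp (K * dist (F x) (F y) ^ η)
        have h4 : 0 ≤ K * dist (F x) (F y) ^ η := by positivity
        have h5 : (τ x : ℝ) = τ y := by exact_mod_cast hxy
        rw [h5] at h1 ⊢
        have h6 : (τ y : ℝ) * (K * dist (F x) (F y) ^ η)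
            ≤ (φ y + 2 * τ y) * (K * dist (F x) (F y) ^ η) := by
          gcongr; linarith
        have h7 : (K * dist (F x) (F y) ^ η + 1) * (φ y + 2 * τ y)
            ≤ Real.exp (K * dist (F x) (F y) ^ η) * (φ y + 2 * τ y) := by
          gcongr
          have : (0 : ℝ) ≤ τ y := by positivity
          linarith
        linarith
      · have hy' : ¬ τ y ≤ n := hxy ▸ hx'
        simp [hu, ht, truncate, hx', hy']
  set c := ∫ x, u x ∂μ with hcdef
  have hW2 : ∫ x, 2 * t x ∂μ ≤ 2 * B := by rw [integral_const_mul]; linarith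
  have hutint : ∫ x, u x + 2 * t x ∂μ = c + ∫ x, 2 * t x ∂μ :=
    integral_add hub.integrable ((IsBddMeasurable.const 2).mul htb).integrable
  -- Since φ has zero mean, c is minus the integral of φ over {τ > n}, where n|φ| ≤ τ² ≤ τ^p.
  have hcB : |c| * n ≤ B := by
    have hφi : Integrable φ μ :=
      hint.mono' hφm.aestronglyMeasurable (.of_forall fun x => (hφ x).trans (hτp x))
    have e1 : c = ∫ x, u x - φ x ∂μ := by
      rw [integral_sub hub.integrable hφi, hφ0, sub_zero]
    rw [e1]
    calc |∫ x, u x - φ x ∂μ| * n ≤ (∫ x, |u x - φ x| ∂μ) * n := by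
          gcongr; exact abs_integral_le_integral_abs
      _ = ∫ x, |u x - φ x| * n ∂μ := (integral_mul_const _ _).symm
      _ ≤ ∫ x, (τ x : ℝ) ^ p ∂μ := by
          refine integral_mono ((hub.integrable.sub hφi).abs.mul_const _) hint fun x => ?_
          simp only [hu, truncate]
          split_ifs with hx
          · simp only [sub_self, abs_zero, zero_mul]; positivity
          · rw [zero_sub, abs_neg]
            have hx' : (n : ℝ) ≤ τ x := by exact_mod_cast (not_le.1 hx).le
            calc |φ x| * n ≤ τ x * τ x := by gcongr; exact hφ x
              _ = (τ x : ℝ) ^ (2 : ℝ) := by rw [Real.rpow_two]; ring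
              _ ≤ (τ x : ℝ) ^ p := natCast_rpow_le_rpow two_pos hp
      _ ≤ B := hB
  have hcB' : |c| ≤ B := le_trans (le_mul_of_one_le_right (abs_nonneg _) hn') hcB
  have hf : IsBddMeasurable (fun x => u x - c) := hub.sub (.const c)
  have hdec : ∀ k : ℕ, ∀ g : Λ → ℝ, Measurable g → Integrable g μ →
      |∫ x, (u x - c) * g (F^[k + 1] x) ∂μ| ≤ 5 * B * D * (1 - c₀) ^ k * ∫ x, |g x| ∂μ := by
    intro k g hgm hg
    have d1 := h.abs_integral_mul_comp_iterate_sub_le hμm hF hR hc hc1 w1 hgm hg k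
    have d2 := h.abs_integral_mul_comp_iterate_sub_le hμm hF hR hc hc1 w2 hgm hg k
    have hgF : Integrable (fun x => g (F^[k + 1] x)) μ :=
      (hF.iterate (k + 1)).integrable_comp_of_integrable hg
    have hgF' : ∫ x, g (F^[k + 1] x) ∂μ = ∫ x, g x ∂μ := by
      have := integral_map (μ := μ) (hF.iterate (k + 1)).measurable.aemeasurable (f := g)
        hgm.aestronglyMeasurable
      rw [(hF.iterate (k + 1)).map_eq] at this
      exact this.symm
    have hmul : ∀ w : Λ → ℝ, IsBddMeasurable w →
        Integrable (fun x => w x * g (F^[k + 1] x)) μ := fun w hw => by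
      obtain ⟨C, hC⟩ := hw.2
      exact hgF.bdd_mul hw.1.aestronglyMeasurable (.of_forall hC)
    have e1 : ∫ x, (u x - c) * g (F^[k + 1] x) ∂μ
        = (∫ x, (u x + 2 * t x) * g (F^[k + 1] x) ∂μ
          - (∫ x, u x + 2 * t x ∂μ) * ∫ x, g x ∂μ)
          - (∫ x, 2 * t x * g (F^[k + 1] x) ∂μ - (∫ x, 2 * t x ∂μ) * ∫ x, g x ∂μ) := by
      have e2 : ∫ x, (u x - c) * g (F^[k + 1] x) ∂μ
          = ∫ x, (u x + 2 * t x) * g (F^[k + 1] x) ∂μ - ∫ x, 2 * t x * g (F^[k + 1] x) ∂μ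
            - c * ∫ x, g x ∂μ := by
        rw [← hgF', ← integral_const_mul, ← integral_sub (hmul _ w1.bdd) (hmul _ w2.bdd)]
        refine Eq.trans ?_ (integral_sub ((hmul _ w1.bdd).sub (hmul _ w2.bdd)) (hgF.const_mul c))
        refine integral_congr_ae (.of_forall fun x => ?_)
        show (u x - c) * g (F^[k + 1] x) = (u x + 2 * t x) * g (F^[k + 1] x)
          - 2 * t x * g (F^[k + 1] x) - c * g (F^[k + 1] x)
        ring
      rw [e2, hutint]; ring
    rw [e1]
    refine (abs_sub _ _).trans ((add_le_add d1 d2).trans ?_)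
    have hi : 0 ≤ ∫ x, |g x| ∂μ := integral_nonneg fun _ => abs_nonneg _
    have hγ : 0 ≤ (1 - c₀) ^ k := pow_nonneg (by linarith) k
    have hD0 : 0 ≤ D := (Real.exp_pos _).le
    -- The source of the 5: the two integrals add up to c plus four times the integral of t, each of
    -- these being at most B.
    have hW : (∫ x, u x + 2 * t x ∂μ) + ∫ x, 2 * t x ∂μ ≤ 5 * B := by
      rw [hutint]; linarith [(abs_le.1 hcB').2]
    calc (1 - c₀) ^ k * D * ((∫ x, u x + 2 * t x ∂μ) * ∫ x, |g x| ∂μ)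
          + (1 - c₀) ^ k * D * ((∫ x, 2 * t x ∂μ) * ∫ x, |g x| ∂μ)
        = (1 - c₀) ^ k * D * (((∫ x, u x + 2 * t x ∂μ) + ∫ x, 2 * t x ∂μ) * ∫ x, |g x| ∂μ) := by
          ring
      _ ≤ (1 - c₀) ^ k * D * (5 * B * ∫ x, |g x| ∂μ) := by gcongr
      _ = _ := by ring
  have hA0 : 0 ≤ 5 * B * D := by have := Real.exp_pos (2 * R * t₀); positivity
  obtain ⟨χ, hχb, hχ, horth⟩ := exists_corrector hF hf hA0 (by linarith : 0 ≤ 1 - c₀)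
    (by linarith) hdec
  rw [sub_sub_cancel] at hχ
  have hX0 : 0 ≤ 5 * B * D / c₀ := by positivity
  refine ⟨χ, fun x => u x - c + χ x - χ (F x), c, hub,
    (hf.add hχb).sub (hχb.comp hF.measurable), hχb, fun x => rfl,
    fun x => (hut x).trans (htZ x), fun x => (hχ x).trans (by linarith), by linarith, ?_, horth⟩
  have hae : ∀ᵐ x ∂μ, x ∈ ⋃₀ α := hμm.ae_le
    (show ∀ᵐ x ∂m, x ∈ ⋃₀ α by rw [ae_iff]; exact h.measure_compl)
  filter_upwards [hae] with x hx
  obtain ⟨a, ha, hxa⟩ := hx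
  -- As Z ≥ 1 almost everywhere, the bounded terms c, χ and χ∘F are absorbed into a multiple of Z.
  have hZ1 : 1 ≤ min (τ x : ℝ) n := le_min (by exact_mod_cast hτ.pos a ha x hxa) hn'
  have h1 := abs_le.1 ((hut x).trans (htZ x))
  have h2 := abs_le.1 hcB'
  have h3 := abs_le.1 (hχ x)
  have h4 := abs_le.1 (hχ (F x))
  have h5 : (B + 2 * (5 * B * D / c₀)) ≤ (B + 2 * (5 * B * D / c₀)) * min (τ x : ℝ) n :=
    le_mul_of_one_le_right (by linarith) hZ1
  rw [abs_le]
  constructor <;> linarith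

end

/-! ### From the induced map to the original map -/

section induced

variable {Λ : Type*} {T : Λ → Λ} {τ : Λ → ℕ} {u w : Λ → ℝ}

theorem abs_birkhoffSum_le_natCast (hu : ∀ x, |u x| ≤ 1) (k : ℕ) (x : Λ) :
    |birkhoffSum T u k x| ≤ k :=
  (Finset.abs_sum_le_sum_abs _ _).trans ((Finset.sum_le_sum fun i _ => hu _).trans (by simp))

theorem abs_iteratedBirkhoffSum_le_sq (hu : ∀ x, |u x| ≤ 1) (hw : ∀ x, |w x| ≤ 1) (k : ℕ)
    (x : Λ) : |iteratedBirkhoffSum T u w k x| ≤ (k : ℝ) ^ 2 := by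
  refine (Finset.abs_sum_le_sum_abs _ _).trans ?_
  rw [sq, ← nsmul_eq_mul]
  nth_rw 2 [← Finset.card_range k]
  refine Finset.sum_le_card_nsmul _ _ _ fun l hl => ?_
  refine (Finset.abs_sum_le_sum_abs _ _).trans ?_
  calc ∑ i ∈ Finset.range l, |u (T^[i] x) * w (T^[l] x)| ≤ ∑ i ∈ Finset.range l, (1 : ℝ) := by
        refine Finset.sum_le_sum fun i _ => ?_
        rw [abs_mul]
        exact mul_le_one₀ (hu _) (abs_nonneg _) (hw _)
    _ ≤ k := by simpa using (Finset.mem_range.1 hl).le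

theorem iterate_birkhoffSum_returnTime (N : ℕ) (y : Λ) :
    T^[birkhoffSum (inducedMap T τ) τ N y] y = (inducedMap T τ)^[N] y := by
  induction N with
  | zero => simp
  | succ N ih =>
    rw [birkhoffSum_succ, add_comm, Function.iterate_add_apply, ih,
      Function.iterate_succ_apply', inducedMap]

theorem birkhoffSum_returnTime (N : ℕ) (y : Λ) :
    birkhoffSum T u (birkhoffSum (inducedMap T τ) τ N y) y
      = birkhoffSum (inducedMap T τ) (fun y => birkhoffSum T u (τ y) y) N y := by
  induction N with
  | zero => simp
  | succ N ih =>
    rw [birkhoffSum_succ _ τ, birkhoffSum_add, ih, iterate_birkhoffSum_returnTime, birkhoffSum_succ]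

theorem iteratedBirkhoffSum_returnTime (N : ℕ) (y : Λ) :
    iteratedBirkhoffSum T u w (birkhoffSum (inducedMap T τ) τ N y) y
      = birkhoffSum (inducedMap T τ) (fun y => iteratedBirkhoffSum T u w (τ y) y) N y
        + iteratedBirkhoffSum (inducedMap T τ) (fun y => birkhoffSum T u (τ y) y)
            (fun y => birkhoffSum T w (τ y) y) N y := by
  induction N with
  | zero => simp [iteratedBirkhoffSum]
  | succ N ih =>
    rw [birkhoffSum_succ _ τ, iteratedBirkhoffSum_add, ih, iterate_birkhoffSum_returnTime,
      birkhoffSum_returnTime, birkhoffSum_succ, iteratedBirkhoffSum_succ]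
    ring

/-- Every time splits into completed excursions and an incomplete one. -/
theorem exists_eq_birkhoffSum_returnTime_add {y : Λ}
    (hy : ∀ i, 1 ≤ τ ((inducedMap T τ)^[i] y)) (k : ℕ) :
    ∃ N r, k = birkhoffSum (inducedMap T τ) τ N y + r ∧ r < τ ((inducedMap T τ)^[N] y) ∧
      N ≤ k := by
  induction k with
  | zero => exact ⟨0, 0, by simp, hy 0, le_rfl⟩
  | succ k ih =>
    obtain ⟨N, r, hk, hr, hN⟩ := ih
    by_cases h : r + 1 < τ ((inducedMap T τ)^[N] y)
    · exact ⟨N, r + 1, by omega, h, by omega⟩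
    · exact ⟨N + 1, 0, by rw [birkhoffSum_succ]; omega, hy _, by omega⟩

theorem birkhoffSum_congr_of_lt {F : Λ → Λ} {f g : Λ → ℝ} {N : ℕ} {y : Λ}
    (h : ∀ i < N, f (F^[i] y) = g (F^[i] y)) : birkhoffSum F f N y = birkhoffSum F g N y :=
  Finset.sum_congr rfl fun i hi => h i (Finset.mem_range.1 hi)

theorem iteratedBirkhoffSum_congr_of_lt {F : Λ → Λ} {f g f' g' : Λ → ℝ} {N : ℕ} {y : Λ}
    (h : ∀ i < N, f (F^[i] y) = g (F^[i] y)) (h' : ∀ i < N, f' (F^[i] y) = g' (F^[i] y)) :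
    iteratedBirkhoffSum F f f' N y = iteratedBirkhoffSum F g g' N y :=
  Finset.sum_congr rfl fun i hi => Finset.sum_congr rfl fun l hl => by
    have hi' := Finset.mem_range.1 hi
    rw [h l ((Finset.mem_range.1 hl).trans hi'), h' i hi']

/-- Sums along the orbit of a point of the base are controlled by sums of truncated observables of
the induced map. -/
theorem birkhoffSum_le_of_dominated (hu : ∀ x, |u x| ≤ 1) (hw : ∀ x, |w x| ≤ 1) {y : Λ} {n : ℕ}
    {Φ : ℝ} (hy : ∀ i, 1 ≤ τ ((inducedMap T τ)^[i] y))
    (hZ : birkhoffSum (inducedMap T τ) (fun x => min (τ x : ℝ) n ^ 2) (n + 1) y ≤ Φ)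
    (hΦ : ∀ k ≤ n,
      birkhoffSum (inducedMap T τ) (truncate τ n fun y => birkhoffSum T u (τ y) y) k y ^ 2 ≤ Φ ∧
      birkhoffSum (inducedMap T τ) (truncate τ n fun y => birkhoffSum T w (τ y) y) k y ^ 2 ≤ Φ ∧
      |iteratedBirkhoffSum (inducedMap T τ) (truncate τ n fun y => birkhoffSum T u (τ y) y)
        (truncate τ n fun y => birkhoffSum T w (τ y) y) k y| ≤ Φ) :
    ∀ k ≤ n, birkhoffSum T u k y ^ 2 ≤ 4 * Φ ∧ birkhoffSum T w k y ^ 2 ≤ 4 * Φ ∧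
      |iteratedBirkhoffSum T u w k y| ≤ 3 * Φ := by
  intro k hk
  set F := inducedMap T τ with hF
  obtain ⟨N, r, hkN, hr, hN⟩ := exists_eq_birkhoffSum_returnTime_add hy k
  rw [← hF] at hkN hr
  set Z : Λ → ℝ := fun x => min (τ x : ℝ) n with hZdef
  -- Completed excursions fit into time k ≤ n, so the truncation does not touch them.
  have hle : ∀ i < N, τ (F^[i] y) ≤ n := fun i hi => by
    have : τ (F^[i] y) ≤ birkhoffSum F τ N y :=
      Finset.single_le_sum (f := fun i => τ (F^[i] y)) (fun _ _ => Nat.zero_le _)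
        (Finset.mem_range.2 hi)
    omega
  have htr : ∀ f : Λ → ℝ, ∀ i < N, f (F^[i] y) = truncate τ n f (F^[i] y) := fun f i hi => by
    rw [truncate, if_pos (hle i hi)]
  have hrZ : (r : ℝ) ≤ Z (F^[N] y) :=
    le_min (by exact_mod_cast hr.le) (by exact_mod_cast (by omega : r ≤ n))
  have hZ0 : ∀ x, 0 ≤ Z x ^ 2 := fun x => sq_nonneg _
  -- At most n completed excursions and one incomplete one: this is why the sum of squares has n + 1
  -- terms.
  have hsum : birkhoffSum F (fun x => Z x ^ 2) N y + Z (F^[N] y) ^ 2 ≤ Φ := by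
    rw [← birkhoffSum_succ F (fun x => Z x ^ 2)]
    exact (birkhoffSum_mono_of_nonneg hZ0 (by omega) y).trans hZ
  have hsum0 : 0 ≤ birkhoffSum F (fun x => Z x ^ 2) N y := Finset.sum_nonneg fun _ _ => hZ0 _
  have hS : ∀ u : Λ → ℝ, (∀ x, |u x| ≤ 1) → birkhoffSum T u r (F^[N] y) ^ 2 ≤ Z (F^[N] y) ^ 2 :=
    fun u hu => sq_le_sq.2 (((abs_birkhoffSum_le_natCast hu r _).trans hrZ).trans (le_abs_self _))
  obtain ⟨hΦ1, hΦ1', hΦ2⟩ := hΦ N (hN.trans hk)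
  rw [← birkhoffSum_congr_of_lt (htr _)] at hΦ1 hΦ1'
  rw [← iteratedBirkhoffSum_congr_of_lt (htr _) (htr _)] at hΦ2
  have e1 : ∀ u : Λ → ℝ, birkhoffSum T u k y
      = birkhoffSum F (fun y => birkhoffSum T u (τ y) y) N y + birkhoffSum T u r (F^[N] y) :=
    fun u => by rw [hkN, birkhoffSum_add, birkhoffSum_returnTime, iterate_birkhoffSum_returnTime]
  have e2 : iteratedBirkhoffSum T u w k y
      = birkhoffSum F (fun y => iteratedBirkhoffSum T u w (τ y) y) N y
        + iteratedBirkhoffSum F (fun y => birkhoffSum T u (τ y) y)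
            (fun y => birkhoffSum T w (τ y) y) N y
        + iteratedBirkhoffSum T u w r (F^[N] y)
        + birkhoffSum F (fun y => birkhoffSum T u (τ y) y) N y * birkhoffSum T w r (F^[N] y) := by
    rw [hkN, iteratedBirkhoffSum_add, iteratedBirkhoffSum_returnTime, birkhoffSum_returnTime,
      iterate_birkhoffSum_returnTime]
  set S := birkhoffSum F (fun y => birkhoffSum T u (τ y) y) N y
  set S' := birkhoffSum F (fun y => birkhoffSum T w (τ y) y) N y
  refine ⟨?_, ?_, ?_⟩
  · rw [e1]
    have := sq_nonneg (S - birkhoffSum T u r (F^[N] y))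
    have := hS u hu
    linarith
  · rw [e1]
    have := sq_nonneg (S' - birkhoffSum T w r (F^[N] y))
    have := hS w hw
    linarith
  · have h1 : |birkhoffSum F (fun y => iteratedBirkhoffSum T u w (τ y) y) N y|
        ≤ birkhoffSum F (fun x => Z x ^ 2) N y := by
      refine (Finset.abs_sum_le_sum_abs _ _).trans (Finset.sum_le_sum fun i hi => ?_)
      refine (abs_iteratedBirkhoffSum_le_sq hu hw _ _).trans (le_of_eq ?_)
      simp only [hZdef]
      rw [min_eq_left (by exact_mod_cast hle i (Finset.mem_range.1 hi))]
    have h2 : |iteratedBirkhoffSum T u w r (F^[N] y)| ≤ Z (F^[N] y) ^ 2 :=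
      (abs_iteratedBirkhoffSum_le_sq hu hw _ _).trans (by gcongr)
    have h3 : |S * birkhoffSum T w r (F^[N] y)| ≤ Φ := by
      have := hS w hw
      rw [abs_le]
      constructor
      · linarith [sq_nonneg (S + birkhoffSum T w r (F^[N] y))]
      · linarith [sq_nonneg (S - birkhoffSum T w r (F^[N] y))]
    rw [e2]
    rw [abs_le] at *
    constructor <;> linarith

/-- Sums along the orbit of a point of the tower. -/
theorem birkhoffSum_iterate_le_of_dominated (hu : ∀ x, |u x| ≤ 1) (hw : ∀ x, |w x| ≤ 1) {y : Λ}
    {n l : ℕ} {Φ : ℝ} (hl : l < τ y)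
    (hu' : ∀ k ≤ n, birkhoffSum T u k (inducedMap T τ y) ^ 2 ≤ 4 * Φ)
    (hw' : ∀ k ≤ n, birkhoffSum T w k (inducedMap T τ y) ^ 2 ≤ 4 * Φ)
    (huw : ∀ k ≤ n, |iteratedBirkhoffSum T u w k (inducedMap T τ y)| ≤ 3 * Φ) :
    ∀ k ≤ n, birkhoffSum T u k (T^[l] y) ^ 2 ≤ 8 * (min (τ y : ℝ) n ^ 2 + Φ) ∧
      |iteratedBirkhoffSum T u w k (T^[l] y)| ≤ 8 * (min (τ y : ℝ) n ^ 2 + Φ) := by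
  intro k hk
  set Z := min (τ y : ℝ) n with hZ
  have hΦ : 0 ≤ Φ := by
    have := huw 0 (Nat.zero_le _)
    have := abs_nonneg (iteratedBirkhoffSum T u w 0 (inducedMap T τ y))
    linarith
  have hZ0 : 0 ≤ Z ^ 2 := sq_nonneg Z
  have hshort : ∀ i, i ≤ τ y → i ≤ n → (i : ℝ) ≤ Z := fun i h1 h2 =>
    le_min (by exact_mod_cast h1) (by exact_mod_cast h2)
  have hsq : ∀ i, i ≤ τ y → i ≤ n → ∀ u : Λ → ℝ, (∀ x, |u x| ≤ 1) →
      birkhoffSum T u i (T^[l] y) ^ 2 ≤ Z ^ 2 := fun i h1 h2 u hu =>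
    sq_le_sq.2 (((abs_birkhoffSum_le_natCast hu i _).trans (hshort i h1 h2)).trans (le_abs_self _))
  have hit : ∀ i, i ≤ τ y → i ≤ n → |iteratedBirkhoffSum T u w i (T^[l] y)| ≤ Z ^ 2 :=
    fun i h1 h2 => (abs_iteratedBirkhoffSum_le_sq hu hw _ _).trans (by
      have := hshort i h1 h2
      gcongr)
  -- Either the orbit is still in the column at time k, or it is split at its arrival at F y.
  rcases le_total k (τ y - l) with h | h
  · have h1 : k ≤ τ y := by omega
    exact ⟨(hsq k h1 hk u hu).trans (by linarith), (hit k h1 hk).trans (by linarith)⟩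
  · obtain ⟨i, rfl⟩ := Nat.exists_eq_add_of_le h
    have h1 : τ y - l ≤ τ y := by omega
    have h2 : τ y - l ≤ n := by omega
    have hF : T^[τ y - l] (T^[l] y) = inducedMap T τ y := by
      rw [← Function.iterate_add_apply, Nat.sub_add_cancel hl.le, inducedMap]
    rw [birkhoffSum_add, iteratedBirkhoffSum_add, hF]
    have a1 := hsq _ h1 h2 u hu
    have a2 := hit _ h1 h2
    have a3 := hu' i (by omega)
    have a4 := hw' i (by omega)
    have a5 := huw i (by omega)
    set A := birkhoffSum T u (τ y - l) (T^[l] y)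
    constructor
    · linarith [sq_nonneg (A - birkhoffSum T u i (inducedMap T τ y))]
    · rw [abs_le] at a2 a5 ⊢
      constructor
      · linarith [sq_nonneg (A + birkhoffSum T w i (inducedMap T τ y))]
      · linarith [sq_nonneg (A - birkhoffSum T w i (inducedMap T τ y))]

end induced

/-! ### Moments on the tower -/

section measurability

variable {Λ : Type*} [MeasurableSpace Λ] {T : Λ → Λ} {τ : Λ → ℕ} {u : Λ → ℝ}

theorem measurable_birkhoffSum (hT : Measurable T) (hu : Measurable u) (k : ℕ) :
    Measurable (birkhoffSum T u k) :=
  Finset.measurable_sum _ fun i _ => hu.comp (hT.iterate i)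

theorem measurable_apply_returnTime {β : Type*} [MeasurableSpace β] {f : ℕ → Λ → β}
    (hf : ∀ k, Measurable (f k)) (hτ : Measurable τ) : Measurable fun y => f (τ y) y :=
  (measurable_from_prod_countable_right (f := fun z : ℕ × Λ => f z.1 z.2) hf).comp
    (hτ.prodMk measurable_id)

end measurability

/-- The constant in `exists_tower_dominating_function`. -/
noncomputable def towerConst (H D B P : ℝ) : ℝ :=
  8 ^ P * 2 ^ P * (B + D * B * dominationConst H D B P)

section tower

variable {Λ : Type*} [MetricSpace Λ] [MeasurableSpace Λ] [BorelSpace Λ] {m μ : Measure Λ}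
  [IsProbabilityMeasure m] [IsProbabilityMeasure μ] {T : Λ → Λ} {τ : Λ → ℕ}
  {α : Set (Set Λ)} {j : Λ → ℝ≥0∞} {η θ K t₀ R c₀ p B H D P : ℝ} {n : ℕ}

/-- Quasi-independence of the return time and of the future. -/
theorem lintegral_returnTime_mul_comp_le {F : Λ → Λ} (h : IsGibbsMarkov m F α j η θ K t₀)
    (hμm : μ ≪ m) (hF : MeasurePreserving F μ μ) (hR : R = 3 * K / (1 - θ))
    (hτ : IsReturnTime α τ) {g : Λ → ℝ≥0∞} (hg : Measurable g) :
    ∫⁻ x, (τ x : ℝ≥0∞) * g (F x) ∂μ ≤ ENNReal.ofReal (Real.exp (2 * R * t₀))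
      * (∫⁻ x, (τ x : ℝ≥0∞) ∂μ) * ∫⁻ x, g x ∂μ := by
  have hK := h.K_pos
  have hmin : ∀ (N : ℕ) x, ENNReal.ofReal (min (τ x : ℝ) N) = ((min (τ x) N : ℕ) : ℝ≥0∞) :=
    fun N x => by rw [← ENNReal.ofReal_natCast]; push_cast; rfl
  -- Regular weights are bounded, so τ is reached from min(τ, N) by monotone convergence.
  have hN : ∀ N : ℕ, ∫⁻ x, ((min (τ x) N : ℕ) : ℝ≥0∞) * g (F x) ∂μ
      ≤ ENNReal.ofReal (Real.exp (2 * R * t₀)) * (∫⁻ x, (τ x : ℝ≥0∞) ∂μ) * ∫⁻ x, g x ∂μ := by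
    intro N
    have hw : IsRegularWeight F α η K (fun x => min (τ x : ℝ) N) := by
      refine ⟨isBddMeasurable_min hτ.measurable N, fun x => by positivity,
        fun a ha x hx y hy => ?_⟩
      rw [hτ.const a ha x hx y hy]
      exact le_mul_of_one_le_left (by positivity) (Real.one_le_exp (by positivity))
    have := h.lintegral_mul_comp_le hμm hF hR hw hg
    simp only [hmin] at this
    refine this.trans ?_
    gcongr with x
    exact min_le_left _ _
  have hsup : ∀ x, (τ x : ℝ≥0∞) * g (F x) = ⨆ N : ℕ, ((min (τ x) N : ℕ) : ℝ≥0∞) * g (F x) := by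
    intro x
    refine le_antisymm ?_ (iSup_le fun N => ?_)
    · exact le_iSup_of_le (τ x) (by rw [min_self])
    · gcongr; exact min_le_left _ _
  simp only [hsup]
  rw [lintegral_iSup (fun N => ?_) (fun N M hNM x => ?_)]
  · exact iSup_le hN
  · exact ((measurable_from_top (f := fun k : ℕ => (k : ℝ≥0∞))).comp
      (hτ.measurable.min measurable_const)).mul (hg.comp h.measurable)
  · show ((min (τ x) N : ℕ) : ℝ≥0∞) * g (F x) ≤ ((min (τ x) M : ℕ) : ℝ≥0∞) * g (F x)
    gcongr

/-- A single function that controls all sums along the orbits starting in a column of the tower. -/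
theorem exists_tower_dominating_function
    (h : IsGibbsMarkov m (inducedMap T τ) α j η θ K t₀) (hμm : μ ≪ m)
    (hF : MeasurePreserving (inducedMap T τ) μ μ) (hR : R = 3 * K / (1 - θ))
    (hc : c₀ = Real.exp (-(2 * R * t₀)) * (K / R)) (hτ : IsReturnTime α τ) (hT : Measurable T)
    (hinter : ∀ a ∈ α, ∀ x ∈ a, ∀ y ∈ a, ∀ l < τ x,
      dist (T^[l] x) (T^[l] y) ^ η ≤ K * dist (inducedMap T τ x) (inducedMap T τ y) ^ η)
    (hp : 2 ≤ p) (hP : 2 * (p - 1) ≤ P) (hint : Integrable (fun x => (τ x : ℝ) ^ p) μ)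
    (hB : ∫ x, (τ x : ℝ) ^ p ∂μ ≤ B) (hB1 : 1 ≤ B)
    (hD : D = Real.exp (2 * R * t₀)) (hH : H = 1 + B + 2 * (5 * B * D / c₀)) (hn : 1 ≤ n)
    {u w : Λ → ℝ} (hum : Measurable u) (hwm : Measurable w)
    (hu : ∀ x, |u x| ≤ 1) (hw : ∀ x, |w x| ≤ 1)
    (huη : ∀ x y, u x - u y ≤ dist x y ^ η) (hwη : ∀ x y, w x - w y ≤ dist x y ^ η)
    (hu0 : ∫ y, birkhoffSum T u (τ y) y ∂μ = 0) (hw0 : ∫ y, birkhoffSum T w (τ y) y ∂μ = 0) :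
    ∃ Ψ : Λ → ℝ, IsBddMeasurable Ψ ∧
      (∀ᵐ y ∂μ, ∀ l < τ y, ∀ k ≤ n, birkhoffSum T u k (T^[l] y) ^ 2 ≤ Ψ y ∧
        |iteratedBirkhoffSum T u w k (T^[l] y)| ≤ Ψ y) ∧
      eLpNorm Ψ (ENNReal.ofReal (p - 1)) (μ.withDensity fun y => (τ y : ℝ≥0∞))
        ≤ ENNReal.ofReal (towerConst H D B P) * n := by
  have hK := h.K_pos
  have h1θ : 0 < 1 - θ := by linarith [h.theta_lt_one]
  have hR0 : 0 < R := by rw [hR]; positivity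
  have hD1 : 1 ≤ D := by
    rw [hD]; refine Real.one_le_exp ?_
    have := h.t₀_nonneg
    positivity
  have hc0 : 0 < c₀ := by rw [hc]; positivity
  have hH1 : 1 ≤ H := by
    have : 0 ≤ 2 * (5 * B * D / c₀) := by positivity
    linarith
  have hdec : ∀ u : Λ → ℝ, Measurable u → (∀ x, |u x| ≤ 1) → (∀ x y, u x - u y ≤ dist x y ^ η) →
      ∫ y, birkhoffSum T u (τ y) y ∂μ = 0 →
      ∃ χ M c, IsMartingaleDecomposition μ (inducedMap T τ) (fun x => min (τ x : ℝ) n) n H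
        (truncate τ n fun y => birkhoffSum T u (τ y) y) χ M c := by
    intro u hum hu huη hu0
    rw [hH, hD]
    refine exists_isMartingaleDecomposition h hμm hF hR hc hτ hp hint hB hn
      (measurable_apply_returnTime (measurable_birkhoffSum hT hum) hτ.measurable)
      (fun x => abs_birkhoffSum_le_natCast hu _ _) hu0 fun a ha x hx y hy => ?_
    rw [← hτ.const a ha x hx y hy, birkhoffSum, birkhoffSum, ← Finset.sum_sub_distrib]
    refine (Finset.sum_le_card_nsmul _ _ _ fun l hl =>
      (huη _ _).trans (hinter a ha x hx y hy l (Finset.mem_range.1 hl))).trans (le_of_eq ?_)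
    rw [Finset.card_range, nsmul_eq_mul]
  obtain ⟨χ, M, c, hmd⟩ := hdec u hum hu huη hu0
  obtain ⟨χ', M', c', hmd'⟩ := hdec w hwm hw hwη hw0
  have hZ := isExcursionLength_min h hμm hF hR hτ hp hint hB hn
  rw [← hD] at hZ
  obtain ⟨Φ, hΦb, hΦint, hΦZ, hΦ⟩ :=
    exists_dominating_function hZ hmd hmd' hF hn hH1 hD1 hB1 hp hP
  have hΦ0 : ∀ x, 0 ≤ Φ x := fun x => (sq_nonneg _).trans (hΦ x 0 (Nat.zero_le _)).1
  have hZb := isBddMeasurable_min hτ.measurable n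
  have hr0 : 0 < p - 1 := by linarith
  have hrP : p - 1 ≤ P := by linarith
  have hP0 : 0 ≤ P := by linarith
  have hn0 : (0 : ℝ) < n := by exact_mod_cast hn
  have hdom0 : 0 ≤ dominationConst H D B P := by
    have h1 : 0 ≤ ∫ x, Φ x ^ (p - 1) ∂μ := integral_nonneg fun x => Real.rpow_nonneg (hΦ0 x) _
    have h2 : 0 < (n : ℝ) ^ (p - 1) := by positivity
    exact nonneg_of_mul_nonneg_left (h1.trans hΦint) h2
  -- The first term pays for the rest of the column above y, the second for the orbit from F y on.
  set G : Λ → ℝ := fun y => 8 * (min (τ y : ℝ) n ^ 2 + Φ (inducedMap T τ y)) with hG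
  have hGb : IsBddMeasurable G := (IsBddMeasurable.const 8).mul (hZb.sq.add (hΦb.comp h.measurable))
  have hG0 : ∀ y, 0 ≤ G y := fun y => by have := hΦ0 (inducedMap T τ y); positivity
  refine ⟨G, hGb, ?_, ?_⟩
  · have hpos : ∀ᵐ y ∂μ, 1 ≤ τ y := by
      have hae : ∀ᵐ x ∂μ, x ∈ ⋃₀ α := hμm.ae_le
        (show ∀ᵐ x ∂m, x ∈ ⋃₀ α by rw [ae_iff]; exact h.measure_compl)
      filter_upwards [hae] with x hx
      obtain ⟨a, ha, hxa⟩ := hx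
      exact hτ.pos a ha x hxa
    have hpos' : ∀ᵐ y ∂μ, ∀ i, 1 ≤ τ ((inducedMap T τ)^[i] (inducedMap T τ y)) := by
      refine ae_all_iff.2 fun i => ?_
      simp only [← Function.iterate_succ_apply]
      exact (hF.iterate (i + 1)).quasiMeasurePreserving.ae hpos
    filter_upwards [hpos'] with y hy l hl
    have b := birkhoffSum_le_of_dominated hu hw hy (hΦZ _) (hΦ _)
    exact birkhoffSum_iterate_le_of_dominated hu hw hl (fun k hk => (b k hk).1)
      (fun k hk => (b k hk).2.1) (fun k hk => (b k hk).2.2)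
  · have hr1 : 1 ≤ p - 1 := by linarith
    have hr2 : (ENNReal.ofReal (p - 1)).toReal = p - 1 := ENNReal.toReal_ofReal hr0.le
    have hτm : Measurable fun y => (τ y : ℝ≥0∞) := measurable_from_top.comp hτ.measurable
    have hC0 : (0 : ℝ) ≤ 8 ^ P * 2 ^ P := by positivity
    -- Needed at the end, where the power 1/(p-1) ≤ 1 of the constant is replaced by the constant.
    have hA1 : 1 ≤ towerConst H D B P := by
      rw [towerConst]
      have h1 : (1 : ℝ) ≤ 8 ^ P := Real.one_le_rpow (by norm_num) hP0
      have h2 : (1 : ℝ) ≤ 2 ^ P := Real.one_le_rpow (by norm_num) hP0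
      have h3 : 0 ≤ D * B * dominationConst H D B P := by positivity
      exact one_le_mul_of_one_le_of_one_le (one_le_mul_of_one_le_of_one_le h1 h2) (by linarith)
    have hGp : ∀ y, G y ^ (p - 1) ≤ 8 ^ P * 2 ^ P * ((min (τ y : ℝ) n ^ 2) ^ (p - 1)
        + Φ (inducedMap T τ y) ^ (p - 1)) := fun y => by
      have hΦy := hΦ0 (inducedMap T τ y)
      calc G y ^ (p - 1) = 8 ^ (p - 1) * (min (τ y : ℝ) n ^ 2 + Φ (inducedMap T τ y)) ^ (p - 1) :=
            Real.mul_rpow (by norm_num) (by positivity)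
        _ ≤ 8 ^ P * (2 ^ P * ((min (τ y : ℝ) n ^ 2) ^ (p - 1)
            + Φ (inducedMap T τ y) ^ (p - 1))) := by
          gcongr
          · norm_num
          · exact rpow_add_le_two_rpow_mul hr0.le hrP (sq_nonneg _) hΦy
        _ = _ := by ring
    have hτint : ∫⁻ y, (τ y : ℝ≥0∞) ∂μ ≤ ENNReal.ofReal B := by
      calc ∫⁻ y, (τ y : ℝ≥0∞) ∂μ ≤ ∫⁻ y, ENNReal.ofReal ((τ y : ℝ) ^ p) ∂μ := by
            refine lintegral_mono fun y => ?_
            rw [← ENNReal.ofReal_natCast]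
            refine ENNReal.ofReal_le_ofReal ?_
            simpa using natCast_rpow_le_rpow (k := τ y) (s := 1) one_pos (by linarith : (1 : ℝ) ≤ p)
        _ = ENNReal.ofReal (∫ y, (τ y : ℝ) ^ p ∂μ) :=
            (ofReal_integral_eq_lintegral_ofReal hint (.of_forall fun y => by positivity)).symm
        _ ≤ _ := ENNReal.ofReal_le_ofReal hB
    -- From min(τ, n)² ≤ τn the integrand is at most τ · (τn)^{p-1} = τ^p n^{p-1}: the L^p
    -- hypothesis is used to its full strength.
    have h1 : ∫⁻ y, (τ y : ℝ≥0∞) * ENNReal.ofReal ((min (τ y : ℝ) n ^ 2) ^ (p - 1)) ∂μ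
        ≤ ENNReal.ofReal (B * (n : ℝ) ^ (p - 1)) := by
      calc ∫⁻ y, (τ y : ℝ≥0∞) * ENNReal.ofReal ((min (τ y : ℝ) n ^ 2) ^ (p - 1)) ∂μ
          ≤ ∫⁻ y, ENNReal.ofReal ((τ y : ℝ) ^ p * (n : ℝ) ^ (p - 1)) ∂μ := by
            refine lintegral_mono fun y => ?_
            rw [← ENNReal.ofReal_natCast, ← ENNReal.ofReal_mul (by positivity)]
            refine ENNReal.ofReal_le_ofReal ?_
            rcases Nat.eq_zero_or_pos (τ y) with hy | hy
            · rw [hy]; simp only [Nat.cast_zero, zero_mul]; positivity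
            have hy' : (0 : ℝ) < τ y := by exact_mod_cast hy
            calc (τ y : ℝ) * (min (τ y : ℝ) n ^ 2) ^ (p - 1)
                ≤ τ y * ((τ y : ℝ) * n) ^ (p - 1) := by
                  gcongr
                  rw [sq]
                  gcongr
                  · exact min_le_left _ _
                  · exact min_le_right _ _
              _ = (τ y : ℝ) ^ (1 : ℝ) * (τ y : ℝ) ^ (p - 1) * (n : ℝ) ^ (p - 1) := by
                  rw [Real.mul_rpow hy'.le hn0.le, Real.rpow_one]; ring
              _ = _ := by rw [← Real.rpow_add hy']; ring_nf
        _ = ENNReal.ofReal (∫ y, (τ y : ℝ) ^ p * (n : ℝ) ^ (p - 1) ∂μ) :=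
            (ofReal_integral_eq_lintegral_ofReal (hint.mul_const _)
              (.of_forall fun y => by positivity)).symm
        _ ≤ _ := by
            rw [integral_mul_const]
            gcongr
    have hΦp : IsBddMeasurable fun x => Φ x ^ (p - 1) := hΦb.rpow hΦ0 hr0.le
    -- Quasi-independence of the column height and the future: no moment of Φ beyond p - 1 is
    -- required.
    have h2 : ∫⁻ y, (τ y : ℝ≥0∞) * ENNReal.ofReal (Φ (inducedMap T τ y) ^ (p - 1)) ∂μ
        ≤ ENNReal.ofReal (D * B * (dominationConst H D B P * (n : ℝ) ^ (p - 1))) := by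
      refine (lintegral_returnTime_mul_comp_le h hμm hF hR hτ
        (g := fun x => ENNReal.ofReal (Φ x ^ (p - 1))) hΦp.1.ennreal_ofReal).trans ?_
      rw [ENNReal.ofReal_mul (by positivity), ENNReal.ofReal_mul (by linarith), ← hD,
        ← ofReal_integral_eq_lintegral_ofReal hΦp.integrable
          (.of_forall fun y => Real.rpow_nonneg (hΦ0 y) _)]
      gcongr
    rw [eLpNorm_eq_lintegral_rpow_enorm_toReal (by simpa using hr0) ENNReal.ofReal_ne_top, hr2]
    have h3 : ∫⁻ y, ‖G y‖ₑ ^ (p - 1) ∂μ.withDensity (fun y => (τ y : ℝ≥0∞))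
        ≤ ENNReal.ofReal (towerConst H D B P) * (n : ℝ≥0∞) ^ (p - 1) := by
      rw [lintegral_withDensity_eq_lintegral_mul _ hτm (hGb.1.enorm.pow_const _)]
      calc ∫⁻ y, (τ y : ℝ≥0∞) * ‖G y‖ₑ ^ (p - 1) ∂μ
          ≤ ∫⁻ y, ENNReal.ofReal (8 ^ P * 2 ^ P)
              * ((τ y : ℝ≥0∞) * ENNReal.ofReal ((min (τ y : ℝ) n ^ 2) ^ (p - 1))
                + (τ y : ℝ≥0∞) * ENNReal.ofReal (Φ (inducedMap T τ y) ^ (p - 1))) ∂μ := by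
            refine lintegral_mono fun y => ?_
            rw [Real.enorm_eq_ofReal (hG0 y), ENNReal.ofReal_rpow_of_nonneg (hG0 y) hr0.le,
              ← mul_add, ← ENNReal.ofReal_add (by positivity)
                (Real.rpow_nonneg (hΦ0 _) _), mul_left_comm, ← ENNReal.ofReal_mul hC0]
            gcongr
            exact hGp y
        _ ≤ ENNReal.ofReal (8 ^ P * 2 ^ P) * (ENNReal.ofReal (B * (n : ℝ) ^ (p - 1))
            + ENNReal.ofReal (D * B * (dominationConst H D B P * (n : ℝ) ^ (p - 1)))) := by
            rw [lintegral_const_mul', lintegral_add_left']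
            · gcongr
            · exact (hτm.mul (((hZb.sq).1.pow_const _).ennreal_ofReal)).aemeasurable
            · exact ENNReal.ofReal_ne_top
        _ = _ := by
            rw [← ENNReal.ofReal_add (by positivity) (by positivity), ← ENNReal.ofReal_mul hC0,
              ← ENNReal.ofReal_natCast, ENNReal.ofReal_rpow_of_nonneg hn0.le hr0.le,
              ← ENNReal.ofReal_mul (by linarith), towerConst]
            congr 1; ring
    refine (ENNReal.rpow_le_rpow h3 (by positivity)).trans ?_
    rw [ENNReal.mul_rpow_of_nonneg _ _ (by positivity), ← ENNReal.rpow_mul,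
      mul_one_div_cancel hr0.ne', ENNReal.rpow_one]
    gcongr
    refine (ENNReal.rpow_le_rpow_of_exponent_le (y := 1 / (p - 1)) (z := 1) ?_ ?_).trans
      (ENNReal.rpow_one _).le
    · rw [← ENNReal.ofReal_one]; exact ENNReal.ofReal_le_ofReal hA1
    · rw [div_le_one hr0]; exact hr1

end tower

/-! ### The projected measure -/

section projected

variable {Λ : Type*} [MeasurableSpace Λ] {T : Λ → Λ} {τ : Λ → ℕ} {μY : Measure Λ}

theorem measurable_iterate_prod (hT : Measurable T) :
    Measurable fun z : Λ × ℕ => T^[z.2] z.1 :=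
  measurable_from_prod_countable_left fun l => hT.iterate l

theorem measurableSet_tower (hτ : Measurable τ) : MeasurableSet {z : Λ × ℕ | z.2 < τ z.1} :=
  measurableSet_lt measurable_snd (hτ.comp measurable_fst)

theorem setLIntegral_tower [SFinite μY] (hτ : Measurable τ) {g : Λ → ℝ≥0∞} (hg : Measurable g) :
    ∫⁻ z in {z : Λ × ℕ | z.2 < τ z.1}, g z.1 ∂(μY.prod Measure.count)
      = ∫⁻ y, (τ y : ℝ≥0∞) * g y ∂μY := by
  rw [← lintegral_indicator (measurableSet_tower hτ),
    lintegral_prod ({z : Λ × ℕ | z.2 < τ z.1}.indicator fun z => g z.1)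
      ((hg.comp measurable_fst).indicator (measurableSet_tower hτ)).aemeasurable]
  refine lintegral_congr fun y => ?_
  have : (fun l => {z : Λ × ℕ | z.2 < τ z.1}.indicator (fun z => g z.1) (y, l))
      = (Iio (τ y)).indicator fun _ => g y := by
    ext l; simp [indicator]
  rw [this, lintegral_indicator measurableSet_Iio, setLIntegral_const, mul_comm]
  congr 1
  rw [← Finset.coe_range, Measure.count_apply_finset, Finset.card_range]

/-- A function which is dominated on the columns of the tower. -/
theorem eLpNorm_projectedMeasure_le [SFinite μY] (hτ : Measurable τ)
    (hc : 1 ≤ ∫⁻ y, (τ y : ℝ≥0∞) ∂μY) {q : ℝ} (hq : 0 < q) {G Ψ : Λ → ℝ} (hΨ : Measurable Ψ)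
    (h : ∀ᵐ y ∂μY, ∀ l < τ y, |G (T^[l] y)| ≤ Ψ y) :
    eLpNorm G (ENNReal.ofReal q) (projectedMeasure T τ μY)
      ≤ eLpNorm Ψ (ENNReal.ofReal q) (μY.withDensity fun y => (τ y : ℝ≥0∞)) := by
  have hq' : ENNReal.ofReal q ≠ 0 := by simpa using hq
  have hτm : Measurable fun y => (τ y : ℝ≥0∞) := measurable_from_top.comp hτ
  have hΨm : Measurable fun y => ‖Ψ y‖ₑ ^ q := hΨ.enorm.pow_const _
  rw [eLpNorm_eq_lintegral_rpow_enorm_toReal hq' ENNReal.ofReal_ne_top,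
    eLpNorm_eq_lintegral_rpow_enorm_toReal hq' ENNReal.ofReal_ne_top, ENNReal.toReal_ofReal hq.le]
  refine ENNReal.rpow_le_rpow ?_ (by positivity)
  rw [lintegral_withDensity_eq_lintegral_mul _ hτm hΨm]
  refine (lintegral_map_le _ _).trans ?_
  rw [towerMeasure, lintegral_smul_measure, smul_eq_mul]
  -- The normalizing factor of the tower measure is at most 1 and is dropped.
  refine (mul_le_of_le_one_left zero_le (ENNReal.inv_le_one.2 hc)).trans ?_
  refine le_trans ?_ (setLIntegral_tower hτ hΨm).le
  refine setLIntegral_mono_ae (hΨm.comp measurable_fst).aemeasurable ?_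
  filter_upwards [Measure.quasiMeasurePreserving_fst.ae h] with z hz hzτ
  gcongr
  rw [Real.enorm_eq_ofReal_abs, Real.enorm_eq_ofReal_abs]
  exact ENNReal.ofReal_le_ofReal ((hz z.2 hzτ).trans (le_abs_self _))

/-- An observable with zero mean induces an observable with zero mean. -/
theorem integral_birkhoffSum_returnTime_eq_zero [IsProbabilityMeasure μY] (hT : Measurable T)
    (hτ : Measurable τ) (hc : ∫⁻ y, (τ y : ℝ≥0∞) ∂μY ≠ ∞) {u : Λ → ℝ} (hu : Measurable u)
    (hu1 : ∀ x, |u x| ≤ 1) (h : ∫ x, u x ∂(projectedMeasure T τ μY) = 0) :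
    ∫ y, birkhoffSum T u (τ y) y ∂μY = 0 := by
  set S := {z : Λ × ℕ | z.2 < τ z.1} with hS
  have hSm : MeasurableSet S := measurableSet_tower hτ
  have hπ := measurable_iterate_prod hT
  have hmass : (μY.prod Measure.count) S = ∫⁻ y, (τ y : ℝ≥0∞) ∂μY := by
    have := setLIntegral_tower (μY := μY) hτ (g := fun _ => 1) measurable_const
    simpa using this
  have hint : IntegrableOn (fun z : Λ × ℕ => u (T^[z.2] z.1)) S (μY.prod Measure.count) := by
    refine IntegrableOn.of_bound (by rw [hmass]; exact hc.lt_top)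
      (hu.comp hπ).aestronglyMeasurable 1 (.of_forall fun z => hu1 _)
  have e1 : ∫ z in S, u (T^[z.2] z.1) ∂(μY.prod Measure.count)
      = ∫ y, birkhoffSum T u (τ y) y ∂μY := by
    rw [← integral_indicator hSm, integral_prod _ ((integrable_indicator_iff hSm).2 hint)]
    refine integral_congr_ae (.of_forall fun y => ?_)
    have : (fun l => S.indicator (fun z => u (T^[z.2] z.1)) (y, l))
        = (↑(Finset.range (τ y)) : Set ℕ).indicator fun l => u (T^[l] y) := by
      ext l; simp [indicator, hS]
    simp only [this]
    rw [integral_indicator (Finset.measurableSet _), setIntegral_finset]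
    · simp [birkhoffSum, Measure.real]
    · refine IntegrableOn.of_bound ?_ (measurable_of_countable _).aestronglyMeasurable 1
        (.of_forall fun l => hu1 _)
      rw [Measure.count_apply_finset]; exact ENNReal.natCast_lt_top _
  rw [projectedMeasure, integral_map hπ.aemeasurable hu.aestronglyMeasurable, towerMeasure,
    integral_smul_measure, e1, smul_eq_mul] at h
  rcases mul_eq_zero.1 h with h | h
  · rw [ENNReal.toReal_inv, inv_eq_zero, ENNReal.toReal_eq_zero_iff] at h
    rcases h with h | h
    · rw [lintegral_eq_zero_iff (f := fun y => (τ y : ℝ≥0∞)) (measurable_from_top.comp hτ)] at h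
      refine integral_eq_zero_of_ae ?_
      filter_upwards [h] with y hy
      have : τ y = 0 := by simpa using hy
      simp [this]
    · exact absurd h hc
  · exact h

theorem isFiniteMeasure_projectedMeasure [SFinite μY] (hτ : Measurable τ) (hT : Measurable T)
    (hc : 1 ≤ ∫⁻ y, (τ y : ℝ≥0∞) ∂μY) (hc' : ∫⁻ y, (τ y : ℝ≥0∞) ∂μY ≠ ∞) :
    IsFiniteMeasure (projectedMeasure T τ μY) := by
  constructor
  have hmass : (μY.prod Measure.count) {z : Λ × ℕ | z.2 < τ z.1} = ∫⁻ y, (τ y : ℝ≥0∞) ∂μY := by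
    have := setLIntegral_tower (μY := μY) hτ (g := fun _ => 1) measurable_const
    simpa using this
  rw [projectedMeasure, Measure.map_apply (measurable_iterate_prod hT) .univ, preimage_univ,
    towerMeasure, Measure.smul_apply, Measure.restrict_apply_univ, hmass, smul_eq_mul,
    ENNReal.inv_mul_cancel (by positivity) hc']
  exact ENNReal.one_lt_top

end projected

/-! ### Hölder observables with values in a Euclidean space -/

section holder

variable {Λ : Type*} [MetricSpace Λ] {η : ℝ≥0}

theorem norm_le_holderNormFull {E : Type*} [NormedAddCommGroup E] {v : Λ → E}
    (hv : holderNormFull η v < ∞) (x : Λ) : ‖v x‖ ≤ (holderNormFull η v).toReal := by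
  rw [← toReal_enorm]
  exact ENNReal.toReal_mono hv.ne ((le_iSup (fun x => ‖v x‖ₑ) x).trans le_self_add)

theorem norm_sub_le_holderNormFull {E : Type*} [NormedAddCommGroup E] {v : Λ → E}
    (hv : holderNormFull η v < ∞) (x y : Λ) :
    ‖v x - v y‖ ≤ (holderNormFull η v).toReal * dist x y ^ (η : ℝ) := by
  have h1 : eHolderNorm η v < ∞ := lt_of_le_of_lt le_add_self hv
  have h2 : MemHolder η v := eHolderNorm_lt_top.1 h1
  have h3 := h2.holderWith.dist_le x y
  rw [dist_eq_norm] at h3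
  refine h3.trans ?_
  gcongr
  rw [← ENNReal.coe_toReal, h2.coe_nnHolderNorm_eq_eHolderNorm]
  exact ENNReal.toReal_mono hv.ne le_add_self

theorem continuous_of_holderNormFull_lt_top {E : Type*} [NormedAddCommGroup E] {v : Λ → E}
    (hη : 0 < η) (hv : holderNormFull η v < ∞) : Continuous v :=
  (eHolderNorm_lt_top.1 (lt_of_le_of_lt le_add_self hv)).holderWith.continuous hη

end holder

section coordinates

variable {Λ : Type*} {d : ℕ}

/-- The coordinates of `v`, divided by `c`. -/
noncomputable def scaledCoord (c : ℝ) (v : Λ → EuclideanSpace ℝ (Fin d)) (a : Fin d) (x : Λ) : ℝ :=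
  v x a / c

variable {v : Λ → EuclideanSpace ℝ (Fin d)} {c : ℝ}

theorem abs_scaledCoord_le (h : ∀ x, ‖v x‖ ≤ c) (a : Fin d) (x : Λ) : |scaledCoord c v a x| ≤ 1 := by
  have hc : 0 ≤ c := (norm_nonneg _).trans (h x)
  rw [scaledCoord, abs_div, abs_of_nonneg hc]
  exact div_le_one_of_le₀ ((PiLp.norm_apply_le (v x) a).trans (h x)) hc

/-- True for c = 0 as well, since v then vanishes, so the case of zero Hölder norm needs no separate
treatment. -/
theorem eq_mul_scaledCoord (h : ∀ x, ‖v x‖ ≤ c) (a : Fin d) (x : Λ) :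
    v x a = c * scaledCoord c v a x := by
  rcases eq_or_ne c 0 with rfl | hc
  · have : v x = 0 := norm_le_zero_iff.1 (h x)
    simp [this]
  · rw [scaledCoord, mul_div_cancel₀ _ hc]

theorem norm_birkhoffSum_sq (h : ∀ x, ‖v x‖ ≤ c) (T : Λ → Λ) (k : ℕ) (x : Λ) :
    ‖birkhoffSum T v k x‖ ^ 2 = c ^ 2 * ∑ a, birkhoffSum T (scaledCoord c v a) k x ^ 2 := by
  rw [EuclideanSpace.norm_sq_eq, Finset.mul_sum]
  refine Finset.sum_congr rfl fun a _ => ?_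
  rw [Real.norm_eq_abs, sq_abs, ← mul_pow, birkhoffSum, birkhoffSum, Finset.mul_sum]
  congr 1
  simp [eq_mul_scaledCoord h]

theorem norm_iteratedSum_le (h : ∀ x, ‖v x‖ ≤ c) (T : Λ → Λ) (k : ℕ) (x : Λ) :
    ‖iteratedSum T v k x‖ ≤ c ^ 2 * ∑ a, ∑ b,
      |iteratedBirkhoffSum T (scaledCoord c v a) (scaledCoord c v b) k x| := by
  have hval : ∀ a b, iteratedSum T v k x a b
      = c ^ 2 * iteratedBirkhoffSum T (scaledCoord c v a) (scaledCoord c v b) k x := fun a b => by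
    rw [iteratedSum, Matrix.sum_apply, iteratedBirkhoffSum, Finset.mul_sum]
    refine Finset.sum_congr rfl fun j _ => ?_
    rw [Finset.mul_sum, Matrix.sum_apply]
    refine Finset.sum_congr rfl fun i _ => ?_
    rw [Matrix.vecMulVec_apply, eq_mul_scaledCoord h, eq_mul_scaledCoord h]
    ring
  have hentry : ∀ a b, ‖iteratedSum T v k x a b‖
      = c ^ 2 * |iteratedBirkhoffSum T (scaledCoord c v a) (scaledCoord c v b) k x| := fun a b =>
    (congrArg norm (hval a b)).trans (by
      rw [Real.norm_eq_abs, abs_mul, abs_of_nonneg (sq_nonneg c)])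
  have hnn : 0 ≤ ∑ a, ∑ b, ‖iteratedSum T v k x a b‖ := by positivity
  simp only [Finset.mul_sum, ← hentry]
  rw [Matrix.frobenius_norm_def, ← Real.sqrt_eq_rpow]
  simp only [Real.rpow_two]
  refine Real.sqrt_le_iff.2 ⟨hnn, le_trans (Finset.sum_le_sum fun a _ =>
    Finset.sum_sq_le_sq_sum_of_nonneg fun b _ => ?_)
    (Finset.sum_sq_le_sq_sum_of_nonneg fun a _ => ?_)⟩ <;> positivity

end coordinates

/-! ### The induced map of a nonuniformly expanding map -/

namespace IsNonuniformlyExpanding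

variable {Λ : Type*} [MetricSpace Λ] [MeasurableSpace Λ] {ρ : Measure Λ} {T : Λ → Λ} {Y : Set Λ}
  {α : Set (Set Λ)} {τ : Λ → ℕ} {β C₁ : ℝ} {η : ℝ≥0}

theorem isReturnTime (h : IsNonuniformlyExpanding ρ T Y α τ β C₁ η) : IsReturnTime α τ :=
  ⟨h.measurable_returnTime, h.returnTime_pos, h.returnTime_const⟩

theorem measurable_inducedMap (h : IsNonuniformlyExpanding ρ T Y α τ β C₁ η) :
    Measurable (inducedMap T τ) :=
  measurable_apply_returnTime (f := fun k => T^[k]) (fun k => h.nonsingular.measurable.iterate k)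
    h.measurable_returnTime

/-- Surjectivity up to null sets in measure form. Combined with the density 1/ζ₀ it gives the change
of variables `branch`. -/
theorem restrict_image_inter_preimage (h : IsNonuniformlyExpanding ρ T Y α τ β C₁ η) {a : Set Λ}
    (ha : a ∈ α) (E : Set Λ) :
    ρ.restrict Y (inducedMap T τ '' (a ∩ inducedMap T τ ⁻¹' E)) = ρ.restrict Y E := by
  obtain ⟨a', ha', Y', -, -, hY', -, hdiff, hbij⟩ := h.bijection a ha
  refine le_antisymm (measure_mono ?_) ?_
  · rintro _ ⟨x, ⟨-, hx⟩, rfl⟩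
    exact hx
  · have hsub : E ∩ Y' ⊆ inducedMap T τ '' (a ∩ inducedMap T τ ⁻¹' E) := by
      rintro z ⟨hzE, hzY⟩
      obtain ⟨x, hx, rfl⟩ := hbij.surjOn hzY
      exact ⟨x, ⟨ha' hx, hzE⟩, rfl⟩
    have hnull : ρ.restrict Y (E \ Y') = 0 := by
      refine measure_mono_null (show E \ Y' ⊆ Y'ᶜ from fun z hz => hz.2) ?_
      rw [Measure.restrict_apply' h.measurableSet_Y, inter_comm, ← sdiff_eq]
      exact hdiff
    calc ρ.restrict Y E ≤ ρ.restrict Y (E ∩ Y') + ρ.restrict Y (E \ Y') := by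
          nth_rw 1 [← inter_union_sdiff E Y']
          exact measure_union_le _ _
      _ ≤ _ := by rw [hnull, add_zero]; exact measure_mono hsub

/-- The reference measure is ρ|_Y normalized and the Jacobian is 1/ζ₀. Distances enter through their
power η, so the expansion β becomes the contraction β^{-η}. Any weaker constants are allowed, which
is what makes the final constant locally uniform. -/
theorem exists_isGibbsMarkov [BoundedSpace Λ] [IsFiniteMeasure ρ]
    (h : IsNonuniformlyExpanding ρ T Y α τ β C₁ η) {θ K t₀ : ℝ} (hK : C₁ ≤ K)
    (hθ : β ^ (-(η : ℝ)) ≤ θ) (hθ1 : θ < 1)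
    (ht : Metric.diam (univ : Set Λ) ^ (η : ℝ) ≤ t₀) :
    ∃ j, IsGibbsMarkov ((ρ Y)⁻¹ • ρ.restrict Y) (inducedMap T τ) α j η θ K t₀ := by
  obtain ⟨ζ, hζm, hζ⟩ := h.distortion
  have hβ : 0 < β := one_pos.trans h.one_lt_beta
  have hη : (0 : ℝ) < η := h.eta_pos
  have hη1 : (η : ℝ) ≤ 1 := by exact_mod_cast h.eta_le_one
  have hdiam : ∀ x y : Λ, dist x y ≤ Metric.diam (univ : Set Λ) := fun x y =>
    Metric.dist_le_diam_of_mem (Bornology.isBounded_univ.2 inferInstance) (mem_univ x) (mem_univ y)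
  have hC : 1 ≤ C₁ := h.one_le_C₁
  refine ⟨fun x => ENNReal.ofReal (1 / ζ x), h.measurable_inducedMap, h.countable_partition,
    h.measurableSet_of_mem, h.pairwiseDisjoint, ?_, (Real.rpow_nonneg hβ.le _).trans hθ, hθ1,
    by linarith, fun a ha x hx y hy => ?_, fun a ha E hE => ?_, fun a ha x hx y hy => ?_,
    fun x y => (Real.rpow_le_rpow dist_nonneg (hdiam x y) hη.le).trans ht,
    (Real.rpow_nonneg Metric.diam_nonneg _).trans ht,
    Metric.diam (univ : Set Λ) ^ (1 - (η : ℝ)), Real.rpow_nonneg Metric.diam_nonneg _,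
    fun x y => ?_⟩
  · rw [Measure.smul_apply, Measure.restrict_apply' h.measurableSet_Y, inter_comm, ← sdiff_eq,
      h.measure_diff_partition, smul_zero]
  · have h1 : dist x y ≤ β⁻¹ * dist (inducedMap T τ x) (inducedMap T τ y) := by
      rw [← div_eq_inv_mul, le_div_iff₀ hβ, mul_comm]
      exact h.expansion a ha x hx y hy
    calc dist x y ^ (η : ℝ) ≤ (β⁻¹ * dist (inducedMap T τ x) (inducedMap T τ y)) ^ (η : ℝ) := by
          gcongr
      _ = β ^ (-(η : ℝ)) * dist (inducedMap T τ x) (inducedMap T τ y) ^ (η : ℝ) := by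
          rw [Real.mul_rpow (by positivity) dist_nonneg, Real.inv_rpow hβ.le, Real.rpow_neg hβ.le]
      _ ≤ _ := by gcongr
  · have hsub : a ∩ inducedMap T τ ⁻¹' E ⊆ Y := inter_subset_left.trans (h.subset_of_mem a ha)
    rw [Measure.restrict_smul, lintegral_smul_measure, Measure.restrict_restrict_of_subset hsub,
      ← (hζ a ha).2.1 _ inter_subset_left
        ((h.measurableSet_of_mem a ha).inter (h.measurable_inducedMap hE)),
      h.restrict_image_inter_preimage ha, Measure.smul_apply]
  · have hx0 := (hζ a ha).1 x hx
    have hy0 := (hζ a ha).1 y hy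
    rw [← ENNReal.ofReal_mul (Real.exp_nonneg _)]
    refine ENNReal.ofReal_le_ofReal ?_
    have h1 := (abs_le.1 ((hζ a ha).2.2 x hx y hy)).1
    have h2 : C₁ * dist (inducedMap T τ x) (inducedMap T τ y) ^ (η : ℝ)
        ≤ K * dist (inducedMap T τ x) (inducedMap T τ y) ^ (η : ℝ) := by gcongr
    rw [mul_one_div, div_le_div_iff₀ hx0 hy0, one_mul]
    calc ζ y = Real.exp (Real.log (ζ y)) := (Real.exp_log hy0).symm
      _ ≤ Real.exp (K * dist (inducedMap T τ x) (inducedMap T τ y) ^ (η : ℝ) + Real.log (ζ x)) :=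
          Real.exp_le_exp.2 (by linarith)
      _ = _ := by rw [Real.exp_add, Real.exp_log hx0]
  · rcases eq_or_ne x y with rfl | hxy
    · rw [dist_self, Real.zero_rpow hη.ne', mul_zero]
    · have hd : 0 < dist x y := dist_pos.2 hxy
      calc dist x y = dist x y ^ (1 - (η : ℝ)) * dist x y ^ (η : ℝ) := by
            rw [← Real.rpow_add hd, sub_add_cancel, Real.rpow_one]
        _ ≤ _ := by
            gcongr
            exact hdiam x y

theorem isProbabilityMeasure_smul_restrict [IsFiniteMeasure ρ]
    (h : IsNonuniformlyExpanding ρ T Y α τ β C₁ η) :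
    IsProbabilityMeasure ((ρ Y)⁻¹ • ρ.restrict Y) := by
  refine ⟨?_⟩
  rw [Measure.smul_apply, Measure.restrict_apply_univ, smul_eq_mul]
  exact ENNReal.inv_mul_cancel h.measure_Y_pos.ne' (measure_ne_top _ _)

theorem dist_iterate_rpow_le (h : IsNonuniformlyExpanding ρ T Y α τ β C₁ η) {K : ℝ} (hK : C₁ ≤ K) :
    ∀ a ∈ α, ∀ x ∈ a, ∀ y ∈ a, ∀ l < τ x, dist (T^[l] x) (T^[l] y) ^ (η : ℝ)
      ≤ K * dist (inducedMap T τ x) (inducedMap T τ y) ^ (η : ℝ) := by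
  intro a ha x hx y hy l hl
  have hC : 1 ≤ C₁ := h.one_le_C₁
  have hη1 : (η : ℝ) ≤ 1 := by exact_mod_cast h.eta_le_one
  calc dist (T^[l] x) (T^[l] y) ^ (η : ℝ)
      ≤ (C₁ * dist (inducedMap T τ x) (inducedMap T τ y)) ^ (η : ℝ) := by
        gcongr; exact h.intermediate a ha x hx y hy l hl
    _ = C₁ ^ (η : ℝ) * dist (inducedMap T τ x) (inducedMap T τ y) ^ (η : ℝ) :=
        Real.mul_rpow (by linarith) dist_nonneg
    _ ≤ _ := by
        gcongr
        exact (Real.rpow_le_self_of_one_le hC hη1).trans hK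

end IsNonuniformlyExpanding

/-! ### Iterated moments -/

/-- The constant in the moment estimates, for parameters which are bounded by `δ`, `K`, `b`, `e`,
`P`, `N`. -/
noncomputable def momentConst (d : ℕ) (δ K b e P N : ℝ) : ℝ :=
  let R := 3 * K / (1 - b ^ (-e))
  let t₀ := max δ 1
  let B := max N 1 ^ P
  let D := Real.exp (2 * R * t₀)
  let c₀ := Real.exp (-(2 * R * t₀)) * (K / R)
  max 1 ((d : ℝ) ^ 2 * towerConst (1 + B + 2 * (5 * B * D / c₀)) D B (2 * P))

theorem abs_maxUpTo_le {Λ : Type*} {f : ℕ → Λ → ℝ} {n : ℕ} {x : Λ} {c : ℝ}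
    (h : ∀ k ≤ n, |f k x| ≤ c) : |maxUpTo f n x| ≤ c := by
  refine abs_le.2 ⟨?_, ?_⟩
  · exact (abs_le.1 (h 0 (Nat.zero_le _))).1.trans
      (Finset.le_sup' (fun k => f k x) (Finset.mem_range.2 (Nat.succ_pos n)))
  · exact Finset.sup'_le _ _ fun k hk =>
      (abs_le.1 (h k (Nat.lt_succ_iff.1 (Finset.mem_range.1 hk)))).2

theorem ae_one_le_returnTime {Λ : Type*} [MetricSpace Λ] [MeasurableSpace Λ] {ρ : Measure Λ}
    {T : Λ → Λ} {Y : Set Λ} {α : Set (Set Λ)} {τ : Λ → ℕ} {β C₁ : ℝ} {η : ℝ≥0} {μY : Measure Λ}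
    (h : IsNonuniformlyExpanding ρ T Y α τ β C₁ η) (hμY : IsInducedACIP ρ T Y τ μY) :
    ∀ᵐ y ∂μY, 1 ≤ τ y := by
  have hae : ∀ᵐ x ∂μY, x ∈ ⋃₀ α := hμY.absolutelyContinuous.ae_le
    (show ∀ᵐ x ∂ρ.restrict Y, x ∈ ⋃₀ α by
      rw [ae_iff, Measure.restrict_apply' h.measurableSet_Y, inter_comm]
      exact h.measure_diff_partition)
  filter_upwards [hae] with x hx
  obtain ⟨a, ha, hxa⟩ := hx
  exact h.returnTime_pos a ha x hxa

/-- Places the parameter |τ|_p in the domain on which the constant is continuous. -/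
theorem one_le_eLpNorm_returnTime {Λ : Type*} [MetricSpace Λ] [MeasurableSpace Λ] {ρ : Measure Λ}
    {T : Λ → Λ} {Y : Set Λ} {α : Set (Set Λ)} {τ : Λ → ℕ} {β C₁ : ℝ} {η : ℝ≥0} {μY : Measure Λ}
    {p : ℝ} (h : IsNonuniformlyExpanding ρ T Y α τ β C₁ η) (hμY : IsInducedACIP ρ T Y τ μY)
    (hp : 0 < p) (hτ : MemLp (fun y => (τ y : ℝ)) (ENNReal.ofReal p) μY) :
    1 ≤ (eLpNorm (fun y => (τ y : ℝ)) (ENNReal.ofReal p) μY).toReal := by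
  have := hμY.isProbabilityMeasure
  have h1 : eLpNorm (fun _ : Λ => (1 : ℝ)) (ENNReal.ofReal p) μY = 1 := by
    rw [eLpNorm_const _ (by simpa using hp) (NeZero.ne μY)]
    simp
  rw [← ENNReal.toReal_one, ← h1]
  refine ENNReal.toReal_mono hτ.2.ne (eLpNorm_mono_ae ?_)
  filter_upwards [ae_one_le_returnTime h hμY] with y hy
  simpa using hy

/-- The moment estimates, with a constant which is uniform over bounded sets of parameters. -/
theorem eLpNorm_maxUpTo_le {d : ℕ} {Λ : Type*} [MetricSpace Λ] [BoundedSpace Λ]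
    [MeasurableSpace Λ] [BorelSpace Λ] {ρ : Measure Λ} [IsFiniteMeasure ρ] {T : Λ → Λ}
    {Y : Set Λ} {α : Set (Set Λ)} {τ : Λ → ℕ} {β C₁ : ℝ} {η : ℝ≥0} {μY : Measure Λ} {p : ℝ}
    {v : Λ → EuclideanSpace ℝ (Fin d)} (h : IsNonuniformlyExpanding ρ T Y α τ β C₁ η)
    (hμY : IsInducedACIP ρ T Y τ μY) (hp : 2 ≤ p)
    (hτ : MemLp (fun y => (τ y : ℝ)) (ENNReal.ofReal p) μY) (hv : holderNormFull η v < ∞)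
    (hv0 : ∫ x, v x ∂(projectedMeasure T τ μY) = 0) {n : ℕ} (hn : 1 ≤ n) {δ K b e P N : ℝ}
    (hδ : Metric.diam (univ : Set Λ) ≤ δ) (hK : C₁ ≤ K) (hb : 1 < b) (hbβ : b ≤ β) (he : 0 < e)
    (heη : e ≤ η) (hP : p ≤ P)
    (hN : (eLpNorm (fun y => (τ y : ℝ)) (ENNReal.ofReal p) μY).toReal ≤ N) {C : ℝ≥0}
    (hC : momentConst d δ K b e P N ≤ C) :
    eLpNorm (maxUpTo (fun k x => ‖birkhoffSum T v k x‖) n)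
        (ENNReal.ofReal (2 * (p - 1))) (projectedMeasure T τ μY)
      ≤ C * (n : ℝ≥0∞) ^ (1 / 2 : ℝ) * holderNormFull η v ∧
    eLpNorm (maxUpTo (fun k x => ‖iteratedSum T v k x‖) n)
        (ENNReal.ofReal (p - 1)) (projectedMeasure T τ μY)
      ≤ C * (n : ℝ≥0∞) * holderNormFull η v ^ 2 := by
  have hp0 : 0 < p := by linarith
  have hr0 : 0 < p - 1 := by linarith
  have hη0 : (0 : ℝ) < η := h.eta_pos
  have hη1 : (η : ℝ) ≤ 1 := by exact_mod_cast h.eta_le_one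
  have hC₁ := h.one_le_C₁
  have hK0 : 0 < K := by linarith
  have := hμY.isProbabilityMeasure
  have := h.isProbabilityMeasure_smul_restrict
  have hT := h.nonsingular.measurable
  have hρY0 : (ρ Y)⁻¹ ≠ 0 := ENNReal.inv_ne_zero.2 (measure_ne_top _ _)
  have hμm : μY ≪ (ρ Y)⁻¹ • ρ.restrict Y :=
    hμY.absolutelyContinuous.trans (Measure.absolutelyContinuous_smul hρY0)
  set θ := b ^ (-e) with hθ
  have hθ1 : θ < 1 := Real.rpow_lt_one_of_one_lt_of_neg hb (by linarith)
  have hβθ : β ^ (-(η : ℝ)) ≤ θ := by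
    calc β ^ (-(η : ℝ)) ≤ b ^ (-(η : ℝ)) :=
          Real.rpow_le_rpow_of_nonpos (by linarith) hbβ (by linarith)
      _ ≤ b ^ (-e) := Real.rpow_le_rpow_of_exponent_le hb.le (by linarith)
  set t₀ := max δ 1 with ht₀
  have ht₀1 : 1 ≤ t₀ := le_max_right _ _
  have hdiam : Metric.diam (univ : Set Λ) ^ (η : ℝ) ≤ t₀ := by
    calc Metric.diam (univ : Set Λ) ^ (η : ℝ) ≤ t₀ ^ (η : ℝ) := by
          have := Metric.diam_nonneg (s := (univ : Set Λ))
          gcongr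
          exact hδ.trans (le_max_left _ _)
      _ ≤ t₀ := Real.rpow_le_self_of_one_le ht₀1 hη1
  obtain ⟨j, hG⟩ := h.exists_isGibbsMarkov hK hβθ hθ1 hdiam
  set B := max N 1 ^ P with hBdef
  have hint : Integrable (fun x => (τ x : ℝ) ^ p) μY := by
    have := hτ.integrable_norm_rpow (by simpa using hp0) ENNReal.ofReal_ne_top
    rw [ENNReal.toReal_ofReal hp0.le] at this
    simpa using this
  have hB1 : 1 ≤ B := Real.one_le_rpow (le_max_right _ _) (by linarith)
  have hB : ∫ x, (τ x : ℝ) ^ p ∂μY ≤ B := by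
    have h0 : 0 ≤ ∫ x, (τ x : ℝ) ^ p ∂μY := integral_nonneg fun x => by positivity
    have h1 : (eLpNorm (fun y => (τ y : ℝ)) (ENNReal.ofReal p) μY).toReal
        = (∫ x, (τ x : ℝ) ^ p ∂μY) ^ p⁻¹ := by
      rw [hτ.eLpNorm_eq_integral_rpow_norm (by simpa using hp0) ENNReal.ofReal_ne_top,
        ENNReal.toReal_ofReal hp0.le, ENNReal.toReal_ofReal (by positivity)]
      simp
    rw [h1] at hN
    calc ∫ x, (τ x : ℝ) ^ p ∂μY = ((∫ x, (τ x : ℝ) ^ p ∂μY) ^ p⁻¹) ^ p := by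
          rw [← Real.rpow_mul h0, inv_mul_cancel₀ hp0.ne', Real.rpow_one]
      _ ≤ max N 1 ^ p := by gcongr; exact hN.trans (le_max_left _ _)
      _ ≤ B := Real.rpow_le_rpow_of_exponent_le (le_max_right _ _) hP
  have hτm := h.measurable_returnTime
  have hc1 : 1 ≤ ∫⁻ y, (τ y : ℝ≥0∞) ∂μY := by
    calc (1 : ℝ≥0∞) = ∫⁻ y, 1 ∂μY := by simp
      _ ≤ ∫⁻ y, (τ y : ℝ≥0∞) ∂μY := by
        refine lintegral_mono_ae ?_
        filter_upwards [ae_one_le_returnTime h hμY] with x hx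
        exact_mod_cast hx
  have hctop : ∫⁻ y, (τ y : ℝ≥0∞) ∂μY ≠ ∞ := by
    have h1 : Integrable (fun y => (τ y : ℝ)) μY :=
      hτ.integrable (by rw [← ENNReal.ofReal_one]; exact ENNReal.ofReal_le_ofReal (by linarith))
    have := h1.2.ne
    simpa [HasFiniteIntegral] using this
  have := isFiniteMeasure_projectedMeasure hτm hT hc1 hctop
  set c := (holderNormFull η v).toReal with hc
  have hcv : holderNormFull η v = ENNReal.ofReal c := (ENNReal.ofReal_toReal hv.ne).symm
  have hc0 : 0 ≤ c := ENNReal.toReal_nonneg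
  have hbound : ∀ x, ‖v x‖ ≤ c := norm_le_holderNormFull hv
  have hcont : Continuous v := continuous_of_holderNormFull_lt_top h.eta_pos hv
  set u := scaledCoord c v with hu
  have hvi : Integrable v (projectedMeasure T τ μY) :=
    Integrable.of_bound hcont.measurable.aestronglyMeasurable c (.of_forall hbound)
  have hum : ∀ a, Measurable (u a) := fun a => by
    have : Continuous fun x => v x a := (EuclideanSpace.proj a).continuous.comp hcont
    exact this.measurable.div_const c
  have hu1 : ∀ a x, |u a x| ≤ 1 := fun a => abs_scaledCoord_le hbound a
  have huη : ∀ a x y, u a x - u a y ≤ dist x y ^ (η : ℝ) := fun a x y => by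
    rw [hu, scaledCoord, scaledCoord, ← sub_div]
    refine div_le_of_le_mul₀ hc0 (by positivity) ?_
    have h1 := PiLp.norm_apply_le (v x - v y) a
    rw [PiLp.sub_apply, Real.norm_eq_abs] at h1
    rw [mul_comm]
    exact (le_abs_self _).trans (h1.trans (norm_sub_le_holderNormFull hv x y))
  have hu0 : ∀ a, ∫ y, birkhoffSum T (u a) (τ y) y ∂μY = 0 := fun a => by
    refine integral_birkhoffSum_returnTime_eq_zero hT hτm hctop (hum a) (hu1 a) ?_
    have : ∫ x, v x a ∂(projectedMeasure T τ μY) = 0 := by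
      have h1 := (EuclideanSpace.proj (𝕜 := ℝ) a).integral_comp_comm hvi
      rw [hv0, map_zero] at h1
      exact h1
    rw [hu]
    simp only [scaledCoord]
    rw [integral_div, this, zero_div]
  set R := 3 * K / (1 - θ) with hR
  set D := Real.exp (2 * R * t₀) with hD
  set c₀ := Real.exp (-(2 * R * t₀)) * (K / R) with hc₀
  set A := towerConst (1 + B + 2 * (5 * B * D / c₀)) D B (2 * P) with hA
  have hCA : max 1 ((d : ℝ) ^ 2 * A) ≤ C := hC
  choose Ψ hΨb hΨ hΨA using fun a b : Fin d =>
    exists_tower_dominating_function hG hμm hμY.invariant hR hc₀ h.isReturnTime hT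
      (h.dist_iterate_rpow_le hK) hp (by linarith : 2 * (p - 1) ≤ 2 * P) hint hB hB1 hD rfl hn
      (hum a) (hum b) (hu1 a) (hu1 b) (huη a) (huη b) (hu0 a) (hu0 b)
  -- One dominating function for each pair of coordinates; the triangle inequality in L^{p-1}, where
  -- p - 1 ≥ 1, produces the factor d².
  set Θ : Λ → ℝ := fun y => c ^ 2 * ∑ a, ∑ b, Ψ a b y with hΘ
  have hΘm : Measurable Θ := by
    refine Measurable.const_mul (Finset.measurable_sum _ fun a _ =>
      Finset.measurable_sum _ fun b _ => (hΨb a b).1) _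
  have hΨae : ∀ᵐ y ∂μY, ∀ a b, ∀ l < τ y, ∀ k ≤ n, birkhoffSum T (u a) k (T^[l] y) ^ 2 ≤ Ψ a b y ∧
      |iteratedBirkhoffSum T (u a) (u b) k (T^[l] y)| ≤ Ψ a b y :=
    ae_all_iff.2 fun a => ae_all_iff.2 fun b => hΨ a b
  have hΘA : eLpNorm Θ (ENNReal.ofReal (p - 1)) (μY.withDensity fun y => (τ y : ℝ≥0∞))
      ≤ C * (n : ℝ≥0∞) * holderNormFull η v ^ 2 := by
    have hΘeq : Θ = c ^ 2 • ∑ z : Fin d × Fin d, Ψ z.1 z.2 := by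
      funext y
      simp [hΘ, Fintype.sum_prod_type, Finset.sum_apply]
    have hr1 : 1 ≤ ENNReal.ofReal (p - 1) := by
      rw [← ENNReal.ofReal_one]; exact ENNReal.ofReal_le_ofReal (by linarith)
    rw [hΘeq, eLpNorm_const_smul, hcv, Real.enorm_eq_ofReal (sq_nonneg c),
      ← ENNReal.ofReal_pow hc0, mul_comm]
    gcongr
    refine (eLpNorm_sum_le (fun z _ => (hΨb z.1 z.2).1.aestronglyMeasurable) hr1).trans ?_
    refine (Finset.sum_le_card_nsmul _ _ _ fun z _ => hΨA z.1 z.2).trans ?_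
    rw [Finset.card_univ, Fintype.card_prod, Fintype.card_fin, nsmul_eq_mul, ← mul_assoc]
    gcongr
    rw [← ENNReal.ofReal_natCast, ← ENNReal.ofReal_mul (by positivity)]
    refine (ENNReal.ofReal_le_ofReal ?_).trans_eq ENNReal.ofReal_coe_nnreal
    refine le_trans (le_of_eq ?_) ((le_max_right _ _).trans hCA)
    push_cast; ring
  constructor
  -- The same Θ dominates the squared maximum of |S_k v|, and the L^{p-1} norm of a square is the
  -- square of the L^{2(p-1)} norm.
  · have h1 := eLpNorm_projectedMeasure_le (T := T) hτm hc1 hr0 hΘm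
      (G := fun x => ‖maxUpTo (fun k x => ‖birkhoffSum T v k x‖) n x‖ ^ (2 : ℝ)) (by
        filter_upwards [hΨae] with y hy l hl
        rw [Real.rpow_two, abs_of_nonneg (sq_nonneg _), Real.norm_eq_abs]
        have hΘ0 : 0 ≤ Θ y := by
          refine mul_nonneg (sq_nonneg _) (Finset.sum_nonneg fun a _ => Finset.sum_nonneg fun b _ =>
            (sq_nonneg _).trans (hy a b l hl 0 (Nat.zero_le _)).1)
        refine (sq_le_sq₀ (abs_nonneg _) (Real.sqrt_nonneg (Θ y))).2
          (abs_maxUpTo_le fun k hk => ?_) |>.trans (Real.sq_sqrt hΘ0).le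
        rw [abs_norm]
        refine Real.le_sqrt_of_sq_le ?_
        rw [norm_birkhoffSum_sq hbound]
        refine mul_le_mul_of_nonneg_left (Finset.sum_le_sum fun a _ => ?_) (sq_nonneg c)
        refine (hy a a l hl k hk).1.trans (Finset.single_le_sum (f := fun b => Ψ a b y)
          (fun b _ => (sq_nonneg _).trans (hy a b l hl 0 (Nat.zero_le _)).1) (Finset.mem_univ a)))
    rw [eLpNorm_norm_rpow _ two_pos, ← ENNReal.ofReal_mul hr0.le, mul_comm (p - 1)] at h1
    have h2 := ENNReal.rpow_le_rpow (h1.trans hΘA) (by norm_num : (0 : ℝ) ≤ 1 / 2)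
    rw [← ENNReal.rpow_mul, mul_one_div_cancel two_ne_zero, ENNReal.rpow_one,
      ENNReal.mul_rpow_of_nonneg _ _ (by norm_num), ENNReal.mul_rpow_of_nonneg _ _ (by norm_num),
      ← ENNReal.rpow_two, ← ENNReal.rpow_mul, mul_one_div_cancel two_ne_zero,
      ENNReal.rpow_one] at h2
    refine h2.trans ?_
    gcongr
    -- The square root of C is at most C because `momentConst` is at least 1.
    refine (ENNReal.rpow_le_rpow_of_exponent_le (y := 1 / 2) (z := 1) ?_ (by norm_num)).trans
      (ENNReal.rpow_one _).le
    exact_mod_cast (le_max_left _ _).trans hCA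
  · refine le_trans (eLpNorm_projectedMeasure_le hτm hc1 hr0 hΘm ?_) hΘA
    filter_upwards [hΨae] with y hy l hl
    refine abs_maxUpTo_le fun k hk => ?_
    rw [abs_norm]
    refine (norm_iteratedSum_le hbound _ _ _).trans ?_
    exact mul_le_mul_of_nonneg_left (Finset.sum_le_sum fun a _ => Finset.sum_le_sum fun b _ =>
      (hy a b l hl k hk).2) (sq_nonneg c)

/-! ### A constant depending continuously on the parameters. -/

/-- `C` is at least `momentConst` for some bounds on the parameters
`z = (diam Λ, C₁, β, η, p, |τ|_p)`. -/
def IsAdmissibleConst (d : ℕ) (z : ℝ × ℝ × ℝ × ℝ × ℝ × ℝ) (C : ℝ) : Prop :=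
  ∃ δ K b e P N : ℝ, z.1 ≤ δ ∧ z.2.1 ≤ K ∧ 1 < b ∧ b ≤ z.2.2.1 ∧ 0 < e ∧ e ≤ z.2.2.2.1 ∧
    z.2.2.2.2.1 ≤ P ∧ z.2.2.2.2.2 ≤ N ∧ momentConst d δ K b e P N ≤ C

/-- Admissible constants form an upward closed, hence convex, set, and a single constant is
admissible near each parameter. A partition of unity glues these local constants, so continuity of
`momentConst` itself plays no role. -/
theorem exists_continuousOn_isAdmissibleConst (d : ℕ) {S : Set (ℝ × ℝ × ℝ × ℝ × ℝ × ℝ)}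
    (hβ : ∀ z ∈ S, 1 < z.2.2.1) (hη : ∀ z ∈ S, 0 < z.2.2.2.1) :
    ∃ C : ℝ × ℝ × ℝ × ℝ × ℝ × ℝ → ℝ≥0, ContinuousOn C S ∧
      ∀ z ∈ S, IsAdmissibleConst d z (C z) := by
  have hconv : ∀ z : S, Convex ℝ {C : ℝ | IsAdmissibleConst d z C} := fun z => by
    refine Set.OrdConnected.convex ⟨fun x hx y _ w hw => ?_⟩
    obtain ⟨δ, K, b, e, P, N, h1, h2, h3, h4, h5, h6, h7, h8, h9⟩ := hx
    exact ⟨δ, K, b, e, P, N, h1, h2, h3, h4, h5, h6, h7, h8, h9.trans hw.1⟩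
  have hloc : ∀ z : S, ∃ C, ∀ᶠ y : S in nhds z, C ∈ {C : ℝ | IsAdmissibleConst d y C} := fun z => by
    obtain ⟨⟨x₁, x₂, x₃, x₄, x₅, x₆⟩, hz⟩ := z
    have h3 : 1 < x₃ := hβ _ hz
    have h4 : 0 < x₄ := hη _ hz
    -- Parameters bounded from above are enlarged by 1; β and η are bounded from below, by values
    -- still above 1 and 0.
    refine ⟨momentConst d (x₁ + 1) (x₂ + 1) ((1 + x₃) / 2) (x₄ / 2) (x₅ + 1) (x₆ + 1), ?_⟩
    have c1 : Continuous fun y : S => y.1.1 := by fun_prop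
    have c2 : Continuous fun y : S => y.1.2.1 := by fun_prop
    have c3 : Continuous fun y : S => y.1.2.2.1 := by fun_prop
    have c4 : Continuous fun y : S => y.1.2.2.2.1 := by fun_prop
    have c5 : Continuous fun y : S => y.1.2.2.2.2.1 := by fun_prop
    have c6 : Continuous fun y : S => y.1.2.2.2.2.2 := by fun_prop
    filter_upwards [c1.continuousAt.eventually_lt_const (lt_add_one x₁),
      c2.continuousAt.eventually_lt_const (lt_add_one x₂),
      c3.continuousAt.eventually_const_lt (by linarith : (1 + x₃) / 2 < x₃),
      c4.continuousAt.eventually_const_lt (by linarith : x₄ / 2 < x₄),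
      c5.continuousAt.eventually_lt_const (lt_add_one x₅),
      c6.continuousAt.eventually_lt_const (lt_add_one x₆)] with y y1 y2 y3 y4 y5 y6
    exact ⟨_, _, _, _, _, _, y1.le, y2.le, by linarith, y3.le, by linarith, y4.le, y5.le, y6.le,
      le_rfl⟩
  obtain ⟨g, hg⟩ := exists_continuous_forall_mem_convex_of_local_const hconv hloc
  classical
  refine ⟨fun z => if h : z ∈ S then (g ⟨z, h⟩).toNNReal else 0, ?_, fun z hz => ?_⟩
  · rw [continuousOn_iff_continuous_domRestrict]
    have : S.domRestrict (fun z => if h : z ∈ S then (g ⟨z, h⟩).toNNReal else 0)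
        = fun z => (g z).toNNReal := by
      ext z; simp [Set.domRestrict]
    rw [this]
    exact continuous_real_toNNReal.comp g.continuous
  · beta_reduce
    rw [dif_pos hz]
    obtain ⟨δ, K, b, e, P, N, h1, h2, h3, h4, h5, h6, h7, h8, h9⟩ := hg ⟨z, hz⟩
    exact ⟨δ, K, b, e, P, N, h1, h2, h3, h4, h5, h6, h7, h8, h9.trans (Real.le_coe_toNNReal _)⟩

/-- The constant `C` is a continuous function of
`(diam Λ, C₁, β, η, p, |τ|_p)`; the sum `S_k v` is `birkhoffSum T v k`. -/
theorem mainTheorem1 (d : ℕ) :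
    ∃ C : ℝ × ℝ × ℝ × ℝ × ℝ × ℝ → ℝ≥0,
      ContinuousOn C
        (Ici 0 ×ˢ Ici 1 ×ˢ Ioi 1 ×ˢ Ioc 0 1 ×ˢ Ici 2 ×ˢ Ici 1) ∧
      ∀ (Λ : Type*) [MetricSpace Λ] [BoundedSpace Λ] [MeasurableSpace Λ] [BorelSpace Λ]
        (ρ : Measure Λ) [IsFiniteMeasure ρ]
        (T : Λ → Λ) (Y : Set Λ) (α : Set (Set Λ)) (τ : Λ → ℕ) (β C₁ : ℝ) (η : ℝ≥0)
        (μY : Measure Λ) (p : ℝ) (v : Λ → EuclideanSpace ℝ (Fin d)),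
        IsNonuniformlyExpanding ρ T Y α τ β C₁ η →
        IsInducedACIP ρ T Y τ μY →
        2 ≤ p →
        MemLp (fun y => (τ y : ℝ)) (ENNReal.ofReal p) μY →
        holderNormFull η v < ∞ →
        ∫ x, v x ∂(projectedMeasure T τ μY) = 0 →
        ∀ n : ℕ, 1 ≤ n →
          eLpNorm (maxUpTo (fun k x => ‖birkhoffSum T v k x‖) n)
              (ENNReal.ofReal (2 * (p - 1))) (projectedMeasure T τ μY)
            ≤ C (Metric.diam (univ : Set Λ), C₁, β, (η : ℝ), p,
                  (eLpNorm (fun y => (τ y : ℝ)) (ENNReal.ofReal p) μY).toReal)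
              * (n : ℝ≥0∞) ^ (1 / 2 : ℝ) * holderNormFull η v ∧
          eLpNorm (maxUpTo (fun k x => ‖iteratedSum T v k x‖) n)
              (ENNReal.ofReal (p - 1)) (projectedMeasure T τ μY)
            ≤ C (Metric.diam (univ : Set Λ), C₁, β, (η : ℝ), p,
                  (eLpNorm (fun y => (τ y : ℝ)) (ENNReal.ofReal p) μY).toReal)
              * (n : ℝ≥0∞) * holderNormFull η v ^ 2 := by
  obtain ⟨C, hCc, hC⟩ := exists_continuousOn_isAdmissibleConst d
    (S := Ici 0 ×ˢ Ici 1 ×ˢ Ioi 1 ×ˢ Ioc 0 1 ×ˢ Ici 2 ×ˢ Ici 1)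
    (fun z hz => hz.2.2.1) (fun z hz => hz.2.2.2.1.1)
  refine ⟨C, hCc, ?_⟩
  intro Λ _ _ _ _ ρ _ T Y α τ β C₁ η μY p v h hμY hp hτ hv hv0 n hn
  have hτ1 : 1 ≤ (eLpNorm (fun y => (τ y : ℝ)) (ENNReal.ofReal p) μY).toReal :=
    one_le_eLpNorm_returnTime h hμY (by linarith) hτ
  obtain ⟨δ, K, b, e, P, N, h1, h2, h3, h4, h5, h6, h7, h8, h9⟩ := hC
    (Metric.diam (univ : Set Λ), C₁, β, (η : ℝ), p,
      (eLpNorm (fun y => (τ y : ℝ)) (ENNReal.ofReal p) μY).toReal)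
    ⟨Metric.diam_nonneg, h.one_le_C₁, h.one_lt_beta,
      ⟨by exact_mod_cast h.eta_pos, by exact_mod_cast h.eta_le_one⟩, hp, hτ1⟩
  exact eLpNorm_maxUpTo_le h hμY hp hτ hv hv0 hn h1 h2 h3 h4 h5 h6 h7 h8 h9
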